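/- Let $n\ge 0$. A $2$-Dyck path of length $3n$ is a sequence of $2n$ up-steps $\nearrow$ ($+1$) and $n$ down-steps $\searrow$ ($-2$) all of whose partial sums (heights) are $\ge 0$. A non-crossing spanning tree (NCST) with $n$ edges is a spanning tree on the points $0,1,\dots,n$ with edges $(a,b)$, $a<b$, such that there are no edges $(a,b)$, $(c,d)$ with $a<c<b<d$. Write $[n]=\{1,\dots,n\}$. *Chains.* For $2$-Dyck paths $I\ne F$, $P_{\mathrm{AM}}(I,F)=\frac1{6n-2}$ if $F$ arises from $I$ by swapping two adjacent steps, and $P_{\mathrm{AM}}(I,F)=0$ otherwise; the move is to the Left if it replaces $\nearrow\searrow$ with $\searrow\nearrow$, and to the Right otherwise. $P_{\mathrm{FM}}(S,T)$ is the probability of going from the NCST $S$ to the NCST $T$ when one removes a uniformly random edge of $S$ and then adds a uniformly random edge among all those that give an NCST (possibly the removed one). *Correspondence.* The empty path corresponds to the one-point tree. A non-empty path is uniquely $\nearrow A\nearrow B\searrow C$ with $2$-Dyck paths $A,B,C$ (of lengths $3|A|,3|B|,3|C|$); its tree, drawn from the point $o$ on, consists of the edge $(o,t)$ with $t=o+|A|+|B|+1$,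 the tree of $A$ on $[o,g]$ with $g=o+|A|$, the tree of $B$ on $[g+1,t]$, and the tree of $C$ from $t$ on. One says that the gap beneath $(o,t)$ is $g,g+1$. The tree of a path $I$, with $o=0$, is $T_I$. *Shifting.* $\mathrm{ShiftRight}$ at depth $\delta$ moves a tree on $[s,t-1]$ that lies beneath an edge $(s,t)$ with gap $t-1,t$ to $[s+1,t]$. It processes the minimal segments (the subtrees $[p,q]$ spanned beneath the edges $e=(p,q)$ whose next enclosing edge is $(s,t)$) from right to left. For the segment with edge $e=(p,q)$ and gap $g,g+1$ beneath $e$ it does, in this order: if $q\ge g+2$, move $e$ to $(p,g+1)$; if $p\le g-1$, call $\mathrm{ShiftRight}$ at depth $\delta+1$ for the tree on $[p,g]$ beneath $(p,g+1)$; move $e$ from $(p,g+1)$ to $(g+1,q+1)$; if $q\ge g+2$, call $\mathrm{ShiftRight}$ at depth $\delta+1$ for the tree on $[g+1,q]$ beneath $(g+1,q+1)$; if $p\le g-1$, move $e$ from $(g+1,q+1)$ to $(p+1,q+1)$. $\mathrm{ShiftLeft}$ is the reverse sequence, with the same depths. *Canonical paths.* Let $I\neq F$ with $P_{\mathrm{AM}}(I,F)>0$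 be a move to the Left that replaces the steps $\nearrow\searrow$ numbered $x$ and $y=x+1$ with $\searrow\nearrow$. Let $y'$ be the first position after $y$ whose height is one (Type 1) or two (Type 2) below that at $y$, and $x'$ the last position before $x$ with the same height as $y'$. Let $e$ be the edge of $T_I$ belonging to the down-step $y$, with gap $g_e,g_e+1$, and $a=(a_1,a_2)$ the edge belonging to the down-step that ends at $y'$, with gap $g_a,g_a+1$. - Type 1: the part between $x'$ and $y'$ is $\nearrow A_1\nearrow A_2\nearrow\searrow B_1\nearrow B_2\searrow$, and $e=(p,g_e+1)$, with the tree of $A_2$ on $[p,g_e]$. The canonical path starts at $T_I$ and performs $S_1$: $\mathrm{ShiftRight}$ at depth $1$ of the tree of $A_2$ beneath $e$ (if $A_2$ is non-empty); $M_1$: move $e$ to $(a_1,g_e+1)$; $M_2$: move $a$ to $(g_e+1,a_2)$. - Type 2: the part between $x'$ and $y'$ is $\nearrow A_1\nearrow A_2\nearrow A_3\nearrow\searrow B\searrow$, and $e=(q,g_e+1)$, with the tree of $A_2$ on $[g_a+1,q]$. The canonical path performs $M_3$: move $e$ to $(g_a,q)$; $S_2$: $\mathrm{ShiftLeft}$ at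 depth $1$ of the tree of $A_2$ to $[g_a,q-1]$ beneath $(g_a,q)$ (if $A_2$ is non-empty); $M_4$: move $e$ to $(g_a,g_e)$. For a move to the Right, the canonical path from $I$ to $F$ is the reverse of the one from $F$ to $I$, each transition keeping its type and depth. ($M_1$ is a loop $Z\to Z$ if $A_1$ is empty, and so is $M_4$ if $A_3$ is empty.) **Statement.** Let $Z,Z'$ be NCSTs with $n$ edges and $P_{\mathrm{FM}}(Z,Z')>0$, and let $\mathcal P$ be the set of pairs $(I,F)$ of $2$-Dyck paths of length $3n$ with $I\ne F$ and $P_{\mathrm{AM}}(I,F)>0$ whose canonical path contains the transition $Z\to Z'$. Call a map $$\varphi:\mathcal P\to\{\mathsf{Left},\mathsf{Right}\}\times\{M_1,M_2,M_3,M_4,S_1,S_2\}\times[n],\qquad \varphi(I,F)=(\mathsf{dir},M,d),$$ an encoding if, for every $(I,F)\in\mathcal P$, $\mathsf{dir}$ is the direction of the move $I\to F$, every occurrence of $Z\to Z'$ in the canonical path is of type $M$, and, if $M\in\{S_1,S_2\}$, every occurrence of $Z\to Z'$ is made by a recursive call of depth $d$ (for $M\in\{M_1,\dots,M_4\}$,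 $d\in[n]$ is arbitrary). Then: 1. there is an injective encoding; 2. if $Z\ne Z'$, every encoding is injective; 3. $|\mathcal P|\le 12n$. -/

import Mathlib

namespace FlipChain

/-! ## 2-Dyck paths -/

/-- An up-step (`+1`) or a down-step (`-2`). -/
inductive Step
  | up
  | down
  deriving DecidableEq

/-- The height change of a step. -/
def Step.val : Step → ℤ
  | .up => 1
  | .down => -2

/-- The height of a word after its first `j` steps. -/
def height (w : List Step) (j : ℕ) : ℤ := ((w.take j).map Step.val).sum

/-- The 2-Dyck paths of length `3 n`: all heights are nonnegative and the last one is zero. -/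
structure DyckPath (n : ℕ) where
  steps : List Step
  length_eq : steps.length = 3 * n
  height_nonneg : ∀ j, j ≤ 3 * n → 0 ≤ height steps j
  height_last : height steps (3 * n) = 0

/-! ## The adjacent move chain -/

/-- The paths different from `X` that are obtained from `X` by swapping two adjacent steps. -/
def adjacentMoves {n : ℕ} (X : DyckPath n) : Set (DyckPath n) :=
  {Y | Y ≠ X ∧ ∃ (P Q : List Step) (s t : Step),
    X.steps = P ++ s :: t :: Q ∧ Y.steps = P ++ t :: s :: Q}

open Classical in
/-- Transition probabilities of the adjacent move chain. -/
noncomputable def PAM {n : ℕ} (X Y : DyckPath n) : ℝ :=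
  if X = Y then 1 - ((adjacentMoves X).ncard : ℝ) / (6 * (n : ℝ) - 2)
  else if Y ∈ adjacentMoves X then 1 / (6 * (n : ℝ) - 2)
  else 0

/-! ## Non-crossing spanning trees and the flip chain -/

/-- An edge `(a, b)` joins the points `a` and `b`; in a tree `a < b`. -/
abbrev Edge := ℕ × ℕ

/-- The graph on the points `0, …, n` with a given set of edges. -/
def graphOf (n : ℕ) (T : Finset Edge) : SimpleGraph (Fin (n + 1)) :=
  SimpleGraph.fromRel fun i j => ((i : ℕ), (j : ℕ)) ∈ T

/-- `T` is the edge set of a non-crossing spanning tree on the points `0, …, n`. -/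
def IsNCST (n : ℕ) (T : Finset Edge) : Prop :=
  (∀ e ∈ T, e.1 < e.2 ∧ e.2 ≤ n) ∧
  (∀ e ∈ T, ∀ f ∈ T, ¬ (e.1 < f.1 ∧ f.1 < e.2 ∧ e.2 < f.2)) ∧
  (graphOf n T).IsTree

/-- The non-crossing spanning trees with `n` edges. -/
abbrev NCST (n : ℕ) := {T : Finset Edge // IsNCST n T}

/-- The number of edges that complete `X` to a non-crossing spanning tree. -/
noncomputable def completions (n : ℕ) (X : Finset Edge) : ℕ :=
  {f : Edge | IsNCST n (insert f X)}.ncard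

open Classical in
/-- Transition probabilities of the flip chain: remove a uniformly random edge `e` of `S`, then
add back a uniformly random edge among those that give a non-crossing spanning tree. -/
noncomputable def PFM {n : ℕ} (S T : NCST n) : ℝ :=
  ∑ e ∈ S.1, if S.1.erase e ⊆ T.1 then 1 / ((n : ℝ) * (completions n (S.1.erase e) : ℝ)) else 0

/-! ## The correspondence between paths and trees

Every nonempty 2-Dyck path is uniquely `↗ A ↗ B ↘ C`, and every nonempty non-crossing spanning tree
is uniquely given by its pivot edge and three trees `T_A, T_B, T_C`. Both recursive decompositions
are recorded by a ternary tree. -/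

/-- The recursive decomposition of a 2-Dyck path (or of a non-crossing spanning tree). -/
inductive Decomp
  | nil
  | node (A B C : Decomp)
  deriving DecidableEq

namespace Decomp

/-- The number of edges. -/
def size : Decomp → ℕ
  | nil => 0
  | node A B C => size A + size B + size C + 1

/-- The 2-Dyck path `↗ A ↗ B ↘ C`. -/
def word : Decomp → List Step
  | nil => []
  | node A B C => .up :: (word A ++ .up :: (word B ++ .down :: word C))

/-- The edges of the non-crossing tree, drawn on the points `o, …, o + size`: the pivot edge
`(o, t)`, the tree `T_A` on `[o, s]`, the tree `T_B` on `[s + 1, t]` and the tree `T_C` from `t`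
on. -/
def edges : ℕ → Decomp → Finset Edge
  | _, nil => ∅
  | o, node A B C =>
    insert (o, o + size A + size B + 1)
      (edges o A ∪ edges (o + size A + 1) B ∪ edges (o + size A + size B + 1) C)

/-- Concatenation. -/
def concat : Decomp → Decomp → Decomp
  | nil, t => t
  | node A B C, t => node A B (concat C t)

/-- The point that corresponds to the position after the first `k` steps of `word`: if the tree
starts at point `0` then `A` starts at `0`, `B` at `size A + 1` and `C` at
`size A + size B + 1`. -/
def pointAt : Decomp → ℕ → ℕ
  | nil, _ => 0
  | node A B C, k =>
    if k = 0 then 0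
    else if k ≤ 1 + 3 * size A then pointAt A (k - 1)
    else if k ≤ 2 + 3 * size A + 3 * size B then
      size A + 1 + pointAt B (k - (2 + 3 * size A))
    else size A + size B + 1 + pointAt C (k - (3 + 3 * size A + 3 * size B))

end Decomp

/-- Left-to-right parsing. The stack holds the paths read between the up-steps that are not matched
yet; a down-step is matched with the last two of these up-steps. -/
def parseAux : List Decomp → List Step → List Decomp
  | st, [] => st
  | st, .up :: w => parseAux (.nil :: st) w
  | B :: A :: C :: st, .down :: w => parseAux (C.concat (.node A B .nil) :: st) w
  | st, .down :: w => parseAux st w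

/-- The decomposition of a 2-Dyck path: the inverse of `Decomp.word`, see `parse_word` and
`word_parse`. -/
def parse (w : List Step) : Decomp := (parseAux [.nil] w).headD .nil

theorem Decomp.concat_nil (t : Decomp) : t.concat .nil = t := by
  induction t with
  | nil => rfl
  | node A B C _ _ ih => simp [Decomp.concat, ih]

theorem Decomp.concat_assoc (r s t : Decomp) :
    (r.concat s).concat t = r.concat (s.concat t) := by
  induction r with
  | nil => rfl
  | node A B C _ _ ih => simp [Decomp.concat, ih]

theorem Decomp.word_concat (s t : Decomp) : (s.concat t).word = s.word ++ t.word := by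
  induction s with
  | nil => rfl
  | node A B C _ _ ih => simp [Decomp.concat, Decomp.word, ih]

theorem parseAux_word (t C : Decomp) (st : List Decomp) (w : List Step) :
    parseAux (C :: st) (t.word ++ w) = parseAux (C.concat t :: st) w := by
  induction t generalizing C st w with
  | nil => simp [Decomp.word, Decomp.concat_nil]
  | node X Y Z ihX ihY ihZ =>
    simp only [Decomp.word, List.cons_append, List.append_assoc, parseAux, ihX, ihY, ihZ,
      Decomp.concat_assoc]
    rfl

theorem parse_word (t : Decomp) : parse t.word = t := by
  have h := parseAux_word t .nil [] []
  simp only [List.append_nil] at h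
  simp [parse, h, parseAux, Decomp.concat]

/-- The word that a parsing stack stands for. -/
def stackWord : List Decomp → List Step
  | [] => []
  | [t] => t.word
  | t :: st => stackWord st ++ .up :: t.word

theorem sum_word (t : Decomp) : (t.word.map Step.val).sum = 0 := by
  induction t with
  | nil => rfl
  | node A B C hA hB hC => simp [Decomp.word, Step.val, hA, hB, hC]

theorem sum_stackWord (t : Decomp) (st : List Decomp) :
    ((stackWord (t :: st)).map Step.val).sum = st.length := by
  induction st generalizing t with
  | nil => simp [stackWord, sum_word]
  | cons s st ih => simp [stackWord, ih, sum_word, Step.val]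

theorem stackWord_parseAux (w : List Step) (t : Decomp) (st : List Decomp)
    (h : ∀ j, 0 ≤ (st.length : ℤ) + height w j) :
    ∃ t' st', parseAux (t :: st) w = t' :: st' ∧
      stackWord (t' :: st') = stackWord (t :: st) ++ w := by
  induction w generalizing t st with
  | nil => exact ⟨t, st, rfl, by simp⟩
  | cons s w ih =>
    cases s with
    | up =>
      obtain ⟨t', st', h1, h2⟩ := ih .nil (t :: st) (fun j => by
        have := h (j + 1)
        simp only [height, List.take_succ_cons, List.map_cons, List.sum_cons, Step.val] at this
        simp only [height, List.length_cons]
        push_cast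
        linarith)
      exact ⟨t', st', h1, by simp [h2, stackWord, Decomp.word]⟩
    | down =>
      have h0 := h 1
      simp only [height, List.take_succ_cons, List.map_cons, List.sum_cons, Step.val,
        List.take_zero, List.map_nil, List.sum_nil] at h0
      match st, h, h0 with
      | [], _, h0 => simp at h0
      | [_], _, h0 => simp at h0
      | A :: C :: st, h, _ =>
        obtain ⟨t', st', h1, h2⟩ := ih (C.concat (.node A t .nil)) st (fun j => by
          have := h (j + 1)
          simp only [height, List.take_succ_cons, List.map_cons, List.sum_cons, Step.val,
            List.length_cons] at this
          simp only [height]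
          push_cast at this
          linarith)
        refine ⟨t', st', h1, ?_⟩
        cases st <;> simp [h2, stackWord, Decomp.word, Decomp.word_concat]

theorem word_parse {n : ℕ} (W : DyckPath n) : (parse W.steps).word = W.steps := by
  have hl := W.length_eq
  obtain ⟨t', st', h1, h2⟩ := stackWord_parseAux W.steps .nil [] (fun j => by
    rcases le_total j (3 * n) with hj | hj
    · simpa using W.height_nonneg j hj
    · have := W.height_last
      simp only [height] at this ⊢
      rw [List.take_of_length_le (by omega)] at this ⊢
      simp [this])
  have h3 := sum_stackWord t' st'
  have h4 := W.height_last
  simp only [height] at h4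
  rw [List.take_of_length_le (by omega)] at h4
  simp only [h2, stackWord, Decomp.word, List.nil_append, h4] at h3
  have h5 : st' = [] := by
    cases st' with
    | nil => rfl
    | cons a l => simp only [List.length_cons] at h3; push_cast at h3; omega
  subst h5
  simpa [parse, h1, stackWord, Decomp.word] using h2

/-- The edge set of the tree `T_W` that corresponds to a 2-Dyck path `W`. -/
def treeOf (w : List Step) : Finset Edge := (parse w).edges 0

/-! ## The canonical paths -/

/-- The direction of an adjacent move: the direction in which the down-step moves. -/
inductive Direction
  | left
  | right
  deriving DecidableEq

/-- The places of the construction at which a flip can be performed: one of the four flips at the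
top level, or inside one of the two shift sequences. -/
inductive MoveType
  | M1
  | M2
  | M3
  | M4
  | S1
  | S2
  deriving DecidableEq

/-- A flip that moves the edge `old` to `new`. The depth is that of the recursive call for a flip in
a shift sequence; it has no meaning (and is set to `0`) for the flips at the top level. -/
structure Flip where
  kind : MoveType
  depth : ℕ
  old : Edge
  new : Edge

/-- The reverse flip. -/
def Flip.symm (f : Flip) : Flip := ⟨f.kind, f.depth, f.new, f.old⟩

/-- The sequence of flips that shifts a tree, drawn from the point `p` on beneath an edge
`(p, p + size + 1)`, to the right by one. The minimal segments are processed from right to left.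
The first segment has the pivot edge `e = (p, q)`, the gap `g, g + 1` beneath `e`, and the
subtrees `A` on `[p, g]` and `B` on `[g + 1, q]`; the tree `C` consists of the other segments.
When the first segment is processed, the gap beneath the overarching edge of `e` is
`q, q + 1`. The flips of `e` are the moves `M₅`, `M₆`, `M₇`, in this order. -/
def shiftRight (kind : MoveType) : ℕ → ℕ → Decomp → List Flip
  | _, _, .nil => []
  | depth, p, .node A B C =>
    let g := p + A.size
    let q := p + A.size + B.size + 1
    shiftRight kind depth q C ++
    (if g + 2 ≤ q then [⟨kind, depth, (p, q), (p, g + 1)⟩] else []) ++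
    shiftRight kind (depth + 1) p A ++
    [⟨kind, depth, (p, g + 1), (g + 1, q + 1)⟩] ++
    shiftRight kind (depth + 1) (g + 1) B ++
    (if p + 1 ≤ g then [⟨kind, depth, (g + 1, q + 1), (p + 1, q + 1)⟩] else [])

/-- The reverse of `shiftRight`: it shifts a tree from `[p + 1, p + size + 1]` to
`[p, p + size]`. -/
def shiftLeft (kind : MoveType) (depth p : ℕ) (A : Decomp) : List Flip :=
  ((shiftRight kind depth p A).map Flip.symm).reverse

/-- The number of steps before the first position at which two words differ. -/
def firstDiff (I F : List Step) : ℕ := (I.zip F).findIdx fun s => decide (s.1 ≠ s.2)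

/-- The direction of the adjacent move from `I` to `F`: it is `left` if `↗↘` is replaced with
`↘↗`. -/
def direction (I F : List Step) : Direction :=
  if I[firstDiff I F]? = some .up then .left else .right

/-- The last position `j ≤ k` at which the height is `h`. -/
def lastAt (w : List Step) (h : ℤ) (k : ℕ) : ℕ := Nat.findGreatest (fun j => height w j = h) k

/-- The steps of `w` after position `i` and up to position `j`. -/
def slice (w : List Step) (i j : ℕ) : List Step := (w.take j).drop i

/-- The flips that simulate an adjacent move to the left which replaces the steps `↗↘` numbered `x`
and `y = x + 1` (counting from `1`) with `↘↗`.

* `y'` is the first position after `y` whose height is one or two below that of `y`, and `x'` is the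
  last position before `x` with the same height as `y'`.
* Type 1, height one below: the part of the path between `x'` and `y'` is
  `↗ A₁ ↗ A₂ ↗↘ B₁ ↗ B₂ ↘`.
* Type 2, height two below: the part of the path between `x'` and `y'` is
  `↗ A₁ ↗ A₂ ↗ A₃ ↗↘ B ↘`.

In both cases `a = (a₁, a₂)` is the pivot edge of the tree of this part, and `e` is the edge of the
down-step numbered `y`, whose part `↗ A₂ ↗↘` or `↗ A₃ ↗↘` of the path starts at the position `s`. -/
def leftFlips (I : List Step) (x : ℕ) : List Flip :=
  let point := (parse I).pointAt
  let y := x + 1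
  let y' := (List.range (I.length + 1)).findIdx fun j =>
    decide (y < j ∧ (height I j = height I y - 1 ∨ height I j = height I y - 2))
  let x' := lastAt I (height I y') (x - 1)
  let s := lastAt I (height I y) (x - 1)
  let ge := point (x - 1)
  if height I y' = height I y - 1 then
    let a₁ := point x'
    let a₂ := point y'
    let p := point s
    let A₂ := parse (slice I (s + 1) (x - 1))
    shiftRight .S1 1 p A₂ ++
      [⟨.M1, 0, (p, ge + 1), (a₁, ge + 1)⟩, ⟨.M2, 0, (a₁, a₂), (ge + 1, a₂)⟩]
  else
    let r := lastAt I (height I y' + 1) (x - 1)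
    let ga := point r
    let q := point s
    let A₂ := parse (slice I (r + 1) s)
    [⟨.M3, 0, (q, ge + 1), (ga, q)⟩] ++ shiftLeft .S2 1 ga A₂ ++
      [⟨.M4, 0, (ga, q), (ga, ge)⟩]

/-- A transition `src → tgt` of a canonical path, with its place in the construction. -/
structure Transition where
  src : Finset Edge
  tgt : Finset Edge
  kind : MoveType
  depth : ℕ

/-- The reverse transition. -/
def Transition.symm (t : Transition) : Transition := ⟨t.tgt, t.src, t.kind, t.depth⟩

/-- The transitions that a sequence of flips makes, starting from `Z`. -/
def runFlips : Finset Edge → List Flip → List Transition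
  | _, [] => []
  | Z, f :: fs =>
    let Z' := insert f.new (Z.erase f.old)
    ⟨Z, Z', f.kind, f.depth⟩ :: runFlips Z' fs

/-- The canonical path from `I` to `F`, where `F` is obtained from `I` by an adjacent move to the
left. -/
def leftPath (I F : List Step) : List Transition :=
  runFlips (treeOf I) (leftFlips I (firstDiff I F + 1))

/-- The canonical path from `I` to `F`, as its list of transitions. For an adjacent move to the
right it is the reverse of the path from `F` to `I`. -/
def canonicalPath (I F : List Step) : List Transition :=
  match direction I F with
  | .left => leftPath I F
  | .right => ((leftPath F I).map Transition.symm).reverse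

/-! ## The encoding -/

/-- The pairs `I ≠ F` with `P_AM(I, F) > 0` whose canonical path contains the transition
`Z → Z'`. -/
def pairsUsing {n : ℕ} (Z Z' : NCST n) : Set (DyckPath n × DyckPath n) :=
  {p | p.1 ≠ p.2 ∧ 0 < PAM p.1 p.2 ∧
    ∃ t ∈ canonicalPath p.1.steps p.2.steps, t.src = Z.1 ∧ t.tgt = Z'.1}

/-- The set of codes `{Left, Right} × {M₁, M₂, M₃, M₄, S₁, S₂} × [n]`. -/
abbrev Code (n : ℕ) := Direction × MoveType × {d : ℕ // 1 ≤ d ∧ d ≤ n}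

/-- `φ` sends every pair whose canonical path contains `Z → Z'` to the direction of the adjacent
move, the place in the construction where `Z → Z'` is made, and, if this is in a shift sequence, the
depth of the recursive call that makes it. -/
def IsEncoding {n : ℕ} (Z Z' : NCST n) (φ : pairsUsing Z Z' → Code n) : Prop :=
  ∀ p : pairsUsing Z Z',
    (φ p).1 = direction p.1.1.steps p.1.2.steps ∧
    ∀ t ∈ canonicalPath p.1.1.steps p.1.2.steps, t.src = Z.1 → t.tgt = Z'.1 →
      (φ p).2.1 = t.kind ∧
      (t.kind = .S1 ∨ t.kind = .S2 → ((φ p).2.2 : ℕ) = t.depth)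

end FlipChain

/-! The proof decodes: it recovers the pair of paths from the transition and its code. An adjacent
move to the Left is described by a `Config`, which holds the edge `a = (o, t)`, the tree `A` to be
shifted and the edges `O` at rest. Its source and target are the trees of the two paths. A path can
be recovered from its tree (`Decomp.edges_injective`, `word_parse`), so it suffices to recover the
configuration. A move to the Right uses the same configuration with source and target exchanged, and
the direction in the code says which case holds.

Let `Z ≠ Z'`. Both trees have `n` edges, so the transition determines the removed and the added edge
(`flip_unique`). For `M₁`, …, `M₄` the endpoints of these two edges give most parameters. The rest
is visible in the tree: `a` is the least edge that passes over `e`, and at `M₂` the start of `A` is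
the only uncovered cell beneath the edge `e`. Position then separates the edges of `A` from `O`.

For a flip in a shift sequence, the frame (the edge beneath which `A` is shifted) is not part of the
flip. Every enclosing recursive call contributes exactly one edge over the flipped edge, so the
depth `d` is one more than the number of moved edges over it (`Mid.depth_eq`). Since the tree is
non-crossing, its edges over a given edge are nested, and the frame is the one with exactly `d - 1`
others of this chain beneath it (`frame_unique`). Then `a` is the least edge over the frame, and in
type 2 the parameter `g` is the uncovered cell beneath `a`. What remains is to recover `A` from its
half-shifted state. This is `Mid.unique`: the outermost moved edge over the flipped one belongs to
the current segment, and the side on which the uncovered cell lies tells which half of the segment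
is being shifted. A shift to the left is a reversed shift to the right, so the same argument applies
to the tree after the flip. `Site.unique` collects these cases.

If `Z = Z'`, only `M₁` and `M₄` can make the loop. Their third entry is free, so it can record which
of the `n` edges is removed and put back. Counting codes gives `2 · 6 · n`. -/

namespace FlipChain

/-! ### Covered cells, and trees determined by their edges -/

/-- Some edge of `S` passes over the cell `[c, c + 1]`. -/
def Covers (S : Finset Edge) (c : ℕ) : Prop := ∃ X ∈ S, X.1 ≤ c ∧ c < X.2

/-- The edges of `S` between the points `a` and `b`. -/
def restr (S : Finset Edge) (a b : ℕ) : Finset Edge := S.filter fun X => a ≤ X.1 ∧ X.2 ≤ b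

theorem covers_union {S T : Finset Edge} {c : ℕ} : Covers (S ∪ T) c ↔ Covers S c ∨ Covers T c := by
  simp only [Covers, Finset.mem_union]
  constructor
  · rintro ⟨X, h | h, h'⟩
    exacts [.inl ⟨X, h, h'⟩, .inr ⟨X, h, h'⟩]
  · rintro (⟨X, h, h'⟩ | ⟨X, h, h'⟩)
    exacts [⟨X, .inl h, h'⟩, ⟨X, .inr h, h'⟩]

theorem covers_insert {S : Finset Edge} {e : Edge} {c : ℕ} :
    Covers (insert e S) c ↔ (e.1 ≤ c ∧ c < e.2) ∨ Covers S c := by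
  simp [Covers]

namespace Decomp

theorem edges_bounds {D : Decomp} {o : ℕ} {X : Edge} (h : X ∈ D.edges o) :
    o ≤ X.1 ∧ X.1 < X.2 ∧ X.2 ≤ o + D.size := by
  induction D generalizing o with
  | nil => simp [edges] at h
  | node A B C hA hB hC =>
    simp only [edges, Finset.mem_insert, Finset.mem_union] at h
    simp only [size]
    rcases h with rfl | (h | h) | h
    · exact ⟨le_rfl, by dsimp only; omega, by dsimp only; omega⟩
    · have := hA h; omega
    · have := hB h; omega
    · have := hC h; omega

/-- The outermost edges form a chain from one end of the tree to the other. Uncovered cells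
therefore locate gaps, and all sizes are later read off from them. -/
theorem covers_edges {D : Decomp} {o c : ℕ} :
    Covers (D.edges o) c ↔ o ≤ c ∧ c < o + D.size := by
  constructor
  · rintro ⟨X, h, h1⟩
    have := edges_bounds h
    omega
  · intro h
    induction D generalizing o with
    | nil => simp [size] at h; omega
    | node A B C hA hB hC =>
      simp only [size] at h
      simp only [edges, covers_insert, covers_union]
      by_cases h1 : c < o + A.size + B.size + 1
      · exact .inl ⟨h.1, h1⟩
      · exact .inr (.inr (hC (by omega)))

theorem size_concat (S T : Decomp) : (S.concat T).size = S.size + T.size := by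
  induction S with
  | nil => simp [concat, size]
  | node A B C _ _ ih => simp only [concat, size, ih]; omega

theorem edges_concat (S T : Decomp) (o : ℕ) :
    (S.concat T).edges o = S.edges o ∪ T.edges (o + S.size) := by
  induction S generalizing o with
  | nil => simp [concat, size, edges]
  | node A B C _ _ ih =>
    have : o + (A.size + B.size + C.size + 1) = o + A.size + B.size + 1 + C.size := by omega
    simp only [concat, edges, size, ih, this, Finset.insert_union, Finset.union_assoc]

theorem length_word (D : Decomp) : D.word.length = 3 * D.size := by
  induction D with
  | nil => rfl
  | node A B C hA hB hC => simp [word, size, hA, hB, hC]; omega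

end Decomp

theorem restr_union {S T : Finset Edge} {a b : ℕ} :
    restr (S ∪ T) a b = restr S a b ∪ restr T a b := Finset.filter_union _ _ _

theorem restr_insert_in {S : Finset Edge} {x y a b : ℕ} (h : a ≤ x ∧ y ≤ b) :
    restr (insert (x, y) S) a b = insert (x, y) (restr S a b) := by simp [restr, Finset.filter_insert, h]

theorem restr_insert_out {S : Finset Edge} {x y a b : ℕ} (h : x < a ∨ b < y) :
    restr (insert (x, y) S) a b = restr S a b := by
  rw [restr, Finset.filter_insert, if_neg (by dsimp only; omega)]; rfl

theorem restr_eq_self {S : Finset Edge} {a b : ℕ} (h : ∀ X ∈ S, a ≤ X.1 ∧ X.2 ≤ b) :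
    restr S a b = S := Finset.filter_true_of_mem h

theorem restr_eq_empty {S : Finset Edge} {a b : ℕ} (h : ∀ X ∈ S, X.1 < a ∨ b < X.2) :
    restr S a b = ∅ := Finset.filter_false_of_mem fun X hX => by have := h X hX; omega

theorem restr_edges_in {D : Decomp} {o a b : ℕ} (h : a ≤ o ∧ o + D.size ≤ b) :
    restr (D.edges o) a b = D.edges o :=
  restr_eq_self fun X hX => by have := Decomp.edges_bounds hX; omega

theorem restr_edges_out {D : Decomp} {o a b : ℕ} (h : b ≤ o ∨ o + D.size ≤ a) :
    restr (D.edges o) a b = ∅ :=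
  restr_eq_empty fun X hX => by have := Decomp.edges_bounds hX; omega

/-- The covered cells give the size, the pivot edge is the longest edge at the left end, and the gap
is the only cell beneath it that no other edge covers. Restriction to the three resulting intervals
gives the parts. -/
theorem Decomp.edges_injective {D D' : Decomp} {o o' : ℕ} (ho : o = o')
    (h : D.edges o = D'.edges o') : D = D' := by
  subst ho
  induction D generalizing o D' with
  | nil =>
    cases D' with
    | nil => rfl
    | node A B C => exact absurd h.symm (Finset.insert_ne_empty _ _)
  | node A B C hA hB hC =>
    cases D' with
    | nil => simp [edges] at h
    | node A' B' C' =>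
      have hsz : (node A B C).size = (node A' B' C').size := by
        have h1 : ∀ c, (o ≤ c ∧ c < o + (node A B C).size) ↔
            (o ≤ c ∧ c < o + (node A' B' C').size) := fun c => by
          rw [← covers_edges, ← covers_edges, h]
        have h2 := h1 (o + (node A B C).size - 1)
        have h3 := h1 (o + (node A' B' C').size - 1)
        simp only [size] at *
        omega
      -- If the pivot edges differed, each would lie in the part `A` of the other tree and so be the
      -- shorter one.
      have hq : A.size + B.size = A'.size + B'.size := by
        have h1 : (o, o + A.size + B.size + 1) ∈ (node A' B' C').edges o := by
          rw [← h]; simp [edges]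
        have h2 : (o, o + A'.size + B'.size + 1) ∈ (node A B C).edges o := by
          rw [h]; simp [edges]
        simp only [edges, Finset.mem_insert, Finset.mem_union, Prod.mk.injEq, true_and] at h1 h2
        rcases h1 with h1 | (h1 | h1) | h1
        · omega
        · have b1 := edges_bounds h1
          rcases h2 with h2 | (h2 | h2) | h2
          · omega
          · have := edges_bounds h2; dsimp only at *; omega
          · have := edges_bounds h2; dsimp only at *; omega
          · have := edges_bounds h2; dsimp only at *; omega
        · have := edges_bounds h1; dsimp only at *; omega
        · have := edges_bounds h1; dsimp only at *; omega
      have hb : restr ((node A B C).edges o) o (o + A.size + B.size + 1)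
          = restr ((node A' B' C').edges o) o (o + A.size + B.size + 1) := by rw [h]
      simp (disch := omega) only [edges, restr_union, restr_edges_in,
        restr_edges_out, restr_insert_in, Finset.union_empty] at hb
      rw [show o + A'.size + B'.size + 1 = o + A.size + B.size + 1 by omega] at hb
      have hc := congrArg (fun S => Finset.erase S (o, o + A.size + B.size + 1)) hb
      have nm : ∀ P Q : Decomp, P.size + Q.size = A.size + B.size →
          (o, o + A.size + B.size + 1) ∉ P.edges o ∪ Q.edges (o + P.size + 1) := by
        intro P Q hPQ hm
        rcases Finset.mem_union.1 hm with hm | hm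
        · have := edges_bounds hm; dsimp only at *; omega
        · have := edges_bounds hm; dsimp only at *; omega
      simp only [Finset.erase_insert (nm _ _ rfl), Finset.erase_insert (nm _ _ hq.symm)] at hc
      have hcov : ∀ c, Covers (A.edges o ∪ B.edges (o + A.size + 1)) c ↔
          Covers (A'.edges o ∪ B'.edges (o + A'.size + 1)) c := by rw [hc]; simp
      simp only [covers_union, covers_edges] at hcov
      -- The gap of each tree is tested against the covered cells of the other.
      have hs : A.size = A'.size := by
        have h1 := hcov (o + A.size)
        have h2 := hcov (o + A'.size)
        omega
      have hs' : B.size = B'.size := by omega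
      have eA := congrArg (fun S => restr S o (o + A.size)) h
      have eB := congrArg (fun S => restr S (o + A.size + 1) (o + A.size + B.size + 1)) h
      have eC := congrArg (fun S => restr S (o + A.size + B.size + 1) (o + (node A B C).size)) h
      simp only [edges, size] at hsz eA eB eC
      simp (disch := omega) only [restr_union, restr_edges_in,
        restr_edges_out, restr_insert_out, Finset.union_empty, Finset.empty_union] at eA eB eC
      rw [hs] at eB
      rw [hs, hs'] at eC
      rw [hA eA, hB eB, hC eC]


/-! ### States of a shift sequence -/

/-- `Mid δ p D U d old new` says that, while `shiftRight` at depth `δ` moves the tree of `D` from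
`[p, p + size]` to the right by one, a recursive call of depth `d` performs the flip `old → new`
when the moved edges form the set `U`. In each case `D` is split at the current segment. -/
inductive Mid : ℕ → ℕ → Decomp → Finset Edge → ℕ → Edge → Edge → Prop
  -- Segments are processed from right to left: `L` is still in its old place and `R` is already one
  -- point further right.
  | shrink (δ p : ℕ) (L A B R : Decomp) (hB : 0 < B.size) :
    Mid δ p (L.concat (.node A B R))
      (L.edges p ∪ (insert (p + L.size, p + L.size + A.size + B.size + 1)
        (A.edges (p + L.size) ∪ B.edges (p + L.size + A.size + 1)) ∪
        R.edges (p + L.size + A.size + B.size + 1 + 1))) δ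
      (p + L.size, p + L.size + A.size + B.size + 1) (p + L.size, p + L.size + A.size + 1)
  | left (δ p : ℕ) (L A B R : Decomp) (U : Finset Edge) (d : ℕ) (old new : Edge)
      (h : Mid (δ + 1) (p + L.size) A U d old new) :
    Mid δ p (L.concat (.node A B R))
      (L.edges p ∪ (insert (p + L.size, p + L.size + A.size + 1)
        (U ∪ B.edges (p + L.size + A.size + 1)) ∪
        R.edges (p + L.size + A.size + B.size + 1 + 1))) d old new
  | jump (δ p : ℕ) (L A B R : Decomp) :
    Mid δ p (L.concat (.node A B R))
      (L.edges p ∪ (insert (p + L.size, p + L.size + A.size + 1)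
        (A.edges (p + L.size + 1) ∪ B.edges (p + L.size + A.size + 1)) ∪
        R.edges (p + L.size + A.size + B.size + 1 + 1))) δ
      (p + L.size, p + L.size + A.size + 1)
      (p + L.size + A.size + 1, p + L.size + A.size + B.size + 1 + 1)
  | right (δ p : ℕ) (L A B R : Decomp) (U : Finset Edge) (d : ℕ) (old new : Edge)
      (h : Mid (δ + 1) (p + L.size + A.size + 1) B U d old new) :
    Mid δ p (L.concat (.node A B R))
      (L.edges p ∪ (insert (p + L.size + A.size + 1, p + L.size + A.size + B.size + 1 + 1)
        (A.edges (p + L.size + 1) ∪ U) ∪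
        R.edges (p + L.size + A.size + B.size + 1 + 1))) d old new
  | stretch (δ p : ℕ) (L A B R : Decomp) (hA : 0 < A.size) :
    Mid δ p (L.concat (.node A B R))
      (L.edges p ∪ (insert (p + L.size + A.size + 1, p + L.size + A.size + B.size + 1 + 1)
        (A.edges (p + L.size + 1) ∪ B.edges (p + L.size + A.size + 1 + 1)) ∪
        R.edges (p + L.size + A.size + B.size + 1 + 1))) δ
      (p + L.size + A.size + 1, p + L.size + A.size + B.size + 1 + 1)
      (p + L.size + 1, p + L.size + A.size + B.size + 1 + 1)

/-- The edge `X` lies beneath `(a, b)`. -/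
def Beneath (a b : ℕ) (X : Edge) : Prop :=
  a ≤ X.1 ∧ X.1 < X.2 ∧ X.2 ≤ b ∧ (a < X.1 ∨ X.2 < b)

theorem beneath_edges {D : Decomp} {o a b : ℕ} {X : Edge} (h : X ∈ D.edges o) (ha : a ≤ o)
    (hb : o + D.size ≤ b) (hab : D.size < b - a) : Beneath a b X := by
  have := Decomp.edges_bounds h
  unfold Beneath
  omega

theorem Beneath.mono {a b a' b' : ℕ} {X : Edge} (h : Beneath a' b' X) (ha : a ≤ a')
    (hb : b' ≤ b) : Beneath a b X := by
  unfold Beneath at *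
  omega

namespace Mid

variable {δ p d : ℕ} {D : Decomp} {U : Finset Edge} {old new : Edge}

theorem old_mem (h : Mid δ p D U d old new) : old ∈ U := by
  induction h with
  | left δ p L A B R U d old new h ih => simp [ih]
  | right δ p L A B R U d old new h ih => simp [ih]
  | shrink | jump | stretch => simp

/-- Shifting by one uses one cell more than the tree has. The moved edges stay strictly inside the
frame over these cells, so they never meet the frame edge or anything outside. -/
theorem beneath (h : Mid δ p D U d old new) :
    (∀ X ∈ U, Beneath p (p + D.size + 1) X) ∧ Beneath p (p + D.size + 1) new := by
  induction h with
  | shrink δ p L A B R hB =>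
    simp only [Decomp.size_concat, Decomp.size]
    refine ⟨fun X hX => ?_, by unfold Beneath; dsimp only; omega⟩
    simp only [Finset.mem_union, Finset.mem_insert] at hX
    rcases hX with hX | (rfl | hX | hX) | hX
    · exact beneath_edges hX (by omega) (by omega) (by omega)
    · unfold Beneath; dsimp only; omega
    all_goals exact beneath_edges hX (by omega) (by omega) (by omega)
  | left δ p L A B R U d old new h ih =>
    simp only [Decomp.size_concat, Decomp.size]
    refine ⟨fun X hX => ?_, ih.2.mono (by omega) (by omega)⟩
    simp only [Finset.mem_union, Finset.mem_insert] at hX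
    rcases hX with hX | (rfl | hX | hX) | hX
    · exact beneath_edges hX (by omega) (by omega) (by omega)
    · have := ih.1 _ h.old_mem
      unfold Beneath at this ⊢
      dsimp only
      omega
    · exact (ih.1 X hX).mono (by omega) (by omega)
    all_goals exact beneath_edges hX (by omega) (by omega) (by omega)
  | jump δ p L A B R =>
    simp only [Decomp.size_concat, Decomp.size]
    refine ⟨fun X hX => ?_, by unfold Beneath; dsimp only; omega⟩
    simp only [Finset.mem_union, Finset.mem_insert] at hX
    rcases hX with hX | (rfl | hX | hX) | hX
    · exact beneath_edges hX (by omega) (by omega) (by omega)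
    · unfold Beneath; dsimp only; omega
    all_goals exact beneath_edges hX (by omega) (by omega) (by omega)
  | right δ p L A B R U d old new h ih =>
    simp only [Decomp.size_concat, Decomp.size]
    refine ⟨fun X hX => ?_, ih.2.mono (by omega) (by omega)⟩
    simp only [Finset.mem_union, Finset.mem_insert] at hX
    rcases hX with hX | (rfl | hX | hX) | hX
    · exact beneath_edges hX (by omega) (by omega) (by omega)
    · unfold Beneath; dsimp only; omega
    · exact beneath_edges hX (by omega) (by omega) (by omega)
    · exact (ih.1 X hX).mono (by omega) (by omega)
    · exact beneath_edges hX (by omega) (by omega) (by omega)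
  | stretch δ p L A B R hA =>
    simp only [Decomp.size_concat, Decomp.size]
    refine ⟨fun X hX => ?_, by unfold Beneath; dsimp only; omega⟩
    simp only [Finset.mem_union, Finset.mem_insert] at hX
    rcases hX with hX | (rfl | hX | hX) | hX
    · exact beneath_edges hX (by omega) (by omega) (by omega)
    · unfold Beneath; dsimp only; omega
    all_goals exact beneath_edges hX (by omega) (by omega) (by omega)

/-- Together with `old_mem`, this makes every flip of a shift reversible and none of them a loop. -/
theorem new_notMem (h : Mid δ p D U d old new) : new ∉ U := by
  intro hX
  induction h with
  | shrink δ p L A B R hB =>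
    simp only [Finset.mem_union, Finset.mem_insert, Prod.mk.injEq] at hX
    rcases hX with hX | (hX | hX | hX) | hX
    · have := Decomp.edges_bounds hX; dsimp only at *; omega
    · omega
    all_goals have := Decomp.edges_bounds hX; dsimp only at *; omega
  | left δ p L A B R U d old new h ih =>
    have hb := h.beneath.2
    unfold Beneath at hb
    simp only [Finset.mem_union, Finset.mem_insert] at hX
    rcases hX with hX | (rfl | hX | hX) | hX
    · have := Decomp.edges_bounds hX; omega
    · dsimp only at hb; omega
    · exact ih hX
    all_goals have := Decomp.edges_bounds hX; omega
  | jump δ p L A B R =>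
    simp only [Finset.mem_union, Finset.mem_insert, Prod.mk.injEq] at hX
    rcases hX with hX | (hX | hX | hX) | hX
    · have := Decomp.edges_bounds hX; dsimp only at *; omega
    · omega
    all_goals have := Decomp.edges_bounds hX; dsimp only at *; omega
  | right δ p L A B R U d old new h ih =>
    have hb := h.beneath.2
    unfold Beneath at hb
    simp only [Finset.mem_union, Finset.mem_insert] at hX
    rcases hX with hX | (rfl | hX | hX) | hX
    · have := Decomp.edges_bounds hX; omega
    · dsimp only at hb; omega
    · have := Decomp.edges_bounds hX; omega
    · exact ih hX
    · have := Decomp.edges_bounds hX; omega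
  | stretch δ p L A B R hA =>
    simp only [Finset.mem_union, Finset.mem_insert, Prod.mk.injEq] at hX
    rcases hX with hX | (hX | hX | hX) | hX
    · have := Decomp.edges_bounds hX; dsimp only at *; omega
    · omega
    all_goals have := Decomp.edges_bounds hX; dsimp only at *; omega

end Mid

/-! ### Depth as a number of edges passing over -/

/-- The edge `X` passes strictly over the edge `x`. -/
def Over (x X : Edge) : Prop := X.1 ≤ x.1 ∧ x.2 ≤ X.2 ∧ X ≠ x

open Classical in
/-- The edges of `U` that pass strictly over `x`. -/
noncomputable def overs (U : Finset Edge) (x : Edge) : Finset Edge := U.filter (Over x)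

theorem mem_overs {U : Finset Edge} {x X : Edge} : X ∈ overs U x ↔ X ∈ U ∧ Over x X := by
  simp [overs]

theorem over_iff {x X : Edge} :
    Over x X ↔ X.1 ≤ x.1 ∧ x.2 ≤ X.2 ∧ (X.1 < x.1 ∨ x.2 < X.2) := by
  unfold Over
  rw [Ne, Prod.ext_iff]
  omega

namespace Mid

variable {δ p d : ℕ} {D : Decomp} {U : Finset Edge} {old new : Edge}

/-- A recursive call works beneath the edge of the segment in progress, which passes over everything
in the call, while the other edges of the outer level lie to the side. In the call that makes the
flip, nothing passes over the flipped edge. -/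
theorem depth_eq (h : Mid δ p D U d old new) : d = δ + (overs U old).card := by
  induction h with
  | shrink δ p L A B R hB =>
    suffices overs _ _ = ∅ by rw [this]; rfl
    refine Finset.eq_empty_of_forall_notMem fun X hX => ?_
    rw [mem_overs, over_iff] at hX
    obtain ⟨hX, ho⟩ := hX
    simp only [Finset.mem_union, Finset.mem_insert] at hX
    rcases hX with hX | (rfl | hX | hX) | hX
    · have := Decomp.edges_bounds hX; dsimp only at *; omega
    · dsimp only at ho; omega
    all_goals have := Decomp.edges_bounds hX; dsimp only at *; omega
  | left δ p L A B R U d old new h ih =>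
    have hb := h.beneath.1 _ h.old_mem
    have hn : (p + L.size, p + L.size + A.size + 1) ∉ overs U old := fun hm => by
      have := h.beneath.1 _ (mem_overs.1 hm).1
      unfold Beneath at this
      dsimp only at this
      omega
    suffices overs _ _ = insert (p + L.size, p + L.size + A.size + 1) (overs U old) by
      rw [this, Finset.card_insert_of_notMem hn, ih]; omega
    ext X
    unfold Beneath at hb
    simp only [mem_overs, Finset.mem_union, Finset.mem_insert]
    constructor
    · rintro ⟨hX | (hX | hX | hX) | hX, ho⟩
      · have := Decomp.edges_bounds hX; rw [over_iff] at ho; omega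
      · exact .inl hX
      · exact .inr ⟨hX, ho⟩
      all_goals have := Decomp.edges_bounds hX; rw [over_iff] at ho; omega
    · rintro (rfl | ⟨hX, ho⟩)
      · refine ⟨by simp, ?_⟩
        rw [over_iff]; dsimp only; omega
      · exact ⟨by simp [hX], ho⟩
  | jump δ p L A B R =>
    suffices overs _ _ = ∅ by rw [this]; rfl
    refine Finset.eq_empty_of_forall_notMem fun X hX => ?_
    rw [mem_overs, over_iff] at hX
    obtain ⟨hX, ho⟩ := hX
    simp only [Finset.mem_union, Finset.mem_insert] at hX
    rcases hX with hX | (rfl | hX | hX) | hX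
    · have := Decomp.edges_bounds hX; dsimp only at *; omega
    · dsimp only at ho; omega
    all_goals have := Decomp.edges_bounds hX; dsimp only at *; omega
  | right δ p L A B R U d old new h ih =>
    have hb := h.beneath.1 _ h.old_mem
    have hn : (p + L.size + A.size + 1, p + L.size + A.size + B.size + 1 + 1) ∉ overs U old :=
      fun hm => by
        have := h.beneath.1 _ (mem_overs.1 hm).1
        unfold Beneath at this
        dsimp only at this
        omega
    suffices overs _ _ = insert (p + L.size + A.size + 1, p + L.size + A.size + B.size + 1 + 1)
        (overs U old) by
      rw [this, Finset.card_insert_of_notMem hn, ih]; omega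
    ext X
    unfold Beneath at hb
    simp only [mem_overs, Finset.mem_union, Finset.mem_insert]
    constructor
    · rintro ⟨hX | (hX | hX | hX) | hX, ho⟩
      · have := Decomp.edges_bounds hX; rw [over_iff] at ho; omega
      · exact .inl hX
      · have := Decomp.edges_bounds hX; rw [over_iff] at ho; omega
      · exact .inr ⟨hX, ho⟩
      · have := Decomp.edges_bounds hX; rw [over_iff] at ho; omega
    · rintro (rfl | ⟨hX, ho⟩)
      · refine ⟨by simp, ?_⟩
        rw [over_iff]; dsimp only; omega
      · exact ⟨by simp [hX], ho⟩
  | stretch δ p L A B R hA =>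
    suffices overs _ _ = ∅ by rw [this]; rfl
    refine Finset.eq_empty_of_forall_notMem fun X hX => ?_
    rw [mem_overs, over_iff] at hX
    obtain ⟨hX, ho⟩ := hX
    simp only [Finset.mem_union, Finset.mem_insert] at hX
    rcases hX with hX | (rfl | hX | hX) | hX
    · have := Decomp.edges_bounds hX; dsimp only at *; omega
    · dsimp only at ho; omega
    all_goals have := Decomp.edges_bounds hX; dsimp only at *; omega

end Mid


/-! ### Recovering the shifted tree from a state -/

theorem restr_beneath_in {U : Finset Edge} {x y a b : ℕ} (hU : ∀ X ∈ U, Beneath x y X)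
    (h : a ≤ x ∧ y ≤ b) : restr U a b = U :=
  restr_eq_self fun X hX => by have := hU X hX; unfold Beneath at this; omega

theorem restr_beneath_out {U : Finset Edge} {x y a b : ℕ} (hU : ∀ X ∈ U, Beneath x y X)
    (h : b ≤ x ∨ y ≤ a) : restr U a b = ∅ :=
  restr_eq_empty fun X hX => by have := hU X hX; unfold Beneath at this; omega

theorem covers_of_beneath {U : Finset Edge} {x y c : ℕ} (hU : ∀ X ∈ U, Beneath x y X)
    (h : Covers U c) : x ≤ c ∧ c < y := by
  obtain ⟨X, hX, h1⟩ := h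
  have := hU X hX
  unfold Beneath at this
  omega

theorem insert_inj_beneath {U U' : Finset Edge} {x y : ℕ} (hU : ∀ X ∈ U, Beneath x y X)
    (hU' : ∀ X ∈ U', Beneath x y X) (h : insert (x, y) U = insert (x, y) U') : U = U' := by
  have key : ∀ V : Finset Edge, (∀ X ∈ V, Beneath x y X) → (x, y) ∉ V := fun V hV hm => by
    have := hV _ hm
    unfold Beneath at this
    dsimp only at this
    omega
  rw [← Finset.erase_insert (key U hU), h, Finset.erase_insert (key U' hU')]

namespace Mid

theorem le_depth {δ p d : ℕ} {D : Decomp} {U : Finset Edge} {old new : Edge}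
    (h : Mid δ p D U d old new) : δ ≤ d := by
  have := h.depth_eq
  omega

/-- At depth `δ` the flip shows its stage: a shrink keeps the left endpoint, a stretch keeps the
right one, and a jump starts where the old edge ended. At larger depth the outermost moved edge over
`old` is the edge of the segment in progress, and the single uncovered cell fixes the half being
shifted and the remaining size. Restriction to intervals then separates the pieces. -/
theorem unique {δ p d p' d' : ℕ} {D D' : Decomp} {U U' : Finset Edge} {old new old' new' : Edge}
    (h : Mid δ p D U d old new) (h' : Mid δ p' D' U' d' old' new') (hp : p = p') (hU : U = U')
    (hd : d = d') (ho : old = old') (hn : new = new') (hs : D.size = D'.size) : D = D' := by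
  induction h generalizing D' U' d' old' new' p' with
  | shrink δ p L A B R hB =>
    cases h' with
    | shrink _ _ L' A' B' R' hB' =>
      simp only [Prod.mk.injEq] at ho hn
      simp only [Decomp.size_concat, Decomp.size] at hs
      have h1 : L.size = L'.size := by omega
      have h2 : A.size = A'.size := by omega
      have h3 : B.size = B'.size := by omega
      have h4 : R.size = R'.size := by omega
      have eL := congrArg (fun S => restr S p (p + L.size)) hU
      have eA := congrArg (fun S => restr S (p + L.size) (p + L.size + A.size)) hU
      have eB := congrArg (fun S => restr S (p + L.size + A.size + 1)
        (p + L.size + A.size + B.size + 1)) hU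
      have eR := congrArg (fun S => restr S (p + L.size + A.size + B.size + 1 + 1)
        (p + L.size + A.size + B.size + 1 + 1 + R.size)) hU
      simp (disch := omega) only [restr_union, restr_edges_in, restr_edges_out, restr_insert_out,
        Finset.union_empty, Finset.empty_union] at eL eA eB eR
      rw [Decomp.edges_injective (by omega) eL, Decomp.edges_injective (by omega) eA,
        Decomp.edges_injective (by omega) eB, Decomp.edges_injective (by omega) eR]
    -- A flip in a recursive call is deeper than `δ`.
    | left _ _ L' A' B' R' _ _ _ _ h' => have := h'.le_depth; omega
    | jump => simp only [Prod.mk.injEq] at ho hn; omega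
    | right _ _ L' A' B' R' _ _ _ _ h' => have := h'.le_depth; omega
    | stretch => simp only [Prod.mk.injEq] at ho hn; omega
  | jump δ p L A B R =>
    cases h' with
    | jump _ _ L' A' B' R' =>
      simp only [Prod.mk.injEq] at ho hn
      simp only [Decomp.size_concat, Decomp.size] at hs
      have h1 : L.size = L'.size := by omega
      have h2 : A.size = A'.size := by omega
      have h3 : B.size = B'.size := by omega
      have h4 : R.size = R'.size := by omega
      have eL := congrArg (fun S => restr S p (p + L.size)) hU
      have eA := congrArg (fun S => restr S (p + L.size + 1) (p + L.size + A.size + 1)) hU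
      have eB := congrArg (fun S => restr S (p + L.size + A.size + 1)
        (p + L.size + A.size + B.size + 1)) hU
      have eR := congrArg (fun S => restr S (p + L.size + A.size + B.size + 1 + 1)
        (p + L.size + A.size + B.size + 1 + 1 + R.size)) hU
      simp (disch := omega) only [restr_union, restr_edges_in, restr_edges_out, restr_insert_out,
        Finset.union_empty, Finset.empty_union] at eL eA eB eR
      rw [Decomp.edges_injective (by omega) eL, Decomp.edges_injective (by omega) eA,
        Decomp.edges_injective (by omega) eB, Decomp.edges_injective (by omega) eR]
    | left _ _ L' A' B' R' _ _ _ _ h' => have := h'.le_depth; omega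
    | shrink => simp only [Prod.mk.injEq] at ho hn; omega
    | right _ _ L' A' B' R' _ _ _ _ h' => have := h'.le_depth; omega
    | stretch => simp only [Prod.mk.injEq] at ho hn; omega
  | stretch δ p L A B R hB =>
    cases h' with
    | stretch _ _ L' A' B' R' hB' =>
      simp only [Prod.mk.injEq] at ho hn
      simp only [Decomp.size_concat, Decomp.size] at hs
      have h1 : L.size = L'.size := by omega
      have h2 : A.size = A'.size := by omega
      have h3 : B.size = B'.size := by omega
      have h4 : R.size = R'.size := by omega
      have eL := congrArg (fun S => restr S p (p + L.size)) hU
      have eA := congrArg (fun S => restr S (p + L.size + 1) (p + L.size + A.size + 1)) hU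
      have eB := congrArg (fun S => restr S (p + L.size + A.size + 1 + 1)
        (p + L.size + A.size + B.size + 1 + 1)) hU
      have eR := congrArg (fun S => restr S (p + L.size + A.size + B.size + 1 + 1)
        (p + L.size + A.size + B.size + 1 + 1 + R.size)) hU
      simp (disch := omega) only [restr_union, restr_edges_in, restr_edges_out, restr_insert_out,
        Finset.union_empty, Finset.empty_union] at eL eA eB eR
      rw [Decomp.edges_injective (by omega) eL, Decomp.edges_injective (by omega) eA,
        Decomp.edges_injective (by omega) eB, Decomp.edges_injective (by omega) eR]
    | left _ _ L' A' B' R' _ _ _ _ h' => have := h'.le_depth; omega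
    | shrink => simp only [Prod.mk.injEq] at ho hn; omega
    | right _ _ L' A' B' R' _ _ _ _ h' => have := h'.le_depth; omega
    | jump => simp only [Prod.mk.injEq] at ho hn; omega
  | left δ p L A B R U d old new h ih =>
    subst hp ho hn hd
    have hb := h.beneath.1
    have hbo := hb _ h.old_mem
    have hl := h.le_depth
    -- While `A` is being shifted, the free cell lies between `B` and `R`.
    have hcov : ∀ c, Covers U' c ↔ p ≤ c ∧ c < p + (L.concat (.node A B R)).size + 1 ∧
        c ≠ p + L.size + A.size + B.size + 1 := fun c => by
      rw [← hU]
      simp only [covers_union, covers_insert, Decomp.covers_edges, Decomp.size_concat,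
        Decomp.size]
      have := @covers_of_beneath U _ _ c hb
      by_cases hc : Covers U c
      · have := this hc; simp only [hc, true_or, or_true, true_iff]; omega
      · simp only [hc, false_or]; omega
    -- The edge of the segment in progress is outermost over `old`. As this holds in both
    -- decompositions, the two edges agree.
    have htop : ∀ X ∈ U', X.1 ≤ old.1 → old.2 ≤ X.2 →
        p + L.size ≤ X.1 ∧ X.2 ≤ p + L.size + A.size + 1 := fun X hX h1 h2 => by
      rw [← hU] at hX
      unfold Beneath at hbo
      simp only [Finset.mem_union, Finset.mem_insert] at hX
      rcases hX with hX | (rfl | hX | hX) | hX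
      · have := Decomp.edges_bounds hX; omega
      · exact ⟨le_rfl, le_rfl⟩
      · have := hb X hX; unfold Beneath at this; omega
      all_goals have := Decomp.edges_bounds hX; omega
    have htop' : (p + L.size, p + L.size + A.size + 1) ∈ U' := by rw [← hU]; simp
    have hov : p + L.size ≤ old.1 ∧ old.1 < old.2 ∧ old.2 ≤ p + L.size + A.size + 1 := by
      unfold Beneath at hbo; omega
    cases h' with
    | shrink => omega
    | jump => omega
    | stretch => omega
    | left _ _ L' A' B' R' U' _ _ _ h' =>
      have hb' := h'.beneath.1
      have hbo' := hb' _ h'.old_mem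
      have t1 := htop (p + L'.size, p + L'.size + A'.size + 1) (by simp)
        (by unfold Beneath at hbo'; dsimp only; omega) (by unfold Beneath at hbo'; dsimp only; omega)
      have t2 : p + L'.size ≤ p + L.size ∧ p + L.size + A.size + 1 ≤ p + L'.size + A'.size + 1 := by
        unfold Beneath at hbo'
        simp only [Finset.mem_union, Finset.mem_insert] at htop'
        rcases htop' with hX | (hX | hX | hX) | hX
        · have := Decomp.edges_bounds hX; dsimp only at this; omega
        · rw [Prod.mk.injEq] at hX; omega
        · have := hb' _ hX; unfold Beneath at this; dsimp only at this; omega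
        all_goals have := Decomp.edges_bounds hX; dsimp only at this; omega
      have h1 : L.size = L'.size := by dsimp only at t1; omega
      have h2 : A.size = A'.size := by dsimp only at t1; omega
      -- The free cell marks the right end of `B`.
      have h3 : B.size = B'.size := by
        have c1 := hcov (p + L'.size + A'.size + B'.size + 1)
        have := @covers_of_beneath U' _ _ (p + L'.size + A'.size + B'.size + 1) hb'
        simp only [covers_union, covers_insert, Decomp.covers_edges] at c1
        simp only [Decomp.size_concat, Decomp.size] at hs c1
        by_cases hc : Covers U' (p + L'.size + A'.size + B'.size + 1)
        · have := this hc; simp only [hc, true_or, or_true, true_iff] at c1; omega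
        · simp only [hc, false_or] at c1; omega
      simp only [Decomp.size_concat, Decomp.size] at hs
      have h4 : R.size = R'.size := by omega
      clear hcov htop
      have hb1 := fun a b => @restr_beneath_in U _ _ a b hb
      have hb2 := fun a b => @restr_beneath_out U _ _ a b hb
      have hb1' := fun a b => @restr_beneath_in U' _ _ a b hb'
      have hb2' := fun a b => @restr_beneath_out U' _ _ a b hb'
      have eL := congrArg (fun S => restr S p (p + L.size)) hU
      have eA := congrArg (fun S => restr S (p + L.size) (p + L.size + A.size + 1)) hU
      have eB := congrArg (fun S => restr S (p + L.size + A.size + 1)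
        (p + L.size + A.size + B.size + 1)) hU
      have eR := congrArg (fun S => restr S (p + L.size + A.size + B.size + 1 + 1)
        (p + L.size + A.size + B.size + 1 + 1 + R.size)) hU
      simp (disch := omega) only [restr_union, restr_edges_in, restr_edges_out, restr_insert_out,
        restr_insert_in, hb1, hb2, hb1', hb2', Finset.union_empty, Finset.empty_union]
        at eL eA eB eR
      rw [← h1, ← h2] at eA hb'
      rw [Decomp.edges_injective (by omega) eL, Decomp.edges_injective (by omega) eB,
        Decomp.edges_injective (by omega) eR,
        ih h' (by omega) (insert_inj_beneath hb hb' eA) rfl rfl rfl h2]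
    | right _ _ L' A' B' R' U' _ _ _ h' =>
      -- The free cell is to the right of the segment's edge while `A` is shifted, but to the left
      -- of it while `B` is shifted.
      exfalso
      have hb' := h'.beneath.1
      have hbo' := hb' _ h'.old_mem
      have t1 := htop (p + L'.size + A'.size + 1, p + L'.size + A'.size + B'.size + 1 + 1)
        (by simp) (by unfold Beneath at hbo'; dsimp only; omega)
        (by unfold Beneath at hbo'; dsimp only; omega)
      have c1 := hcov (p + L'.size)
      have := @covers_of_beneath U' _ _ (p + L'.size) hb'
      simp only [covers_union, covers_insert, Decomp.covers_edges] at c1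
      simp only [Decomp.size_concat, Decomp.size] at hs c1
      dsimp only at t1
      by_cases hc : Covers U' (p + L'.size)
      · have := this hc; simp only [hc, true_or, or_true, true_iff] at c1; omega
      · simp only [hc, or_false] at c1; omega
  | right δ p L A B R U d old new h ih =>
    subst hp ho hn hd
    have hb := h.beneath.1
    have hbo := hb _ h.old_mem
    have hl := h.le_depth
    -- While `B` is being shifted, the free cell lies between `L` and the shifted `A`.
    have hcov : ∀ c, Covers U' c ↔ p ≤ c ∧ c < p + (L.concat (.node A B R)).size + 1 ∧
        c ≠ p + L.size := fun c => by
      rw [← hU]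
      simp only [covers_union, covers_insert, Decomp.covers_edges, Decomp.size_concat,
        Decomp.size]
      have := @covers_of_beneath U _ _ c hb
      by_cases hc : Covers U c
      · have := this hc; simp only [hc, true_or, or_true, true_iff]; omega
      · simp only [hc, or_false]; omega
    have htop : ∀ X ∈ U', X.1 ≤ old.1 → old.2 ≤ X.2 →
        p + L.size + A.size + 1 ≤ X.1 ∧ X.2 ≤ p + L.size + A.size + B.size + 1 + 1 :=
      fun X hX h1 h2 => by
      rw [← hU] at hX
      unfold Beneath at hbo
      simp only [Finset.mem_union, Finset.mem_insert] at hX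
      rcases hX with hX | (rfl | hX | hX) | hX
      · have := Decomp.edges_bounds hX; omega
      · exact ⟨le_rfl, le_rfl⟩
      · have := Decomp.edges_bounds hX; omega
      · have := hb X hX; unfold Beneath at this; omega
      · have := Decomp.edges_bounds hX; omega
    have htop' : (p + L.size + A.size + 1, p + L.size + A.size + B.size + 1 + 1) ∈ U' := by
      rw [← hU]; simp
    have hov : p + L.size + A.size + 1 ≤ old.1 ∧ old.1 < old.2 ∧
        old.2 ≤ p + L.size + A.size + B.size + 1 + 1 := by
      unfold Beneath at hbo; omega
    cases h' with
    | shrink => omega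
    | jump => omega
    | stretch => omega
    | right _ _ L' A' B' R' U' _ _ _ h' =>
      have hb' := h'.beneath.1
      have hbo' := hb' _ h'.old_mem
      have t1 := htop (p + L'.size + A'.size + 1, p + L'.size + A'.size + B'.size + 1 + 1)
        (by simp) (by unfold Beneath at hbo'; dsimp only; omega)
        (by unfold Beneath at hbo'; dsimp only; omega)
      have t2 : p + L'.size + A'.size + 1 ≤ p + L.size + A.size + 1 ∧
          p + L.size + A.size + B.size + 1 + 1 ≤ p + L'.size + A'.size + B'.size + 1 + 1 := by
        unfold Beneath at hbo'
        simp only [Finset.mem_union, Finset.mem_insert] at htop'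
        rcases htop' with hX | (hX | hX | hX) | hX
        · have := Decomp.edges_bounds hX; dsimp only at this; omega
        · rw [Prod.mk.injEq] at hX; omega
        · have := Decomp.edges_bounds hX; dsimp only at this; omega
        · have := hb' _ hX; unfold Beneath at this; dsimp only at this; omega
        · have := Decomp.edges_bounds hX; dsimp only at this; omega
      dsimp only at t1
      have h1 : L.size = L'.size := by
        have c1 := hcov (p + L'.size)
        have := @covers_of_beneath U' _ _ (p + L'.size) hb'
        simp only [covers_union, covers_insert, Decomp.covers_edges] at c1
        simp only [Decomp.size_concat, Decomp.size] at hs c1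
        by_cases hc : Covers U' (p + L'.size)
        · have := this hc; simp only [hc, true_or, or_true, true_iff] at c1; omega
        · simp only [hc, or_false] at c1; omega
      have h2 : A.size = A'.size := by omega
      have h3 : B.size = B'.size := by omega
      simp only [Decomp.size_concat, Decomp.size] at hs
      have h4 : R.size = R'.size := by omega
      clear hcov htop
      have hb1 := fun a b => @restr_beneath_in U _ _ a b hb
      have hb2 := fun a b => @restr_beneath_out U _ _ a b hb
      have hb1' := fun a b => @restr_beneath_in U' _ _ a b hb'
      have hb2' := fun a b => @restr_beneath_out U' _ _ a b hb'
      have eL := congrArg (fun S => restr S p (p + L.size)) hU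
      have eA := congrArg (fun S => restr S (p + L.size + 1) (p + L.size + A.size + 1)) hU
      have eB := congrArg (fun S => restr S (p + L.size + A.size + 1)
        (p + L.size + A.size + B.size + 1 + 1)) hU
      have eR := congrArg (fun S => restr S (p + L.size + A.size + B.size + 1 + 1)
        (p + L.size + A.size + B.size + 1 + 1 + R.size)) hU
      simp (disch := omega) only [restr_union, restr_edges_in, restr_edges_out, restr_insert_out,
        restr_insert_in, hb1, hb2, hb1', hb2', Finset.union_empty, Finset.empty_union]
        at eL eA eB eR
      rw [show p + L.size + A.size + 1 + B.size + 1 = p + L.size + A.size + B.size + 1 + 1 by omega]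
        at hb
      rw [← h1, ← h2, ← h3] at eB
      rw [← h1, ← h2, ← h3, show p + L.size + A.size + 1 + B.size + 1 =
        p + L.size + A.size + B.size + 1 + 1 by omega] at hb'
      rw [Decomp.edges_injective (by omega) eL, Decomp.edges_injective (by omega) eA,
        Decomp.edges_injective (by omega) eR,
        ih h' (by omega) (insert_inj_beneath hb hb' eB) rfl rfl rfl h3]
    | left _ _ L' A' B' R' U' _ _ _ h' =>
      exfalso
      have hb' := h'.beneath.1
      have hbo' := hb' _ h'.old_mem
      have t1 := htop (p + L'.size, p + L'.size + A'.size + 1)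
        (by simp) (by unfold Beneath at hbo'; dsimp only; omega)
        (by unfold Beneath at hbo'; dsimp only; omega)
      have c1 := hcov (p + L'.size + A'.size + B'.size + 1)
      have := @covers_of_beneath U' _ _ (p + L'.size + A'.size + B'.size + 1) hb'
      simp only [covers_union, covers_insert, Decomp.covers_edges] at c1
      simp only [Decomp.size_concat, Decomp.size] at hs c1
      dsimp only at t1
      by_cases hc : Covers U' (p + L'.size + A'.size + B'.size + 1)
      · have := this hc; simp only [hc, true_or, or_true, true_iff] at c1; omega
      · simp only [hc, false_or] at c1; omega

end Mid


/-! ### Running a shift sequence -/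

/-- The edge set after a flip. -/
def Flip.apply (f : Flip) (Z : Finset Edge) : Finset Edge := insert f.new (Z.erase f.old)

/-- `Trace P Z fs W`: the flips `fs` lead from `Z` to `W`, and `P` holds for each of them and the
edge set at which it is performed. -/
inductive Trace (P : Finset Edge → Flip → Prop) : Finset Edge → List Flip → Finset Edge → Prop
  | nil (Z : Finset Edge) : Trace P Z [] Z
  | cons {Z : Finset Edge} {f : Flip} {fs : List Flip} {W : Finset Edge} (h : P Z f)
      (ht : Trace P (f.apply Z) fs W) : Trace P Z (f :: fs) W

namespace Trace

variable {P Q : Finset Edge → Flip → Prop} {Z Y W : Finset Edge} {fs gs : List Flip} {f : Flip}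

theorem append (h : Trace P Z fs Y) (h' : Trace P Y gs W) : Trace P Z (fs ++ gs) W := by
  induction h with
  | nil => exact h'
  | cons h _ ih => exact .cons h (ih h')

theorem mono (hPQ : ∀ Z f, P Z f → Q Z f) (h : Trace P Z fs W) : Trace Q Z fs W := by
  induction h with
  | nil => exact .nil _
  | cons h _ ih => exact .cons (hPQ _ _ h) ih

theorem single (h : P Z f) (hW : f.apply Z = W) : Trace P Z [f] W := .cons h (hW ▸ .nil _)

theorem exists_of_mem (h : Trace P Z fs W) {t : Transition} (ht : t ∈ runFlips Z fs) :
    ∃ f, P t.src f ∧ t.tgt = f.apply t.src ∧ t.kind = f.kind ∧ t.depth = f.depth := by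
  induction h with
  | nil => simp [runFlips] at ht
  | cons h _ ih =>
    simp only [runFlips, List.mem_cons] at ht
    rcases ht with rfl | ht
    · exact ⟨_, h, rfl, rfl, rfl⟩
    · exact ih ht

/-- A flip that removes a present edge and adds an absent one is undone by its reverse. What is
known about the reversed flip concerns the edge set `Y` that it leads to, not the one at which it
starts. -/
theorem reverse (hP : ∀ Z f, P Z f → f.old ∈ Z ∧ f.new ∉ Z) (h : Trace P Z fs W) :
    Trace (fun Z f => ∃ Y, P Y f.symm ∧ Z = f.symm.apply Y ∧ f.apply Z = Y) W
      (fs.map Flip.symm).reverse Z := by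
  induction h with
  | nil => exact .nil _
  | @cons Z f fs W h _ ih =>
    obtain ⟨h1, h2⟩ := hP _ _ h
    have hf : f.symm.apply (f.apply Z) = Z := by
      simp only [Flip.apply, Flip.symm]
      rw [Finset.erase_insert (fun hm => h2 (Finset.mem_of_mem_erase hm)), Finset.insert_erase h1]
    rw [List.map_cons, List.reverse_cons]
    exact ih.append (.single ⟨Z, h, rfl, hf⟩ hf)

end Trace

/-- While `C` is shifted, the segment with parts `A` and `B` waits, so it joins the left end of `L`.
-/
theorem Mid.concat_left {δ p d : ℕ} {A B C : Decomp} {U : Finset Edge} {old new : Edge}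
    (h : Mid δ (p + A.size + B.size + 1) C U d old new) :
    Mid δ p (.node A B C) (insert (p, p + A.size + B.size + 1)
      (A.edges p ∪ B.edges (p + A.size + 1)) ∪ U) d old new := by
  have key : ∀ L : Decomp, p + (Decomp.node A B L).size = p + A.size + B.size + 1 + L.size :=
    fun L => by simp only [Decomp.size]; omega
  cases h with
  | shrink _ _ L A' B' R hB =>
    have := Mid.shrink δ p (.node A B L) A' B' R hB
    simpa only [Decomp.concat, key, Decomp.edges, Finset.insert_union, Finset.union_assoc] using this
  | left _ _ L A' B' R U _ _ _ h =>
    have := Mid.left δ p (.node A B L) A' B' R U d old new (by rwa [key])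
    simpa only [Decomp.concat, key, Decomp.edges, Finset.insert_union, Finset.union_assoc] using this
  | jump _ _ L A' B' R =>
    have := Mid.jump δ p (.node A B L) A' B' R
    simpa only [Decomp.concat, key, Decomp.edges, Finset.insert_union, Finset.union_assoc] using this
  | right _ _ L A' B' R U _ _ _ h =>
    have := Mid.right δ p (.node A B L) A' B' R U d old new (by rwa [key])
    simpa only [Decomp.concat, key, Decomp.edges, Finset.insert_union, Finset.union_assoc] using this
  | stretch _ _ L A' B' R hB =>
    have := Mid.stretch δ p (.node A B L) A' B' R hB
    simpa only [Decomp.concat, key, Decomp.edges, Finset.insert_union, Finset.union_assoc] using this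

theorem flip_union {O X Y : Finset Edge} {old new : Edge} (hO : old ∉ O) (hX : old ∉ X)
    (hY : old ∉ Y) (kind : MoveType) (d : ℕ) :
    Flip.apply ⟨kind, d, old, new⟩ (O ∪ (insert old X ∪ Y)) = O ∪ (insert new X ∪ Y) := by
  ext e
  simp only [Flip.apply, Finset.mem_insert, Finset.mem_erase, Finset.mem_union]
  by_cases h : e = old
  · subst h; tauto
  · tauto

/-- `O` holds everything at rest. A recursive call adds to it the other pieces of the current state,
so the induction needs arbitrary `O`. The hypothesis keeps the flipped edges out of `O`. -/
theorem trace_shiftRight (kind : MoveType) (δ p : ℕ) (D : Decomp) (O : Finset Edge)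
    (hO : ∀ X ∈ O, ¬ Beneath p (p + D.size + 1) X) :
    Trace (fun Z f => f.kind = kind ∧ ∃ U, Z = O ∪ U ∧ Mid δ p D U f.depth f.old f.new)
      (O ∪ D.edges p) (shiftRight kind δ p D) (O ∪ D.edges (p + 1)) := by
  induction D generalizing δ p O with
  | nil => exact .nil _
  | node A B C hA hB hC =>
    simp only [Decomp.size] at hO
    have eA : p + 1 + A.size = p + A.size + 1 := by omega
    have eB : p + A.size + 1 + B.size + 1 = p + A.size + B.size + 1 + 1 := by omega
    have eC : p + A.size + 1 + B.size = p + A.size + B.size + 1 := by omega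
    have notO : ∀ x y, p ≤ x → x < y → y ≤ p + A.size + B.size + C.size + 2 →
        (p < x ∨ y < p + A.size + B.size + C.size + 2) → (x, y) ∉ O := fun x y h1 h2 h3 h4 hm =>
      hO _ hm ⟨h1, h2, by dsimp only; omega, by dsimp only; omega⟩
    have notE : ∀ (D : Decomp) (o x y : ℕ), (x < o ∨ o + D.size < y) → (x, y) ∉ D.edges o :=
      fun D o x y h hm => by have := Decomp.edges_bounds hm; dsimp only at this; omega
    have s0 : (Decomp.node A B C).edges p = insert (p, p + A.size + B.size + 1)
        (A.edges p ∪ B.edges (p + A.size + 1)) ∪ C.edges (p + A.size + B.size + 1) := by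
      simp only [Decomp.edges, Finset.insert_union]
    have s7 : (Decomp.node A B C).edges (p + 1) =
        insert (p + 1, p + A.size + B.size + 1 + 1)
        (A.edges (p + 1) ∪ B.edges (p + A.size + 1 + 1)) ∪
        C.edges (p + A.size + B.size + 1 + 1) := by
      simp only [Decomp.edges, eA, eC, Finset.insert_union]
    rw [s0, s7]
    unfold shiftRight
    dsimp only
    -- The intermediate sets are those after the shift of `C`, the shrink, the shift of `A`, the
    -- jump and the shift of `B`.
    refine ((((Trace.append (Y := O ∪ (insert (p, p + A.size + B.size + 1)
        (A.edges p ∪ B.edges (p + A.size + 1)) ∪ C.edges (p + A.size + B.size + 1 + 1))) ?_ ?_).append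
      (Y := O ∪ (insert (p, p + A.size + 1)
        (A.edges p ∪ B.edges (p + A.size + 1)) ∪ C.edges (p + A.size + B.size + 1 + 1))) ?_).append
      (Y := O ∪ (insert (p, p + A.size + 1)
        (A.edges (p + 1) ∪ B.edges (p + A.size + 1)) ∪ C.edges (p + A.size + B.size + 1 + 1))) ?_).append
      (Y := O ∪ (insert (p + A.size + 1, p + A.size + B.size + 1 + 1)
        (A.edges (p + 1) ∪ B.edges (p + A.size + 1)) ∪ C.edges (p + A.size + B.size + 1 + 1))) ?_).append
      (Y := O ∪ (insert (p + A.size + 1, p + A.size + B.size + 1 + 1)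
        (A.edges (p + 1) ∪ B.edges (p + A.size + 1 + 1)) ∪
        C.edges (p + A.size + B.size + 1 + 1))) ?_
    · have := hC δ (p + A.size + B.size + 1) (O ∪ insert (p, p + A.size + B.size + 1)
        (A.edges p ∪ B.edges (p + A.size + 1))) (fun X hX hb => by
          simp only [Finset.mem_union, Finset.mem_insert] at hX
          rcases hX with hX | rfl | hX | hX
          · exact hO X hX (by unfold Beneath at *; omega)
          · unfold Beneath at hb; dsimp only at hb; omega
          all_goals have := Decomp.edges_bounds hX; unfold Beneath at hb; omega)
      simp only [Finset.union_assoc] at this ⊢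
      refine this.mono fun Z f hf => ?_
      obtain ⟨h1, U, rfl, h2⟩ := hf
      exact ⟨h1, _, by rw [← Finset.union_assoc], h2.concat_left⟩
    · split_ifs with h
      · refine .single ⟨rfl, _, rfl, ?_⟩ (flip_union ?_ ?_ ?_ _ _)
        · simpa [Decomp.concat, Decomp.edges, Decomp.size] using
            Mid.shrink δ p .nil A B C (by omega)
        · exact notO _ _ (by omega) (by omega) (by omega) (by omega)
        · exact Finset.notMem_union.2
            ⟨notE _ _ _ _ (by omega), notE _ _ _ _ (by omega)⟩
        · exact notE _ _ _ _ (by omega)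
      -- With `B` empty the edge already ends at the gap, so no flip is made.
      · rw [show p + A.size + B.size + 1 = p + A.size + 1 by omega]
        exact .nil _
    · have := hA (δ + 1) p (O ∪ (insert (p, p + A.size + 1) (B.edges (p + A.size + 1)) ∪
        C.edges (p + A.size + B.size + 1 + 1))) (fun X hX hb => by
          simp only [Finset.mem_union, Finset.mem_insert] at hX
          rcases hX with hX | (rfl | hX) | hX
          · exact hO X hX (by unfold Beneath at *; omega)
          · unfold Beneath at hb; dsimp only at hb; omega
          all_goals have := Decomp.edges_bounds hX; unfold Beneath at hb; omega)
      have key : ∀ U : Finset Edge, O ∪ (insert (p, p + A.size + 1) (B.edges (p + A.size + 1)) ∪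
          C.edges (p + A.size + B.size + 1 + 1)) ∪ U = O ∪ (insert (p, p + A.size + 1)
          (U ∪ B.edges (p + A.size + 1)) ∪ C.edges (p + A.size + B.size + 1 + 1)) := fun U => by
        ext X; simp only [Finset.mem_union, Finset.mem_insert]; tauto
      rw [key, key] at this
      refine this.mono fun Z f hf => ?_
      obtain ⟨h1, U, rfl, h2⟩ := hf
      refine ⟨h1, _, key U, ?_⟩
      simpa [Decomp.concat, Decomp.edges, Decomp.size] using
        Mid.left δ p .nil A B C U _ _ _ (by simpa [Decomp.size] using h2)
    · refine .single ⟨rfl, _, rfl, ?_⟩ (flip_union ?_ ?_ ?_ _ _)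
      · simpa [Decomp.concat, Decomp.edges, Decomp.size] using Mid.jump δ p .nil A B C
      · exact notO _ _ (by omega) (by omega) (by omega) (by omega)
      · exact Finset.notMem_union.2 ⟨notE _ _ _ _ (by omega), notE _ _ _ _ (by omega)⟩
      · exact notE _ _ _ _ (by omega)
    · have := hB (δ + 1) (p + A.size + 1) (O ∪ (insert
        (p + A.size + 1, p + A.size + B.size + 1 + 1) (A.edges (p + 1)) ∪
        C.edges (p + A.size + B.size + 1 + 1))) (fun X hX hb => by
          simp only [Finset.mem_union, Finset.mem_insert] at hX
          rcases hX with hX | (rfl | hX) | hX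
          · exact hO X hX (by unfold Beneath at *; omega)
          · unfold Beneath at hb; dsimp only at hb; omega
          all_goals have := Decomp.edges_bounds hX; unfold Beneath at hb; omega)
      have key : ∀ U : Finset Edge, O ∪ (insert (p + A.size + 1, p + A.size + B.size + 1 + 1)
          (A.edges (p + 1)) ∪ C.edges (p + A.size + B.size + 1 + 1)) ∪ U =
          O ∪ (insert (p + A.size + 1, p + A.size + B.size + 1 + 1)
          (A.edges (p + 1) ∪ U) ∪ C.edges (p + A.size + B.size + 1 + 1)) := fun U => by
        ext X; simp only [Finset.mem_union, Finset.mem_insert]; tauto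
      rw [key, key] at this
      refine this.mono fun Z f hf => ?_
      obtain ⟨h1, U, rfl, h2⟩ := hf
      refine ⟨h1, _, key U, ?_⟩
      simpa [Decomp.concat, Decomp.edges, Decomp.size] using
        Mid.right δ p .nil A B C U _ _ _ (by simpa [Decomp.size] using h2)
    · split_ifs with h
      · refine .single ⟨rfl, _, rfl, ?_⟩ (flip_union ?_ ?_ ?_ _ _)
        · simpa [Decomp.concat, Decomp.edges, Decomp.size] using
            Mid.stretch δ p .nil A B C (by omega)
        · exact notO _ _ (by omega) (by omega) (by omega) (by omega)
        · exact Finset.notMem_union.2 ⟨notE _ _ _ _ (by omega), notE _ _ _ _ (by omega)⟩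
        · exact notE _ _ _ _ (by omega)
      · rw [show p + A.size + 1 = p + 1 by omega]
        exact .nil _


/-! ### Configurations and the flips they perform -/

/-- No two edges of `Z` cross. -/
def NonCrossing (Z : Finset Edge) : Prop :=
  ∀ e ∈ Z, ∀ f ∈ Z, ¬ (e.1 < f.1 ∧ f.1 < e.2 ∧ e.2 < f.2)

/-- The parts of a tree that matter for an adjacent move to the left. In both types `(o, t)` is the
edge `a`, `A` is the tree `A₂` that gets shifted, and `O` consists of the edges, other than `a`,
that no flip moves. In type 1 the edge `e` is `(p, p + A.size + 1)`. In type 2 it is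
`(r + 1 + A.size, g + 1)`, and `r, r + 1` is the gap beneath `a`. -/
inductive Config
  | one (O : Finset Edge) (o p t : ℕ) (A : Decomp)
  | two (O : Finset Edge) (o r g t : ℕ) (A : Decomp)

namespace Config

/-- The position of the edges in `O` relative to those that are moved. -/
def Valid : Config → Prop
  | one O o p t A => o ≤ p ∧ p + A.size + 1 < t ∧
      (∀ X ∈ O, X.1 < X.2 ∧ (X.1 < o ∨ t < X.2 ∨ X.2 ≤ p ∨
        (p + A.size + 1 ≤ X.1 ∧ (p + A.size + 1 < X.1 ∨ X.2 < t)))) ∧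
      -- The tree of `A₁` covers these cells, which leaves `p` as the only uncovered cell beneath
      -- `(o, p + A.size + 1)` just before `M₂`.
      ∀ c, o ≤ c → c < p → ∃ X ∈ O, o ≤ X.1 ∧ X.2 ≤ p ∧ X.1 ≤ c ∧ c < X.2
  | two O o r g t A => o ≤ r ∧ r + 1 + A.size ≤ g ∧ g < t ∧
      (∀ X ∈ O, X.1 < X.2 ∧ (X.1 < o ∨ t < X.2 ∨ X.2 ≤ r ∨
        (r + 1 + A.size ≤ X.1 ∧ X.2 ≤ g) ∨ g + 1 ≤ X.1)) ∧
      -- The trees of `A₁`, `A₃` and `B` cover everything beneath `(o, t)` except `g` and the range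
      -- of the shift.
      ∀ c, o ≤ c → c < t → c ≠ g → (c < r ∨ r + 1 + A.size ≤ c) →
        ∃ X ∈ O, o ≤ X.1 ∧ X.2 ≤ t ∧ X.1 ≤ c ∧ c < X.2

/-- The tree before the adjacent move. -/
def source : Config → Finset Edge
  | one O o p t A => insert (p, p + A.size + 1) (insert (o, t) O ∪ A.edges p)
  | two O o r g t A => insert (r + 1 + A.size, g + 1) (insert (o, t) O ∪ A.edges (r + 1))

/-- The tree after the adjacent move. -/
def target : Config → Finset Edge
  | one O o p t A => insert (o, p + A.size + 1) (insert (p + A.size + 1, t) O ∪ A.edges (p + 1))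
  | two O o r g t A => insert (r, g) (insert (o, t) O ∪ A.edges r)

/-- The flips of the canonical path. -/
def flips : Config → List Flip
  | one _ o p t A => shiftRight .S1 1 p A ++
      [⟨.M1, 0, (p, p + A.size + 1), (o, p + A.size + 1)⟩, ⟨.M2, 0, (o, t), (p + A.size + 1, t)⟩]
  | two _ _ r g _ A => [⟨.M3, 0, (r + 1 + A.size, g + 1), (r, r + 1 + A.size)⟩] ++
      shiftLeft .S2 1 r A ++ [⟨.M4, 0, (r, r + 1 + A.size), (r, g)⟩]

end Config

/-- `Site c Z f`: the canonical path of `c` performs the flip `f` at `Z`. -/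
inductive Site : Config → Finset Edge → Flip → Prop
  | s1 (O : Finset Edge) (o p t : ℕ) (A : Decomp) (U : Finset Edge) (d : ℕ) (old new : Edge)
      (h : Mid 1 p A U d old new) :
    Site (.one O o p t A) (insert (p, p + A.size + 1) (insert (o, t) O ∪ U)) ⟨.S1, d, old, new⟩
  | m1 (O : Finset Edge) (o p t : ℕ) (A : Decomp) :
    Site (.one O o p t A) (insert (p, p + A.size + 1) (insert (o, t) O ∪ A.edges (p + 1)))
      ⟨.M1, 0, (p, p + A.size + 1), (o, p + A.size + 1)⟩
  | m2 (O : Finset Edge) (o p t : ℕ) (A : Decomp) :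
    Site (.one O o p t A) (insert (o, p + A.size + 1) (insert (o, t) O ∪ A.edges (p + 1)))
      ⟨.M2, 0, (o, t), (p + A.size + 1, t)⟩
  | m3 (O : Finset Edge) (o r g t : ℕ) (A : Decomp) :
    Site (.two O o r g t A)
      (insert (r + 1 + A.size, g + 1) (insert (o, t) O ∪ A.edges (r + 1)))
      ⟨.M3, 0, (r + 1 + A.size, g + 1), (r, r + 1 + A.size)⟩
  -- The flip reverses one of `shiftRight`. Hence `Mid` has `old` and `new` exchanged and describes
  -- the edge set after the flip.
  | s2 (O : Finset Edge) (o r g t : ℕ) (A : Decomp) (U Z : Finset Edge) (d : ℕ) (old new : Edge)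
      (h : Mid 1 r A U d new old) (hold : old ∈ Z)
      (hZ : Flip.apply ⟨.S2, d, old, new⟩ Z =
        insert (r, r + 1 + A.size) (insert (o, t) O ∪ U)) :
    Site (.two O o r g t A) Z ⟨.S2, d, old, new⟩
  | m4 (O : Finset Edge) (o r g t : ℕ) (A : Decomp) :
    Site (.two O o r g t A) (insert (r, r + 1 + A.size) (insert (o, t) O ∪ A.edges r))
      ⟨.M4, 0, (r, r + 1 + A.size), (r, g)⟩

/-! ### Reading frame, enclosing edge and gaps off a tree -/

/-- Non-crossing edges over a common edge are nested, so a minimal one is unique. This finds `a`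
from `e` or from the frame. -/
theorem least_over_unique {Z : Finset Edge} {e a a' : Edge} (hZ : NonCrossing Z) (he : e.1 < e.2)
    (ha : a ∈ Z) (ha' : a' ∈ Z) (hea : Over e a) (hea' : Over e a')
    (h : ∀ X ∈ Z, Over e X → X = a ∨ X.1 < a.1 ∨ a.2 < X.2)
    (h' : ∀ X ∈ Z, Over e X → X = a' ∨ X.1 < a'.1 ∨ a'.2 < X.2) : a = a' := by
  rcases h a' ha' hea' with h1 | h1
  · exact h1.symm
  rcases h' a ha hea with h2 | h2
  · exact h2
  have c1 := hZ a ha a' ha'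
  have c2 := hZ a' ha' a ha
  rw [over_iff] at hea hea'
  omega

-- The edges over `x` form a chain, along which the number of members beneath strictly increases.
open Classical in
theorem over_unique_of_card {Z : Finset Edge} {x e e' : Edge} (hZ : NonCrossing Z)
    (hx : x.1 < x.2) (he : e ∈ Z) (he' : e' ∈ Z) (hxe : Over x e) (hxe' : Over x e')
    (h : ((overs Z x).filter fun X => Over X e).card =
      ((overs Z x).filter fun X => Over X e').card) : e = e' := by
  have key : ∀ e e' : Edge, e ∈ Z → Over x e → Over e e' →
      ((overs Z x).filter fun X => Over X e).card <
        ((overs Z x).filter fun X => Over X e').card := fun e e' he hxe hee => by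
    refine Finset.card_lt_card (Finset.ssubset_iff_of_subset (fun X hX => ?_) |>.2 ⟨e, ?_, ?_⟩)
    · rw [Finset.mem_filter] at hX ⊢
      refine ⟨hX.1, ?_⟩
      have := hX.2
      rw [over_iff] at *
      omega
    · exact Finset.mem_filter.2 ⟨mem_overs.2 ⟨he, hxe⟩, hee⟩
    · exact fun hm => (Finset.mem_filter.1 hm).2.2.2 rfl
  by_contra hne
  have c1 := hZ e he e' he'
  have c2 := hZ e' he' e he
  have hor : Over e e' ∨ Over e' e := by
    have hne' : ¬ (e.1 = e'.1 ∧ e.2 = e'.2) := fun h => hne (Prod.ext h.1 h.2)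
    rw [over_iff] at *
    rw [over_iff]
    omega
  rcases hor with h1 | h1
  · exact (key e e' he hxe h1).ne h
  · exact (key e' e he' hxe' h1).ne h.symm

-- The edges between `z` and the frame are all moved edges. By `Mid.depth_eq` their number is then
-- known from the depth.
open Classical in
theorem overs_filter_over {V U : Finset Edge} {x y : ℕ} {z : Edge}
    (hV : ∀ X ∈ V, ¬ (x ≤ X.1 ∧ X.2 ≤ y)) (hU : ∀ X ∈ U, Beneath x y X) :
    ((overs (insert (x, y) (V ∪ U)) z).filter fun X => Over X (x, y)) = overs U z := by
  ext X
  simp only [Finset.mem_filter, mem_overs, Finset.mem_insert, Finset.mem_union]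
  constructor
  · rintro ⟨⟨rfl | hX | hX, ho⟩, ho'⟩
    · exact absurd rfl ho'.2.2
    · exact absurd ⟨ho'.1, ho'.2.1⟩ (hV X hX)
    · exact ⟨hX, ho⟩
  · rintro ⟨hX, ho⟩
    refine ⟨⟨.inr (.inr hX), ho⟩, ?_⟩
    have := hU X hX
    unfold Beneath at this
    rw [over_iff]
    dsimp only
    omega

/-- Once the interval of the shifted tree is known, position alone tells the moved edges from those
at rest. -/
theorem split_unique {e a : Edge} {O O' S S' : Finset Edge} (x y : ℕ)
    (ha : ¬ (x ≤ a.1 ∧ a.2 ≤ y))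
    (hO : ∀ X ∈ O, ¬ (x ≤ X.1 ∧ X.2 ≤ y) ∧ X ≠ a ∧ X ≠ e)
    (hO' : ∀ X ∈ O', ¬ (x ≤ X.1 ∧ X.2 ≤ y) ∧ X ≠ a ∧ X ≠ e)
    (hS : ∀ X ∈ S, (x ≤ X.1 ∧ X.2 ≤ y) ∧ X ≠ e) (hS' : ∀ X ∈ S', (x ≤ X.1 ∧ X.2 ≤ y) ∧ X ≠ e)
    (h : insert e (insert a O ∪ S) = insert e (insert a O' ∪ S')) : O = O' ∧ S = S' := by
  have key := fun X => Finset.ext_iff.1 h X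
  simp only [Finset.mem_insert, Finset.mem_union] at key
  constructor
  · ext X
    constructor
    · intro hX
      obtain ⟨h1, h2, h3⟩ := hO X hX
      rcases (key X).1 (.inr (.inl (.inr hX))) with h4 | (h4 | h4) | h4
      · exact absurd h4 h3
      · exact absurd h4 h2
      · exact h4
      · exact absurd (hS' X h4).1 h1
    · intro hX
      obtain ⟨h1, h2, h3⟩ := hO' X hX
      rcases (key X).2 (.inr (.inl (.inr hX))) with h4 | (h4 | h4) | h4
      · exact absurd h4 h3
      · exact absurd h4 h2
      · exact h4
      · exact absurd (hS X h4).1 h1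
  · ext X
    constructor
    · intro hX
      obtain ⟨h1, h2⟩ := hS X hX
      rcases (key X).1 (.inr (.inr hX)) with h4 | (h4 | h4) | h4
      · exact absurd h4 h2
      · exact absurd (h4 ▸ h1) ha
      · exact absurd h1 (hO' X h4).1
      · exact h4
    · intro hX
      obtain ⟨h1, h2⟩ := hS' X hX
      rcases (key X).2 (.inr (.inr hX)) with h4 | (h4 | h4) | h4
      · exact absurd h4 h2
      · exact absurd (h4 ▸ h1) ha
      · exact absurd h1 (hO X h4).1
      · exact h4

theorem Beneath.within_ne {x y : ℕ} {X : Edge} (h : Beneath x y X) :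
    (x ≤ X.1 ∧ X.2 ≤ y) ∧ X ≠ (x, y) := by
  unfold Beneath at h
  refine ⟨by omega, fun he => ?_⟩
  rw [he] at h
  dsimp only at h
  omega

theorem within_ne_of_mem_edges {D : Decomp} {o x y : ℕ} {e X : Edge} (hX : X ∈ D.edges o)
    (h : x ≤ o ∧ o + D.size ≤ y) (he : e.1 < o ∨ o + D.size < e.2) :
    (x ≤ X.1 ∧ X.2 ≤ y) ∧ X ≠ e := by
  have := Decomp.edges_bounds hX
  refine ⟨by omega, fun h => ?_⟩
  subst h
  omega

/-- The edges of `O` in a configuration of type 1 lie off the interval `[x, y]` beneath `(o, t)`. -/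
theorem Config.Valid.one_off {O : Finset Edge} {o p t : ℕ} {A : Decomp}
    (hv : (Config.one O o p t A).Valid) {u v x y : ℕ} (hx : p ≤ x ∧ y ≤ p + A.size + 1)
    (hu : o ≤ u ∧ u ≤ p ∧ p < v ∧ v ≤ p + A.size + 1) :
    ∀ X ∈ O, ¬ (x ≤ X.1 ∧ X.2 ≤ y) ∧ X ≠ (o, t) ∧ X ≠ (u, v) := by
  obtain ⟨h1, h2, h3, -⟩ := hv
  intro X hX
  have := h3 X hX
  refine ⟨by omega, fun h => ?_, fun h => ?_⟩ <;> (subst h; dsimp only at this; omega)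

theorem Config.Valid.two_off {O : Finset Edge} {o r g t : ℕ} {A : Decomp}
    (hv : (Config.two O o r g t A).Valid) {u v x y : ℕ} (hx : r ≤ x ∧ y ≤ r + 1 + A.size)
    (hu : (u = r ∧ v = r + 1 + A.size) ∨ (u = r + 1 + A.size ∧ v = g + 1)) :
    ∀ X ∈ O, ¬ (x ≤ X.1 ∧ X.2 ≤ y) ∧ X ≠ (o, t) ∧ X ≠ (u, v) := by
  obtain ⟨h1, h2, h4, h3, -⟩ := hv
  intro X hX
  have := h3 X hX
  refine ⟨by omega, fun h => ?_, fun h => ?_⟩ <;> (subst h; dsimp only at this; omega)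

/-- In a configuration of type 1, `(o, t)` is the least edge that passes strictly over `e`. -/
theorem Config.Valid.one_least {O S : Finset Edge} {o p t : ℕ} {A : Decomp}
    (hv : (Config.one O o p t A).Valid)
    (hS : ∀ X ∈ S, Beneath p (p + A.size + 1) X) :
    ∀ X ∈ insert (p, p + A.size + 1) (insert (o, t) O ∪ S), Over (p, p + A.size + 1) X →
      X = (o, t) ∨ X.1 < (o, t).1 ∨ (o, t).2 < X.2 := by
  obtain ⟨h1, h2, h3, -⟩ := hv
  intro X hX ho
  rw [over_iff] at ho
  simp only [Finset.mem_insert, Finset.mem_union] at hX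
  rcases hX with rfl | (hX | hX) | hX
  · dsimp only at ho; omega
  · exact .inl hX
  · have := h3 X hX; dsimp only at *; omega
  · have := hS X hX; unfold Beneath at this; dsimp only at *; omega

theorem Config.Valid.two_least {O S : Finset Edge} {o r g t : ℕ} {A : Decomp} {e : Edge}
    (hv : (Config.two O o r g t A).Valid)
    (he : e = (r, r + 1 + A.size) ∨ e = (r + 1 + A.size, g + 1))
    (hS : ∀ X ∈ S, Beneath r (r + 1 + A.size) X) :
    ∀ X ∈ insert e (insert (o, t) O ∪ S), Over e X →
      X = (o, t) ∨ X.1 < (o, t).1 ∨ (o, t).2 < X.2 := by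
  obtain ⟨h1, h2, h4, h3, -⟩ := hv
  intro X hX ho
  rw [over_iff] at ho
  simp only [Finset.mem_insert, Finset.mem_union] at hX
  rcases hX with rfl | (hX | hX) | hX
  · omega
  · exact .inl hX
  · have := h3 X hX; rcases he with rfl | rfl <;> dsimp only at * <;> omega
  · have := hS X hX; unfold Beneath at this; rcases he with rfl | rfl <;> dsimp only at * <;> omega

/-- The gap beneath `(o, g + 1)` just before the move `M₂`. -/
theorem Config.Valid.one_gap {O : Finset Edge} {o p t : ℕ} {A : Decomp}
    (hv : (Config.one O o p t A).Valid) {c : ℕ} (hc : o ≤ c ∧ c < p + A.size + 1) :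
    (∃ X ∈ insert (o, p + A.size + 1) (insert (o, t) O ∪ A.edges (p + 1)),
      X ≠ (o, p + A.size + 1) ∧ o ≤ X.1 ∧ X.2 ≤ p + A.size + 1 ∧ X.1 ≤ c ∧ c < X.2) ↔ c ≠ p := by
  obtain ⟨h1, h2, h3, h4⟩ := hv
  constructor
  · rintro ⟨X, hX, hne, hXc⟩ rfl
    simp only [Finset.mem_insert, Finset.mem_union] at hX
    rcases hX with hX | (rfl | hX) | hX
    · exact hne hX
    · dsimp only at hXc; omega
    · have := h3 X hX; omega
    · have := Decomp.edges_bounds hX; omega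
  · intro hcp
    rcases lt_or_gt_of_ne hcp with h | h
    · obtain ⟨X, hX, hXc⟩ := h4 c hc.1 h
      refine ⟨X, by simp [hX], fun he => ?_, by omega⟩
      subst he
      dsimp only at hXc
      omega
    · obtain ⟨X, hX, hXc⟩ := (Decomp.covers_edges (D := A) (o := p + 1)).2
        (show p + 1 ≤ c ∧ c < p + 1 + A.size by omega)
      have := Decomp.edges_bounds hX
      refine ⟨X, by simp [hX], fun he => ?_, by omega⟩
      subst he
      dsimp only at this
      omega

/-- The gap beneath `(o, t)` during the shift sequence of a move of type 2. -/
theorem Config.Valid.two_gap {O U : Finset Edge} {o r g t : ℕ} {A : Decomp}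
    (hv : (Config.two O o r g t A).Valid) (hU : ∀ X ∈ U, Beneath r (r + 1 + A.size) X) {c : ℕ}
    (hc : o ≤ c ∧ c < t) :
    (∃ X ∈ insert (r, r + 1 + A.size) (insert (o, t) O ∪ U),
      X ≠ (o, t) ∧ o ≤ X.1 ∧ X.2 ≤ t ∧ X.1 ≤ c ∧ c < X.2) ↔ c ≠ g := by
  have hoff := hv.two_off (x := r) (y := r) (u := r) (v := r + 1 + A.size) (by omega) (by omega)
  obtain ⟨h1, h2, h5, h3, h4⟩ := hv
  constructor
  · rintro ⟨X, hX, hne, hXc⟩ rfl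
    simp only [Finset.mem_insert, Finset.mem_union] at hX
    rcases hX with rfl | (rfl | hX) | hX
    · dsimp only at hXc; omega
    · exact hne rfl
    · have := h3 X hX; omega
    · have := hU X hX; unfold Beneath at this; omega
  · intro hcg
    by_cases h : c < r ∨ r + 1 + A.size ≤ c
    · obtain ⟨X, hX, hXc⟩ := h4 c hc.1 hc.2 hcg h
      exact ⟨X, by simp [hX], (hoff X hX).2.1, hXc⟩
    · refine ⟨_, Finset.mem_insert_self _ _, fun he => ?_, ?_⟩
      · rw [Prod.mk.injEq] at he; omega
      · dsimp only; omega

namespace Site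

theorem old_mem {c : Config} {Z : Finset Edge} {f : Flip} (h : Site c Z f) : f.old ∈ Z := by
  cases h with
  | s1 O o p t A U d old new h => simp [h.old_mem]
  | s2 O o r g t A U Z d old new h hold => exact hold
  | m1 | m2 | m3 | m4 => simp

/-- Shift flips add an absent edge, and `M₂` and `M₃` always change the left endpoint. Only `M₁` and
`M₄` can leave the tree unchanged. -/
theorem kind_of_old_eq_new {c : Config} {Z : Finset Edge} {f : Flip} (h : Site c Z f)
    (hv : c.Valid) (hf : f.old = f.new) : f.kind = .M1 ∨ f.kind = .M4 := by
  cases h with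
  | s1 O o p t A U d old new h =>
    dsimp only at hf
    subst hf
    exact absurd h.old_mem h.new_notMem
  | s2 O o r g t A U Z d old new h hold =>
    dsimp only at hf
    subst hf
    exact absurd h.old_mem h.new_notMem
  | m1 => exact .inl rfl
  | m4 => exact .inr rfl
  | m2 O o p t A =>
    obtain ⟨h1, h2, -⟩ := hv
    simp only [Prod.mk.injEq] at hf
    omega
  | m3 O o r g t A =>
    obtain ⟨h1, h2, -⟩ := hv
    simp only [Prod.mk.injEq] at hf
    omega

/-- Within one configuration the removed edge shows the place: it is strictly beneath the frame in a
shift sequence, and otherwise equals `e`, `a` or the frame itself. -/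
theorem kind_unique {c : Config} {Z Z' : Finset Edge} {f f' : Flip} (h : Site c Z f)
    (h' : Site c Z' f') (hv : c.Valid) (ho : f.old = f'.old) : f.kind = f'.kind := by
  cases h with
  | s1 O o p t A U d old new h =>
    obtain ⟨h1, h2, -⟩ := hv
    have hb := h.beneath.1 _ h.old_mem
    unfold Beneath at hb
    dsimp only at ho
    cases h' with
    | s1 => rfl
    | m1 => subst ho; dsimp only at hb; omega
    | m2 => subst ho; dsimp only at hb; omega
  | m1 O o p t A =>
    obtain ⟨h1, h2, -⟩ := hv
    dsimp only at ho
    cases h' with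
    | s1 _ _ _ _ _ _ _ _ _ h =>
      have hb := h.beneath.1 _ h.old_mem
      unfold Beneath at hb
      subst ho; dsimp only at hb; omega
    | m1 => rfl
    | m2 => rw [Prod.mk.injEq] at ho; omega
  | m2 O o p t A =>
    obtain ⟨h1, h2, -⟩ := hv
    dsimp only at ho
    cases h' with
    | s1 _ _ _ _ _ _ _ _ _ h =>
      have hb := h.beneath.1 _ h.old_mem
      unfold Beneath at hb
      subst ho; dsimp only at hb; omega
    | m1 => rw [Prod.mk.injEq] at ho; omega
    | m2 => rfl
  | s2 O o r g t A U Z d old new h =>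
    obtain ⟨h1, h2, -⟩ := hv
    have hb := h.beneath.2
    unfold Beneath at hb
    dsimp only at ho
    cases h' with
    | s2 => rfl
    | m3 => subst ho; dsimp only at hb; omega
    | m4 => subst ho; dsimp only at hb; omega
  | m3 O o r g t A =>
    obtain ⟨h1, h2, -⟩ := hv
    dsimp only at ho
    cases h' with
    | s2 _ _ _ _ _ _ _ _ _ _ _ h =>
      have hb := h.beneath.2
      unfold Beneath at hb
      subst ho; dsimp only at hb; omega
    | m3 => rfl
    | m4 => rw [Prod.mk.injEq] at ho; omega
  | m4 O o r g t A =>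
    obtain ⟨h1, h2, -⟩ := hv
    dsimp only at ho
    cases h' with
    | s2 _ _ _ _ _ _ _ _ _ _ _ h =>
      have hb := h.beneath.2
      unfold Beneath at hb
      subst ho; dsimp only at hb; omega
    | m3 => rw [Prod.mk.injEq] at ho; omega
    | m4 => rfl

theorem mid_beneath {r d : ℕ} {A : Decomp} {U : Finset Edge} {old new : Edge}
    (h : Mid 1 r A U d old new) : ∀ X ∈ U, Beneath r (r + 1 + A.size) X := by
  have := h.beneath.1
  rwa [show r + A.size + 1 = r + 1 + A.size by omega] at this

theorem depth_unique {c : Config} {Z Z' : Finset Edge} {f f' : Flip} (h : Site c Z f)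
    (h' : Site c Z' f') (hZ : Z = Z') (hv : c.Valid) (ho : f.old = f'.old) (hn : f.new = f'.new)
    (hk : f.kind = .S1 ∨ f.kind = .S2) : f.depth = f'.depth := by
  have hk' := kind_unique h h' hv ho
  cases h with
  | m1 | m2 | m3 | m4 => simp at hk
  | s1 O o p t A U d old new h =>
    cases h' with
    | m1 | m2 => simp at hk'
    | s1 _ _ _ _ _ U' _ _ _ h' =>
      obtain ⟨-, hU⟩ := split_unique p (p + A.size + 1)
        (by have := hv.2.1; dsimp only; omega) (hv.one_off (by omega) (by have := hv.1; omega))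
        (hv.one_off (by omega) (by have := hv.1; omega))
        (fun X hX => (h.beneath.1 X hX).within_ne) (fun X hX => (h'.beneath.1 X hX).within_ne) hZ
      dsimp only at ho ⊢
      rw [h.depth_eq, h'.depth_eq, hU, ho]
  | s2 O o r g t A U Z d old new h hold hY =>
    cases h' with
    | m3 | m4 => simp at hk'
    | s2 _ _ _ _ _ _ U' _ _ _ _ h' hold' hY' =>
      dsimp only at ho hn ⊢
      have hE := hY.symm.trans ((show Flip.apply ⟨.S2, d, old, new⟩ Z = _ by
        rw [Flip.apply, hZ, ho, hn]; rfl).trans hY')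
      obtain ⟨h1, h2, h3, -⟩ := id hv
      obtain ⟨-, hU⟩ := split_unique r (r + 1 + A.size)
        (by dsimp only; omega) (hv.two_off (by omega) (by omega))
        (hv.two_off (by omega) (by omega))
        (fun X hX => (mid_beneath h X hX).within_ne)
        (fun X hX => (mid_beneath h' X hX).within_ne) hE
      rw [h.depth_eq, h'.depth_eq, hU, hn]

/-- The edges over the flipped one, together with the frame, are `d` distinct edges of a single
tree. For `S₂` this is the tree after the flip. -/
theorem depth_bounds {c : Config} {Z : Finset Edge} {f : Flip} (h : Site c Z f)
    (hk : f.kind = .S1 ∨ f.kind = .S2) :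
    1 ≤ f.depth ∧ (f.depth ≤ Z.card ∨ f.depth ≤ (f.apply Z).card) := by
  have key : ∀ {p d : ℕ} {A : Decomp} {U V : Finset Edge} {old new : Edge},
      Mid 1 p A U d old new → d ≤ (insert (p, p + A.size + 1) (V ∪ U)).card := by
    intro p d A U V old new h
    rw [h.depth_eq, add_comm, ← Finset.card_insert_of_notMem (a := (p, p + A.size + 1))]
    · refine Finset.card_le_card (Finset.insert_subset_insert _ fun X hX => ?_)
      exact Finset.mem_union_right _ (mem_overs.1 hX).1
    · intro hm
      exact (h.beneath.1 _ (mem_overs.1 hm).1).within_ne.2 rfl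
  cases h with
  | m1 | m2 | m3 | m4 => simp at hk
  | s1 O o p t A U d old new h =>
    exact ⟨h.le_depth, .inl (key h)⟩
  | s2 O o r g t A U Z d old new h hold hY =>
    refine ⟨h.le_depth, .inr ?_⟩
    rw [hY, show r + 1 + A.size = r + A.size + 1 by omega]
    exact key h

end Site


/-! ### Decoding a transition -/

open Classical in
/-- The frame of a shift sequence is determined by the depth of the flip. -/
theorem frame_unique {p p' y y' d : ℕ} {A A' : Decomp} {U U' V V' : Finset Edge} {z new : Edge}
    (h : Mid 1 p A U d z new) (h' : Mid 1 p' A' U' d z new)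
    (hy : y = p + A.size + 1) (hy' : y' = p' + A'.size + 1)
    (hV : ∀ X ∈ V, ¬ (p ≤ X.1 ∧ X.2 ≤ y))
    (hV' : ∀ X ∈ V', ¬ (p' ≤ X.1 ∧ X.2 ≤ y'))
    (hE : insert (p, y) (V ∪ U) = insert (p', y') (V' ∪ U'))
    (hN : NonCrossing (insert (p, y) (V ∪ U))) :
    p = p' ∧ y = y' := by
  subst hy hy'
  have hb := h.beneath.1 _ h.old_mem
  have hb' := h'.beneath.1 _ h'.old_mem
  have h1 := overs_filter_over (z := z) hV h.beneath.1
  have h2 := overs_filter_over (z := z) hV' h'.beneath.1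
  have h3 := h.depth_eq
  have h4 := h'.depth_eq
  unfold Beneath at hb hb'
  -- Both frames pass over `z` with exactly `d - 1` edges in between.
  have := over_unique_of_card (x := z) (e := (p, p + A.size + 1)) (e' := (p', p' + A'.size + 1)) hN
    (by omega) (by simp) (by rw [hE]; simp) (by rw [over_iff]; dsimp only; omega)
    (by rw [over_iff]; dsimp only; omega) (by rw [h1, hE, h2]; omega)
  rwa [Prod.mk.injEq] at this

/-- In every case the interval of the shifted tree and the edge `(o, t)` are found first, from the
flip, the depth and the nesting of edges. `split_unique` then gives `O` and the state of the shifted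
tree, which determines the tree. -/
theorem Site.unique {c c' : Config} {Z Z' : Finset Edge} {f f' : Flip} (h : Site c Z f)
    (h' : Site c' Z' f') (hv : c.Valid) (hv' : c'.Valid) (hZ : Z = Z') (hN : NonCrossing Z)
    (hN' : NonCrossing (f.apply Z)) (ho : f.old = f'.old) (hn : f.new = f'.new)
    (hk : f.kind = f'.kind) (hd : f.kind = .S1 ∨ f.kind = .S2 → f.depth = f'.depth) : c = c' := by
  cases h with
  | s1 O o p t A U d old new h =>
    cases h' with
    | m1 | m2 | m3 | m4 | s2 => simp at hk
    | s1 O' o' p' t' A' U' d' _ _ h' =>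
      have hd' := hd (.inl rfl)
      dsimp only at ho hn hd'
      subst ho hn hd'
      obtain ⟨h1, h2, -⟩ := id hv
      obtain ⟨h1', h2', -⟩ := id hv'
      have off : ∀ {O : Finset Edge} {o p t : ℕ} {A : Decomp}, (Config.one O o p t A).Valid →
          ∀ X ∈ insert (o, t) O, ¬ (p ≤ X.1 ∧ X.2 ≤ p + A.size + 1) := by
        intro O o p t A hv X hX
        rcases Finset.mem_insert.1 hX with rfl | hX
        · have := hv.2.1; dsimp only; omega
        · exact (hv.one_off (u := p) (v := p + A.size + 1) (x := p) (y := p + A.size + 1) (by omega)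
            (by have := hv.1; omega) X hX).1
      obtain ⟨hp, hy⟩ := frame_unique h h' rfl rfl (off hv) (off hv') hZ hN
      have hs : A.size = A'.size := by omega
      subst hp
      have ha := least_over_unique (e := (p, p + A.size + 1)) (a := (o, t)) (a' := (o', t')) hN
        (by dsimp only; omega) (by simp) (by rw [hZ]; simp)
        (by rw [over_iff]; dsimp only; omega) (by rw [over_iff]; dsimp only; omega)
        (hv.one_least h.beneath.1) (by rw [hZ, hs]; exact hv'.one_least h'.beneath.1)
      rw [Prod.mk.injEq] at ha
      obtain ⟨rfl, rfl⟩ := ha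
      rw [← hs] at hZ
      obtain ⟨rfl, hU⟩ := split_unique p (p + A.size + 1)
        (by dsimp only; omega) (hv.one_off (by omega) (by omega))
        (hv'.one_off (by omega) (by omega)) (fun X hX => (h.beneath.1 X hX).within_ne)
        (fun X hX => by rw [hs]; exact (h'.beneath.1 X hX).within_ne) hZ
      rw [h.unique h' rfl hU rfl rfl rfl hs]
  | m1 O o p t A =>
    cases h' with
    | s1 | m2 | m3 | m4 | s2 => simp at hk
    | m1 O' o' p' t' A' =>
      simp only [Prod.mk.injEq] at ho
      obtain ⟨rfl, hy⟩ := ho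
      have hs : A.size = A'.size := by omega
      obtain ⟨h1, h2, -⟩ := id hv
      obtain ⟨h1', h2', -⟩ := id hv'
      have bA : ∀ X ∈ A.edges (p + 1), Beneath p (p + A.size + 1) X := fun X hX =>
        beneath_edges hX (by omega) (by omega) (by omega)
      have bA' : ∀ X ∈ A'.edges (p + 1), Beneath p (p + A'.size + 1) X := fun X hX =>
        beneath_edges hX (by omega) (by omega) (by omega)
      have ha := least_over_unique (e := (p, p + A.size + 1)) (a := (o, t)) (a' := (o', t')) hN
        (by dsimp only; omega) (by simp) (by rw [hZ]; simp)
        (by rw [over_iff]; dsimp only; omega) (by rw [over_iff]; dsimp only; omega)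
        (hv.one_least bA) (by rw [hZ, hs]; exact hv'.one_least bA')
      rw [Prod.mk.injEq] at ha
      obtain ⟨rfl, rfl⟩ := ha
      rw [← hs] at hZ
      obtain ⟨rfl, hU⟩ := split_unique p (p + A.size + 1)
        (by dsimp only; omega) (hv.one_off (by omega) (by omega))
        (hv'.one_off (by omega) (by omega)) (fun X hX => (bA X hX).within_ne)
        (fun X hX => by rw [hs]; exact (bA' X hX).within_ne) hZ
      rw [Decomp.edges_injective rfl hU]
  | m2 O o p t A =>
    cases h' with
    | s1 | m1 | m3 | m4 | s2 => simp at hk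
    | m2 O' o' p' t' A' =>
      simp only [Prod.mk.injEq] at ho hn
      obtain ⟨rfl, rfl⟩ := ho
      obtain ⟨hy, -⟩ := hn
      obtain ⟨h1, h2, -⟩ := id hv
      obtain ⟨h1', h2', -⟩ := id hv'
      -- The flip does not show where `A` begins. This is the one cell beneath `(o, p + A.size + 1)`
      -- that no other edge there covers.
      have hp : p = p' := by
        by_contra hne
        have g1 := (hv.one_gap (c := p') (by omega)).2 (fun h => hne h.symm)
        rw [hZ, hy] at g1
        exact (hv'.one_gap (c := p') (by omega)).1 g1 rfl
      subst hp
      have hs : A.size = A'.size := by omega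
      rw [← hs] at hZ
      obtain ⟨rfl, hU⟩ := split_unique (p + 1) (p + A.size + 1)
        (by dsimp only; omega) (hv.one_off (by omega) (by omega))
        (hv'.one_off (by omega) (by omega))
        (fun X hX => within_ne_of_mem_edges hX (by omega) (by dsimp only; omega))
        (fun X hX => within_ne_of_mem_edges hX (by omega) (by dsimp only; omega)) hZ
      rw [Decomp.edges_injective rfl hU]
  | m3 O o r g t A =>
    cases h' with
    | s1 | m1 | m2 | m4 | s2 => simp at hk
    | m3 O' o' r' g' t' A' =>
      simp only [Prod.mk.injEq] at ho hn
      obtain ⟨hq, hg⟩ := ho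
      obtain ⟨rfl, -⟩ := hn
      obtain rfl : g = g' := by omega
      have hs : A.size = A'.size := by omega
      obtain ⟨h1, h2, h3, -⟩ := id hv
      obtain ⟨h1', h2', h3', -⟩ := id hv'
      have bA : ∀ X ∈ A.edges (r + 1), Beneath r (r + 1 + A.size) X := fun X hX =>
        beneath_edges hX (by omega) (by omega) (by omega)
      have bA' : ∀ X ∈ A'.edges (r + 1), Beneath r (r + 1 + A'.size) X := fun X hX =>
        beneath_edges hX (by omega) (by omega) (by omega)
      have ha := least_over_unique (e := (r + 1 + A.size, g + 1)) (a := (o, t)) (a' := (o', t')) hN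
        (by dsimp only; omega) (by simp) (by rw [hZ]; simp)
        (by rw [over_iff]; dsimp only; omega) (by rw [over_iff]; dsimp only; omega)
        (hv.two_least (.inr rfl) bA) (by rw [hZ, hs]; exact hv'.two_least (.inr rfl) bA')
      rw [Prod.mk.injEq] at ha
      obtain ⟨rfl, rfl⟩ := ha
      rw [← hs] at hZ
      obtain ⟨rfl, hU⟩ := split_unique (r + 1) (r + 1 + A.size)
        (by dsimp only; omega) (hv.two_off (by omega) (by omega))
        (hv'.two_off (by omega) (by omega))
        (fun X hX => within_ne_of_mem_edges hX (by omega) (by dsimp only; omega))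
        (fun X hX => within_ne_of_mem_edges hX (by omega) (by dsimp only; omega)) hZ
      rw [Decomp.edges_injective rfl hU]
  | m4 O o r g t A =>
    cases h' with
    | s1 | m1 | m2 | m3 | s2 => simp at hk
    | m4 O' o' r' g' t' A' =>
      simp only [Prod.mk.injEq] at ho hn
      obtain ⟨rfl, hq⟩ := ho
      obtain ⟨-, rfl⟩ := hn
      have hs : A.size = A'.size := by omega
      obtain ⟨h1, h2, h3, -⟩ := id hv
      obtain ⟨h1', h2', h3', -⟩ := id hv'
      have bA : ∀ X ∈ A.edges r, Beneath r (r + 1 + A.size) X := fun X hX =>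
        beneath_edges hX (by omega) (by omega) (by omega)
      have bA' : ∀ X ∈ A'.edges r, Beneath r (r + 1 + A'.size) X := fun X hX =>
        beneath_edges hX (by omega) (by omega) (by omega)
      have ha := least_over_unique (e := (r, r + 1 + A.size)) (a := (o, t)) (a' := (o', t')) hN
        (by dsimp only; omega) (by simp) (by rw [hZ]; simp)
        (by rw [over_iff]; dsimp only; omega) (by rw [over_iff]; dsimp only; omega)
        (hv.two_least (.inl rfl) bA) (by rw [hZ, hs]; exact hv'.two_least (.inl rfl) bA')
      rw [Prod.mk.injEq] at ha
      obtain ⟨rfl, rfl⟩ := ha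
      rw [← hs] at hZ
      obtain ⟨rfl, hU⟩ := split_unique r (r + 1 + A.size)
        (by dsimp only; omega) (hv.two_off (by omega) (by omega))
        (hv'.two_off (by omega) (by omega))
        (fun X hX => within_ne_of_mem_edges hX (by omega) (by dsimp only; omega))
        (fun X hX => within_ne_of_mem_edges hX (by omega) (by dsimp only; omega)) hZ
      rw [Decomp.edges_injective rfl hU]
  | s2 O o r g t A U Z d old new h hold hY =>
    cases h' with
    | s1 | m1 | m2 | m3 | m4 => simp at hk
    | s2 O' o' r' g' t' A' U' _ d' _ _ h' hold' hY' =>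
      have hd' := hd (.inr rfl)
      dsimp only at ho hn hd'
      subst ho hn hd' hZ
      obtain ⟨h1, h2, h3, -⟩ := id hv
      obtain ⟨h1', h2', h3', -⟩ := id hv'
      have off : ∀ {O : Finset Edge} {o r g t : ℕ} {A : Decomp}, (Config.two O o r g t A).Valid →
          ∀ X ∈ insert (o, t) O, ¬ (r ≤ X.1 ∧ X.2 ≤ r + 1 + A.size) := by
        intro O o r g t A hv X hX
        obtain ⟨h1, h2, h3, -⟩ := id hv
        rcases Finset.mem_insert.1 hX with rfl | hX
        · dsimp only; omega
        · exact (hv.two_off (u := r) (v := r + 1 + A.size) (x := r) (y := r + 1 + A.size) (by omega)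
            (by omega) X hX).1
      -- Both configurations describe the tree after the flip, so the comparison takes place there.
      have hE := hY.symm.trans hY'
      rw [hY] at hN'
      have bU := Site.mid_beneath h
      have bU' := Site.mid_beneath h'
      obtain ⟨hr, hy⟩ := frame_unique h h' (by omega) (by omega) (off hv) (off hv') hE hN'
      have hs : A.size = A'.size := by omega
      subst hr
      have ha := least_over_unique (e := (r, r + 1 + A.size)) (a := (o, t)) (a' := (o', t')) hN'
        (by dsimp only; omega) (by simp) (by rw [hE]; simp)
        (by rw [over_iff]; dsimp only; omega) (by rw [over_iff]; dsimp only; omega)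
        (hv.two_least (.inl rfl) bU) (by rw [hE, hs]; exact hv'.two_least (.inl rfl) bU')
      rw [Prod.mk.injEq] at ha
      obtain ⟨rfl, rfl⟩ := ha
      -- Neither the flip nor the frame involves `g`; it is the only uncovered cell beneath `(o,
      -- t)`.
      have hg : g = g' := by
        by_contra hne
        have g1 := (hv.two_gap bU (c := g') (by omega)).2 (fun h => hne h.symm)
        rw [hE] at g1
        exact (hv'.two_gap bU' (c := g') (by omega)).1 g1 rfl
      subst hg
      rw [← hs] at hE
      obtain ⟨rfl, hU⟩ := split_unique r (r + 1 + A.size)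
        (by dsimp only; omega) (hv.two_off (by omega) (by omega))
        (hv'.two_off (by omega) (by omega)) (fun X hX => (bU X hX).within_ne)
        (fun X hX => by rw [hs]; exact (bU' X hX).within_ne) hE
      rw [h.unique h' rfl hU rfl rfl rfl hs]

/-- `Site` lists only what a flip sees. Running the flips from the source shows that every
transition of the canonical path is of this form. The type 2 shift is obtained by reversing the
trace of a shift to the right. -/
theorem Config.source_trace {c : Config} (hv : c.Valid) :
    Trace (Site c) c.source c.flips c.target := by
  cases c with
  | one O o p t A =>
    obtain ⟨h1, h2, -⟩ := id hv
    have off := hv.one_off (u := o) (v := p + A.size + 1) (x := p) (y := p + A.size + 1)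
      (by omega) (by omega)
    have offe := hv.one_off (u := p) (v := p + A.size + 1) (x := p) (y := p + A.size + 1)
      (by omega) (by omega)
    have notE : ∀ x y, (x < p + 1 ∨ p + 1 + A.size < y) → (x, y) ∉ A.edges (p + 1) :=
      fun x y h hm => by have := Decomp.edges_bounds hm; dsimp only at this; omega
    have := trace_shiftRight .S1 1 p A (insert (p, p + A.size + 1) (insert (o, t) O))
      (fun X hX hb => by
        unfold Beneath at hb
        simp only [Finset.mem_insert] at hX
        rcases hX with rfl | rfl | hX
        · dsimp only at hb; omega
        · dsimp only at hb; omega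
        · have := (off X hX).1; omega)
    simp only [Finset.insert_union] at this
    have hm1 : Flip.apply ⟨.M1, 0, (p, p + A.size + 1), (o, p + A.size + 1)⟩
        (insert (p, p + A.size + 1) (insert (o, t) O ∪ A.edges (p + 1))) =
        insert (o, p + A.size + 1) (insert (o, t) O ∪ A.edges (p + 1)) := by
      rw [Flip.apply, Finset.erase_insert]
      intro hm
      simp only [Finset.mem_insert, Finset.mem_union, Prod.mk.injEq] at hm
      rcases hm with (hm | hm) | hm
      · omega
      · exact (offe _ hm).2.2 rfl
      · exact notE _ _ (by omega) hm
    refine Trace.append (Y := insert (p, p + A.size + 1) (insert (o, t) O ∪ A.edges (p + 1))) ?_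
      (.cons (.m1 O o p t A) (.single ?_ ?_))
    · simp only [source, Finset.insert_union]
      refine this.mono fun Z f hf => ?_
      obtain ⟨kind, d, old, new⟩ := f
      obtain ⟨rfl, U, rfl, hm⟩ := hf
      have := Site.s1 O o p t A U d old new hm
      simpa only [Finset.insert_union] using this
    · rw [hm1]
      exact .m2 O o p t A
    · rw [hm1, target, Finset.insert_eq (o, p + A.size + 1), Finset.insert_eq (o, p + A.size + 1)]
      refine flip_union ?_ (fun hm => (off _ hm).2.1 rfl) (fun hm => ?_) _ _
      · rw [Finset.mem_singleton, Prod.mk.injEq]; omega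
      · have := Decomp.edges_bounds hm; dsimp only at this; omega
  | two O o r g t A =>
    obtain ⟨h1, h2, h3, -⟩ := id hv
    have off := hv.two_off (u := r) (v := r + 1 + A.size) (x := r) (y := r + 1 + A.size)
      (by omega) (by omega)
    have offe := hv.two_off (u := r + 1 + A.size) (v := g + 1) (x := r) (y := r + 1 + A.size)
      (by omega) (by omega)
    have := trace_shiftRight .S2 1 r A (insert (r, r + 1 + A.size) (insert (o, t) O))
      (fun X hX hb => by
        unfold Beneath at hb
        simp only [Finset.mem_insert] at hX
        rcases hX with rfl | rfl | hX
        · dsimp only at hb; omega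
        · dsimp only at hb; omega
        · have := (off X hX).1; omega)
    have hO : ∀ X ∈ insert (r, r + 1 + A.size) (insert (o, t) O),
        ¬ Beneath r (r + A.size + 1) X := fun X hX hb => by
      unfold Beneath at hb
      simp only [Finset.mem_insert] at hX
      rcases hX with rfl | rfl | hX
      · dsimp only at hb; omega
      · dsimp only at hb; omega
      · have := (off X hX).1; omega
    have hrev := this.reverse (fun Z f hf => by
      obtain ⟨-, U, rfl, hm⟩ := hf
      refine ⟨Finset.mem_union_right _ hm.old_mem, fun h => ?_⟩
      rcases Finset.mem_union.1 h with h | h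
      · exact hO _ h hm.beneath.2
      · exact hm.new_notMem h)
    simp only [Finset.insert_union] at hrev
    refine Trace.append (Y := insert (r, r + 1 + A.size) (insert (o, t) O ∪ A.edges r))
      (Trace.append (Y := insert (r, r + 1 + A.size) (insert (o, t) O ∪ A.edges (r + 1)))
        (.single (.m3 O o r g t A) ?_) ?_) (.single (.m4 O o r g t A) ?_)
    · rw [source, Flip.apply, Finset.erase_insert]
      intro hm
      simp only [Finset.mem_insert, Finset.mem_union, Prod.mk.injEq] at hm
      rcases hm with (hm | hm) | hm
      · omega
      · exact (offe _ hm).2.2 rfl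
      · have := Decomp.edges_bounds hm; dsimp only at this; omega
    · simp only [Finset.insert_union]
      refine hrev.mono fun Z f hf => ?_
      obtain ⟨kind, d, old, new⟩ := f
      obtain ⟨Y, ⟨hk, U, rfl, hm⟩, hZ, hY⟩ := hf
      obtain rfl : kind = .S2 := hk
      refine Site.s2 O o r g t A U Z d old new hm ?_ ?_
      · rw [hZ]; exact Finset.mem_insert_self _ _
      · rw [hY]; simp only [Finset.insert_union]
    · rw [Flip.apply, Finset.erase_insert, target]
      intro hm
      simp only [Finset.mem_insert, Finset.mem_union, Prod.mk.injEq] at hm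
      rcases hm with (hm | hm) | hm
      · omega
      · exact (off _ hm).2.2 rfl
      · have := Decomp.edges_bounds hm; dsimp only at this; omega


/-! ### Heights, and the flips computed from a path -/

theorem height_zero (w : List Step) : height w 0 = 0 := by simp [height]

theorem height_add (w : List Step) (i j : ℕ) :
    height w (i + j) = height w i + height (w.drop i) j := by
  simp [height, List.take_add]

theorem height_cons_succ (s : Step) (w : List Step) (j : ℕ) :
    height (s :: w) (j + 1) = s.val + height w j := by
  simp [height]

theorem height_append_of_le {u v : List Step} {j : ℕ} (h : j ≤ u.length) :
    height (u ++ v) j = height u j := by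
  simp [height, List.take_append_of_le_length h]

theorem Decomp.height_word_length (D : Decomp) : height D.word (3 * D.size) = 0 := by
  rw [height, ← D.length_word, List.take_length, sum_word]

theorem le_height_cons {c : ℤ} {s : Step} {v : List Step} (hc : c ≤ 0)
    (h : ∀ i, c ≤ s.val + height v i) (j : ℕ) : c ≤ height (s :: v) j := by
  cases j with
  | zero => simpa [height_zero] using hc
  | succ j => rw [height_cons_succ]; exact h j

/-- The suffix `v` carries the induction: a part of a node is followed by the rest of the word,
whose heights relative to that part may be lower by one after the first up-step and by two after the
second. -/
theorem Decomp.le_height_word_append (D : Decomp) {c : ℤ} {v : List Step} (hc : c ≤ 0)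
    (h : ∀ i, c ≤ height v i) (j : ℕ) : c ≤ height (D.word ++ v) j := by
  induction D generalizing c v j with
  | nil => exact h j
  | node A B C hA hB hC =>
    simp only [word, List.cons_append, List.append_assoc]
    refine le_height_cons hc (fun j => ?_) j
    have := hA (c := c - 1) (v := .up :: (B.word ++ .down :: (C.word ++ v))) (by omega)
      (le_height_cons (by omega) fun j => ?_) j
    · simp only [Step.val]; omega
    · have := hB (c := c - 2) (v := .down :: (C.word ++ v)) (by omega)
        (le_height_cons (by omega) fun j => ?_) j
      · simp only [Step.val]; omega
      · have := hC hc h j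
        simp only [Step.val]; omega

theorem Decomp.height_word_nonneg (D : Decomp) (j : ℕ) : 0 ≤ height D.word j := by
  have := D.le_height_word_append (c := 0) (v := []) le_rfl (fun i => by simp [height]) j
  simpa using this

/-- Reading one step of a word. -/
theorem height_of_drop_cons {w v : List Step} {i : ℕ} {s : Step} (h : w.drop i = s :: v) :
    height w (i + 1) = height w i + s.val ∧ w.drop (i + 1) = v ∧ i < w.length := by
  refine ⟨?_, ?_, ?_⟩
  · rw [height_add, h]; simp [height]
  · rw [← List.drop_drop, h]; rfl
  · by_contra hc
    rw [List.drop_eq_nil_of_le (by omega)] at h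
    simp at h

/-- Reading a 2-Dyck path inside a word. -/
theorem height_of_drop_word {w v : List Step} {i : ℕ} {D : Decomp} (h : w.drop i = D.word ++ v) :
    (∀ j, i ≤ j → j ≤ i + 3 * D.size → height w i ≤ height w j) ∧
    height w (i + 3 * D.size) = height w i ∧ w.drop (i + 3 * D.size) = v ∧
    slice w i (i + 3 * D.size) = D.word := by
  refine ⟨fun j h1 h2 => ?_, ?_, ?_, ?_⟩
  · obtain ⟨k, rfl⟩ := Nat.exists_eq_add_of_le h1
    rw [height_add, h, height_append_of_le (by rw [D.length_word]; omega)]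
    have := D.height_word_nonneg k
    omega
  · rw [height_add, h, height_append_of_le (by rw [D.length_word]), D.height_word_length, add_zero]
  · rw [← List.drop_drop, h, ← D.length_word, List.drop_left]
  · rw [slice, List.drop_take, h, Nat.add_sub_cancel_left, ← D.length_word, List.take_left]

theorem lastAt_eq {w : List Step} {h : ℤ} {k m : ℕ} (hm : m ≤ k) (h1 : height w m = h)
    (h2 : ∀ j, m < j → j ≤ k → h < height w j) : lastAt w h k = m := by
  rw [lastAt, Nat.findGreatest_eq_iff]
  exact ⟨hm, fun _ => h1, fun j hj hjk => (h2 j hj hjk).ne'⟩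

theorem findIdx_range {p : ℕ → Bool} {N m : ℕ} (hm : m < N) (h1 : p m = true)
    (h2 : ∀ j, j < m → p j = false) : (List.range N).findIdx p = m := by
  rw [List.findIdx_eq (by simpa using hm)]
  simp only [List.getElem_range]
  exact ⟨h1, h2⟩

theorem leftFlips_of_type_one {w v : List Step} {b : ℕ} {A₁ A₂ B₁ B₂ : Decomp}
    (h : w.drop b = .up :: (A₁.word ++ .up :: (A₂.word ++ .up :: .down :: (B₁.word ++
      .up :: (B₂.word ++ .down :: v))))) :
    leftFlips w (b + 2 + 3 * A₁.size + 3 * A₂.size + 1) =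
      shiftRight .S1 1 ((parse w).pointAt (b + 1 + 3 * A₁.size)) A₂ ++
      [⟨.M1, 0, ((parse w).pointAt (b + 1 + 3 * A₁.size),
          (parse w).pointAt (b + 2 + 3 * A₁.size + 3 * A₂.size) + 1),
        ((parse w).pointAt b, (parse w).pointAt (b + 2 + 3 * A₁.size + 3 * A₂.size) + 1)⟩,
       ⟨.M2, 0, ((parse w).pointAt b, (parse w).pointAt
          (b + 6 + 3 * A₁.size + 3 * A₂.size + 3 * B₁.size + 3 * B₂.size)),
        ((parse w).pointAt (b + 2 + 3 * A₁.size + 3 * A₂.size) + 1, (parse w).pointAt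
          (b + 6 + 3 * A₁.size + 3 * A₂.size + 3 * B₁.size + 3 * B₂.size))⟩] := by
  have x1 : b + 1 + 3 * A₁.size + 1 + 3 * A₂.size = b + 2 + 3 * A₁.size + 3 * A₂.size := by omega
  have x2 : b + 2 + 3 * A₁.size + 3 * A₂.size + 1 + 1 + 3 * B₁.size + 1 + 3 * B₂.size + 1 =
    b + 6 + 3 * A₁.size + 3 * A₂.size + 3 * B₁.size + 3 * B₂.size := by omega
  obtain ⟨s1, d1, -⟩ := height_of_drop_cons h
  obtain ⟨f2, e2, d2, -⟩ := height_of_drop_word d1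
  obtain ⟨s3, d3, -⟩ := height_of_drop_cons d2
  obtain ⟨f4, e4, d4, sl⟩ := height_of_drop_word d3
  rw [x1] at e4 d4 sl
  obtain ⟨s5, d5, -⟩ := height_of_drop_cons d4
  obtain ⟨s6, d6, -⟩ := height_of_drop_cons d5
  obtain ⟨f7, e7, d7, -⟩ := height_of_drop_word d6
  obtain ⟨s8, d8, -⟩ := height_of_drop_cons d7
  obtain ⟨f9, e9, d9, -⟩ := height_of_drop_word d8
  obtain ⟨s10, -, l10⟩ := height_of_drop_cons d9
  rw [x2] at s10
  simp only [Step.val] at s1 s3 s5 s6 s8 s10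
  -- `B₁` stays at least at the height of `y`, and `B₂` at least one above it. The first drop below
  -- is the closing down-step, which ends one below.
  have hy : (List.range (w.length + 1)).findIdx (fun j =>
      decide (b + 2 + 3 * A₁.size + 3 * A₂.size + 1 + 1 < j ∧
        (height w j = height w (b + 2 + 3 * A₁.size + 3 * A₂.size + 1 + 1) - 1 ∨
        height w j = height w (b + 2 + 3 * A₁.size + 3 * A₂.size + 1 + 1) - 2))) =
      b + 6 + 3 * A₁.size + 3 * A₂.size + 3 * B₁.size + 3 * B₂.size := by
    refine findIdx_range (by omega) (decide_eq_true ⟨by omega, by omega⟩)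
      fun j hj => decide_eq_false ?_
    rintro ⟨h1, h2⟩
    have := f7 j
    have := f9 j
    omega
  unfold leftFlips
  simp only [hy, Nat.add_sub_cancel]
  have hx : lastAt w (height w (b + 6 + 3 * A₁.size + 3 * A₂.size + 3 * B₁.size + 3 * B₂.size))
      (b + 2 + 3 * A₁.size + 3 * A₂.size) = b := by
    refine lastAt_eq (by omega) (by omega) fun j h1 h2 => ?_
    have := f2 j
    have := f4 j
    omega
  have hs : lastAt w (height w (b + 2 + 3 * A₁.size + 3 * A₂.size + 1 + 1))
      (b + 2 + 3 * A₁.size + 3 * A₂.size) = b + 1 + 3 * A₁.size := by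
    refine lastAt_eq (by omega) (by omega) fun j h1 h2 => ?_
    have := f4 j
    omega
  rw [hx, hs, if_pos (by omega), sl, parse_word]

theorem leftFlips_of_type_two {w v : List Step} {b : ℕ} {A₁ A₂ A₃ B : Decomp}
    (h : w.drop b = .up :: (A₁.word ++ .up :: (A₂.word ++ .up :: (A₃.word ++ .up :: .down ::
      (B.word ++ .down :: v))))) :
    leftFlips w (b + 3 + 3 * A₁.size + 3 * A₂.size + 3 * A₃.size + 1) =
      [⟨.M3, 0, ((parse w).pointAt (b + 2 + 3 * A₁.size + 3 * A₂.size),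
          (parse w).pointAt (b + 3 + 3 * A₁.size + 3 * A₂.size + 3 * A₃.size) + 1),
        ((parse w).pointAt (b + 1 + 3 * A₁.size),
          (parse w).pointAt (b + 2 + 3 * A₁.size + 3 * A₂.size))⟩] ++
      shiftLeft .S2 1 ((parse w).pointAt (b + 1 + 3 * A₁.size)) A₂ ++
      [⟨.M4, 0, ((parse w).pointAt (b + 1 + 3 * A₁.size),
          (parse w).pointAt (b + 2 + 3 * A₁.size + 3 * A₂.size)),
        ((parse w).pointAt (b + 1 + 3 * A₁.size),
          (parse w).pointAt (b + 3 + 3 * A₁.size + 3 * A₂.size + 3 * A₃.size))⟩] := by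
  have x0 : b + 1 + 3 * A₁.size + 1 + 3 * A₂.size = b + 2 + 3 * A₁.size + 3 * A₂.size := by omega
  have x1 : b + 2 + 3 * A₁.size + 3 * A₂.size + 1 + 3 * A₃.size =
    b + 3 + 3 * A₁.size + 3 * A₂.size + 3 * A₃.size := by omega
  obtain ⟨s1, d1, -⟩ := height_of_drop_cons h
  obtain ⟨f2, e2, d2, -⟩ := height_of_drop_word d1
  obtain ⟨s3, d3, -⟩ := height_of_drop_cons d2
  obtain ⟨f4, e4, d4, sl⟩ := height_of_drop_word d3
  rw [x0] at e4 d4 sl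
  obtain ⟨s5, d5, -⟩ := height_of_drop_cons d4
  obtain ⟨f6, e6, d6, -⟩ := height_of_drop_word d5
  rw [x1] at e6 d6
  obtain ⟨s7, d7, -⟩ := height_of_drop_cons d6
  obtain ⟨s8, d8, -⟩ := height_of_drop_cons d7
  obtain ⟨f9, e9, d9, -⟩ := height_of_drop_word d8
  obtain ⟨s10, -, l10⟩ := height_of_drop_cons d9
  simp only [Step.val] at s1 s3 s5 s7 s8 s10
  -- `B` stays at least at the height of `y`, and the down-step after it drops by two at once.
  have hy : (List.range (w.length + 1)).findIdx (fun j =>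
      decide (b + 3 + 3 * A₁.size + 3 * A₂.size + 3 * A₃.size + 1 + 1 < j ∧
        (height w j = height w (b + 3 + 3 * A₁.size + 3 * A₂.size + 3 * A₃.size + 1 + 1) - 1 ∨
        height w j = height w (b + 3 + 3 * A₁.size + 3 * A₂.size + 3 * A₃.size + 1 + 1) - 2))) =
      b + 3 + 3 * A₁.size + 3 * A₂.size + 3 * A₃.size + 1 + 1 + 3 * B.size + 1 := by
    refine findIdx_range (by omega) (decide_eq_true ⟨by omega, by omega⟩)
      fun j hj => decide_eq_false ?_
    rintro ⟨h1, h2⟩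
    have := f9 j
    omega
  unfold leftFlips
  simp only [hy, Nat.add_sub_cancel]
  have hs : lastAt w (height w (b + 3 + 3 * A₁.size + 3 * A₂.size + 3 * A₃.size + 1 + 1))
      (b + 3 + 3 * A₁.size + 3 * A₂.size + 3 * A₃.size) =
      b + 2 + 3 * A₁.size + 3 * A₂.size := by
    refine lastAt_eq (by omega) (by omega) fun j h1 h2 => ?_
    have := f6 j
    omega
  have hr : lastAt w (height w (b + 3 + 3 * A₁.size + 3 * A₂.size + 3 * A₃.size + 1 + 1 +
      3 * B.size + 1) + 1) (b + 3 + 3 * A₁.size + 3 * A₂.size + 3 * A₃.size) =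
      b + 1 + 3 * A₁.size := by
    refine lastAt_eq (by omega) (by omega) fun j h1 h2 => ?_
    have := f4 j
    have := f6 j
    omega
  rw [hr, hs, if_neg (by omega), sl, parse_word]

/-! ### Contexts, and the positions of `↗↘` -/

/-- A decomposition with a hole. -/
inductive Ctx
  | hole
  | inA (c : Ctx) (B C : Decomp)
  | inB (A : Decomp) (c : Ctx) (C : Decomp)
  | inC (A B : Decomp) (c : Ctx)

namespace Ctx

/-- Put a decomposition into the hole. -/
def fill : Ctx → Decomp → Decomp
  | hole, S => S
  | inA c B C, S => .node (c.fill S) B C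
  | inB A c C, S => .node A (c.fill S) C
  | inC A B c, S => .node A B (c.fill S)

/-- The part of the word before the hole. -/
def pre : Ctx → List Step
  | hole => []
  | inA c _ _ => .up :: c.pre
  | inB A c _ => .up :: (A.word ++ .up :: c.pre)
  | inC A B c => .up :: (A.word ++ .up :: (B.word ++ .down :: c.pre))

/-- The part of the word after the hole. -/
def post : Ctx → List Step
  | hole => []
  | inA c B C => c.post ++ .up :: (B.word ++ .down :: C.word)
  | inB _ c C => c.post ++ .down :: C.word
  | inC _ _ c => c.post

/-- The point at which the hole starts. -/
def start : Ctx → ℕ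
  | hole => 0
  | inA c _ _ => c.start
  | inB A c _ => A.size + 1 + c.start
  | inC A B c => A.size + B.size + 1 + c.start

/-- The number of edges outside the hole. -/
def extra : Ctx → ℕ
  | hole => 0
  | inA c B C => c.extra + B.size + C.size + 1
  | inB A c C => A.size + c.extra + C.size + 1
  | inC A B c => A.size + B.size + c.extra + 1

theorem size_fill (c : Ctx) (S : Decomp) : (c.fill S).size = c.extra + S.size := by
  induction c with
  | hole => simp [fill, extra]
  | inA c B C ih => simp only [fill, extra, Decomp.size, ih]; omega
  | inB A c C ih => simp only [fill, extra, Decomp.size, ih]; omega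
  | inC A B c ih => simp only [fill, extra, Decomp.size, ih]; omega

theorem start_le (c : Ctx) : c.start ≤ c.extra := by
  induction c with
  | hole => exact le_rfl
  | inA c B C ih => simp only [start, extra]; omega
  | inB A c C ih => simp only [start, extra]; omega
  | inC A B c ih => simp only [start, extra]; omega

theorem word_fill (c : Ctx) (S : Decomp) : (c.fill S).word = c.pre ++ (S.word ++ c.post) := by
  induction c with
  | hole => simp [fill, pre, post]
  | inA c B C ih => simp [fill, pre, post, Decomp.word, ih]
  | inB A c C ih => simp [fill, pre, post, Decomp.word, ih]
  | inC A B c ih => simp [fill, pre, post, Decomp.word, ih]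

theorem length_pre_le (c : Ctx) (S : Decomp) :
    c.pre.length + 3 * S.size ≤ 3 * (c.fill S).size := by
  have := congrArg List.length (c.word_fill S)
  simp only [List.length_append, Decomp.length_word] at this
  omega

theorem pointAt_fill (c : Ctx) (S : Decomp) {k : ℕ} (hk : k ≤ 3 * S.size) :
    (c.fill S).pointAt (c.pre.length + k) = c.start + S.pointAt k := by
  induction c with
  | hole => simp [fill, pre, start]
  | inA c B C ih =>
    have := c.length_pre_le S
    simp only [fill, pre, start, Decomp.pointAt, List.length_cons]
    rw [if_neg (by omega), if_pos (by omega), ← ih]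
    congr 1; omega
  | inB A c C ih =>
    have := c.length_pre_le S
    simp only [fill, pre, start, Decomp.pointAt, List.length_cons, List.length_append,
      Decomp.length_word]
    rw [if_neg (by omega), if_neg (by omega), if_pos (by omega), add_assoc (A.size + 1), ← ih]
    congr 2; omega
  | inC A B c ih =>
    simp only [fill, pre, start, Decomp.pointAt, List.length_cons, List.length_append,
      Decomp.length_word]
    rw [if_neg (by omega), if_neg (by omega), if_neg (by omega), add_assoc (A.size + B.size + 1),
      ← ih]
    congr 2; omega

/-- The outer edges depend on the content of the hole only through its size. An adjacent move
preserves the size, so one `K` serves both trees. -/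
theorem exists_edges_fill (c : Ctx) (m o : ℕ) (hm : 0 < m) : ∃ K : Finset Edge,
    (∀ X ∈ K, X.1 < X.2 ∧ (X.1 < o + c.start ∨ o + c.start + m < X.2)) ∧
    ∀ S : Decomp, S.size = m → (c.fill S).edges o = K ∪ S.edges (o + c.start) := by
  induction c generalizing o with
  | hole => exact ⟨∅, by simp, fun S _ => by simp [fill, start]⟩
  | inA c B C ih =>
    obtain ⟨K, h1, h2⟩ := ih o
    refine ⟨insert (o, o + (c.extra + m) + B.size + 1) (K ∪ (B.edges (o + (c.extra + m) + 1) ∪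
      C.edges (o + (c.extra + m) + B.size + 1))), fun X hX => ?_, fun S hS => ?_⟩
    · have := c.start_le
      simp only [Finset.mem_insert, Finset.mem_union] at hX
      simp only [start]
      rcases hX with rfl | hX | hX | hX
      · dsimp only; omega
      · exact h1 X hX
      all_goals have := Decomp.edges_bounds hX; omega
    · simp only [fill, Decomp.edges, h2 S hS, size_fill, hS, start]
      ext X; simp only [Finset.mem_insert, Finset.mem_union]; tauto
  | inB A c C ih =>
    obtain ⟨K, h1, h2⟩ := ih (o + A.size + 1)
    refine ⟨insert (o, o + A.size + (c.extra + m) + 1) (K ∪ (A.edges o ∪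
      C.edges (o + A.size + (c.extra + m) + 1))), fun X hX => ?_, fun S hS => ?_⟩
    · have := c.start_le
      simp only [Finset.mem_insert, Finset.mem_union] at hX
      simp only [start]
      rcases hX with rfl | hX | hX | hX
      · dsimp only; omega
      · have := h1 X hX; omega
      all_goals have := Decomp.edges_bounds hX; omega
    · simp only [fill, Decomp.edges, h2 S hS, size_fill, hS, start, ← add_assoc]
      ext X; simp only [Finset.mem_insert, Finset.mem_union]; tauto
  | inC A B c ih =>
    obtain ⟨K, h1, h2⟩ := ih (o + A.size + B.size + 1)
    refine ⟨insert (o, o + A.size + B.size + 1) (K ∪ (A.edges o ∪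
      B.edges (o + A.size + 1))), fun X hX => ?_, fun S hS => ?_⟩
    · simp only [Finset.mem_insert, Finset.mem_union] at hX
      simp only [start]
      rcases hX with rfl | hX | hX | hX
      · dsimp only; omega
      · have := h1 X hX; omega
      all_goals have := Decomp.edges_bounds hX; omega
    · simp only [fill, Decomp.edges, h2 S hS, start, ← add_assoc]
      ext X; simp only [Finset.mem_insert, Finset.mem_union]; tauto

end Ctx

namespace Decomp

theorem getElem?_word_node_left (A B C : Decomp) {i : ℕ} (hi : i < 3 * A.size) :
    (node A B C).word[i + 1]? = A.word[i]? := by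
  rw [word, List.getElem?_cons_succ, List.getElem?_append_left (by rw [A.length_word]; omega)]

theorem getElem?_word_node_up (A B C : Decomp) :
    (node A B C).word[3 * A.size + 1]? = some .up := by
  rw [word, List.getElem?_cons_succ, List.getElem?_append_right (by rw [A.length_word])]
  simp [A.length_word]

theorem getElem?_word_node_mid (A B C : Decomp) {i : ℕ} (hi : i < 3 * B.size) :
    (node A B C).word[3 * A.size + 1 + i + 1]? = B.word[i]? := by
  rw [word, List.getElem?_cons_succ, List.getElem?_append_right (by rw [A.length_word]; omega),
    A.length_word, show 3 * A.size + 1 + i - 3 * A.size = i + 1 by omega,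
    List.getElem?_cons_succ, List.getElem?_append_left (by rw [B.length_word]; omega)]

theorem getElem?_word_node_down (A B C : Decomp) :
    (node A B C).word[3 * A.size + 3 * B.size + 2]? = some .down := by
  rw [word, show 3 * A.size + 3 * B.size + 2 = 3 * A.size + (3 * B.size + 1) + 1 by omega,
    List.getElem?_cons_succ, List.getElem?_append_right (by rw [A.length_word]; omega),
    A.length_word, Nat.add_sub_cancel_left, List.getElem?_cons_succ,
    List.getElem?_append_right (by rw [B.length_word])]
  simp [B.length_word]

theorem getElem?_word_node_right (A B C : Decomp) (i : ℕ) :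
    (node A B C).word[3 * A.size + 3 * B.size + 3 + i]? = C.word[i]? := by
  rw [word, show 3 * A.size + 3 * B.size + 3 + i = 3 * A.size + (3 * B.size + (i + 1) + 1) + 1 by
    omega, List.getElem?_cons_succ, List.getElem?_append_right (by rw [A.length_word]; omega),
    A.length_word, Nat.add_sub_cancel_left, List.getElem?_cons_succ,
    List.getElem?_append_right (by rw [B.length_word]; omega), B.length_word,
    Nat.add_sub_cancel_left, List.getElem?_cons_succ]

theorem getElem?_word_zero {D : Decomp} (h : 0 < D.size) : D.word[0]? = some .up := by
  cases D with
  | nil => simp [size] at h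
  | node A B C => simp [word]

theorem getElem?_word_last {D : Decomp} {i : ℕ} (h : i + 1 = 3 * D.size) :
    D.word[i]? = some .down := by
  induction D generalizing i with
  | nil => simp [size] at h
  | node A B C _ _ ih =>
    simp only [size] at h
    by_cases hC : C.size = 0
    · rw [show i = 3 * A.size + 3 * B.size + 2 by omega]
      exact getElem?_word_node_down A B C
    · obtain ⟨j, rfl⟩ := Nat.exists_eq_add_of_le
        (show 3 * A.size + 3 * B.size + 3 ≤ i by omega)
      rw [getElem?_word_node_right]
      exact ih (by omega)

theorem eq_nil_of_size {D : Decomp} (h : D.size = 0) : D = nil := by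
  cases D with
  | nil => rfl
  | node A B C => simp [size] at h

/-- The steps `↗↘` in the word of a decomposition: the down-step belongs to a pivot edge whose
part `B` is empty, and which is either outermost, or in the part `A` or `B` of another one. -/
theorem peak_cases {D : Decomp} {k : ℕ} (hu : D.word[k]? = some .up)
    (hd : D.word[k + 1]? = some .down) :
    (∃ L A R : Decomp, D = L.concat (.node A .nil R) ∧ k = 3 * L.size + 1 + 3 * A.size) ∨
    (∃ (c : Ctx) (A₁ A₂ B₁ B₂ C : Decomp),
      D = c.fill (.node (A₁.concat (.node A₂ .nil B₁)) B₂ C) ∧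
      k = c.pre.length + 2 + 3 * A₁.size + 3 * A₂.size) ∨
    (∃ (c : Ctx) (A₁ A₂ A₃ B C : Decomp),
      D = c.fill (.node A₁ (A₂.concat (.node A₃ .nil B)) C) ∧
      k = c.pre.length + 3 + 3 * A₁.size + 3 * A₂.size + 3 * A₃.size) := by
  induction D generalizing k with
  | nil => simp [word] at hu
  | node A B C hA hB hC =>
    rcases Nat.eq_zero_or_pos k with rfl | hk
    · by_cases h0 : A.size = 0
      · have := getElem?_word_node_up A B C
        rw [h0] at this
        rw [hd] at this
        cases this
      · rw [getElem?_word_node_left A B C (by omega), getElem?_word_zero (by omega)] at hd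
        cases hd
    by_cases c1 : k < 3 * A.size
    · obtain ⟨i, rfl⟩ := Nat.exists_eq_add_of_le' hk
      rw [getElem?_word_node_left A B C (by omega)] at hu hd
      rcases hA hu hd with ⟨L, A', R, rfl, h⟩ | ⟨c, A₁, A₂, B₁, B₂, C', rfl, h⟩ |
        ⟨c, A₁, A₂, A₃, B', C', rfl, h⟩
      -- A peak that is outermost in the part `A` becomes type 1, with the present pivot edge as
      -- `a`.
      · exact .inr (.inl ⟨.hole, L, A', R, B, C, rfl, by simp [Ctx.pre]; omega⟩)
      · exact .inr (.inl ⟨.inA c B C, A₁, A₂, B₁, B₂, C', rfl, by simp [Ctx.pre]; omega⟩)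
      · exact .inr (.inr ⟨.inA c B C, A₁, A₂, A₃, B', C', rfl, by simp [Ctx.pre]; omega⟩)
    by_cases c2 : k = 3 * A.size
    · rw [c2, getElem?_word_node_up] at hd
      cases hd
    by_cases c3 : k = 3 * A.size + 1
    · by_cases h0 : B.size = 0
      · rw [eq_nil_of_size h0]
        exact .inl ⟨.nil, A, C, rfl, by simp [size]; omega⟩
      · have := getElem?_word_node_mid A B C (i := 0) (by omega)
        rw [getElem?_word_zero (by omega)] at this
        rw [c3] at hd
        rw [add_zero, hd] at this
        cases this
    by_cases c4 : k < 3 * A.size + 1 + 3 * B.size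
    · obtain ⟨i, rfl⟩ := Nat.exists_eq_add_of_le (show 3 * A.size + 2 ≤ k by omega)
      rw [show 3 * A.size + 2 + i = 3 * A.size + 1 + i + 1 by omega,
        getElem?_word_node_mid A B C (by omega)] at hu
      rw [show 3 * A.size + 2 + i + 1 = 3 * A.size + 1 + (i + 1) + 1 by omega,
        getElem?_word_node_mid A B C (by omega)] at hd
      rcases hB hu hd with ⟨L, A', R, rfl, h⟩ | ⟨c, A₁, A₂, B₁, B₂, C', rfl, h⟩ |
        ⟨c, A₁, A₂, A₃, B', C', rfl, h⟩
      -- A peak that is outermost in the part `B` becomes type 2, with the present pivot edge as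
      -- `a`.
      · exact .inr (.inr ⟨.hole, A, L, A', R, C, rfl, by simp [Ctx.pre]; omega⟩)
      · exact .inr (.inl ⟨.inB A c C, A₁, A₂, B₁, B₂, C', rfl, by
          simp [Ctx.pre, length_word]; omega⟩)
      · exact .inr (.inr ⟨.inB A c C, A₁, A₂, A₃, B', C', rfl, by
          simp [Ctx.pre, length_word]; omega⟩)
    by_cases c5 : k = 3 * A.size + 1 + 3 * B.size
    · exfalso
      have hb : 0 < B.size := by omega
      rw [c5, show 3 * A.size + 1 + 3 * B.size = 3 * A.size + 1 + (3 * B.size - 1) + 1 by omega,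
        getElem?_word_node_mid A B C (by omega), getElem?_word_last (by omega)] at hu
      cases hu
    by_cases c6 : k = 3 * A.size + 3 * B.size + 2
    · rw [c6, getElem?_word_node_down] at hu
      cases hu
    · obtain ⟨i, rfl⟩ := Nat.exists_eq_add_of_le
        (show 3 * A.size + 3 * B.size + 3 ≤ k by omega)
      rw [getElem?_word_node_right] at hu
      rw [add_assoc _ i 1, getElem?_word_node_right] at hd
      rcases hC hu hd with ⟨L, A', R, rfl, h⟩ | ⟨c, A₁, A₂, B₁, B₂, C', rfl, h⟩ |
        ⟨c, A₁, A₂, A₃, B', C', rfl, h⟩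
      · exact .inl ⟨.node A B L, A', R, rfl, by simp only [size]; omega⟩
      · exact .inr (.inl ⟨.inC A B c, A₁, A₂, B₁, B₂, C', rfl, by
          simp [Ctx.pre, length_word]; omega⟩)
      · exact .inr (.inr ⟨.inC A B c, A₁, A₂, A₃, B', C', rfl, by
          simp [Ctx.pre, length_word]; omega⟩)

end Decomp


/-! ### Adjacent moves as configurations -/

namespace Decomp

theorem pointAt_zero (D : Decomp) : D.pointAt 0 = 0 := by
  cases D <;> simp [pointAt]

theorem pointAt_concat (L T : Decomp) (k : ℕ) :
    (L.concat T).pointAt (3 * L.size + k) = L.size + T.pointAt k := by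
  induction L with
  | nil => simp [concat, size]
  | node A B C _ _ ih =>
    simp only [concat, size, pointAt]
    rw [if_neg (by omega), if_neg (by omega), if_neg (by omega),
      show 3 * (A.size + B.size + C.size + 1) + k - (3 + 3 * A.size + 3 * B.size) =
        3 * C.size + k by omega, ih]
    omega

theorem pointAt_end (D : Decomp) : D.pointAt (3 * D.size) = D.size := by
  have := pointAt_concat D nil 0
  simpa [concat_nil, pointAt] using this

theorem pointAt_node_left {A B C : Decomp} {k : ℕ} (hk : k ≤ 3 * A.size) :
    (node A B C).pointAt (1 + k) = A.pointAt k := by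
  rw [pointAt, if_neg (by omega), if_pos (by omega), Nat.add_sub_cancel_left]

theorem pointAt_node_mid {A B C : Decomp} {k : ℕ} (hk : k ≤ 3 * B.size) :
    (node A B C).pointAt (2 + 3 * A.size + k) = A.size + 1 + B.pointAt k := by
  rw [pointAt, if_neg (by omega), if_neg (by omega), if_pos (by omega), Nat.add_sub_cancel_left]

theorem pointAt_node_right {A B C : Decomp} {k : ℕ} :
    (node A B C).pointAt (3 + 3 * A.size + 3 * B.size + k) =
      A.size + B.size + 1 + C.pointAt k := by
  rw [pointAt, if_neg (by omega), if_neg (by omega), if_neg (by omega), Nat.add_sub_cancel_left]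

end Decomp

theorem swap_eq {P Q P' Q' : List Step} (h : P ++ .up :: .down :: Q = P' ++ .up :: .down :: Q')
    (hl : P.length = P'.length) :
    P ++ .down :: .up :: Q = P' ++ .down :: .up :: Q' := by
  obtain ⟨rfl, h2⟩ := List.append_inj h hl
  simp only [List.cons.injEq, true_and] at h2
  rw [h2]

theorem exists_config_of_type_one {w v : List Step} {P Q : List Step} (c : Ctx)
    (A₁ A₂ B₁ B₂ C : Decomp)
    (hw : w = (c.fill (.node (A₁.concat (.node A₂ .nil B₁)) B₂ C)).word)
    (hI : w = P ++ .up :: .down :: Q) (hF : v = P ++ .down :: .up :: Q)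
    (hP : P.length = c.pre.length + 2 + 3 * A₁.size + 3 * A₂.size) :
    ∃ g : Config, g.Valid ∧ g.source = treeOf w ∧ g.target = treeOf v ∧
      g.flips = leftFlips w (P.length + 1) := by
  have hw' : w = c.pre ++ (.up :: (A₁.word ++ .up :: (A₂.word ++ .up :: .down :: (B₁.word ++
      .up :: (B₂.word ++ .down :: (C.word ++ c.post)))))) := by
    rw [hw, Ctx.word_fill]
    simp [Decomp.word, Decomp.word_concat]
  -- Reparsing the swapped word: the second child of the first segment is now `A₂`, and what
  -- followed the peak becomes a segment of its own. The context is unchanged.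
  have hv : v = (c.fill (.node A₁ A₂ (.node B₁ B₂ C))).word := by
    rw [hF, swap_eq (P' := c.pre ++ .up :: (A₁.word ++ .up :: A₂.word))
      (Q' := B₁.word ++ .up :: (B₂.word ++ .down :: (C.word ++ c.post))) ?_ ?_, Ctx.word_fill]
    · simp [Decomp.word]
    · rw [← hI, hw']; simp
    · simp [hP, Decomp.length_word]; omega
  have hparse : parse w = c.fill (.node (A₁.concat (.node A₂ .nil B₁)) B₂ C) := by
    rw [hw, parse_word]
  have hs : (Decomp.node (A₁.concat (.node A₂ .nil B₁)) B₂ C).size =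
      A₁.size + A₂.size + B₁.size + B₂.size + C.size + 2 := by
    simp only [Decomp.size, Decomp.size_concat]; omega
  have hs' : (Decomp.node A₁ A₂ (.node B₁ B₂ C)).size =
      A₁.size + A₂.size + B₁.size + B₂.size + C.size + 2 := by
    simp only [Decomp.size]; omega
  obtain ⟨K, hK, hE⟩ := c.exists_edges_fill
    (A₁.size + A₂.size + B₁.size + B₂.size + C.size + 2) 0 (by omega)
  have e1 := hE _ hs
  have e2 := hE _ hs'
  simp only [zero_add] at hK e1 e2
  have ht : c.start + A₁.size + A₂.size + 1 + B₁.size + B₂.size + 1 =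
    c.start + A₁.size + A₂.size + B₁.size + 1 + B₂.size + 1 := by omega
  refine ⟨.one (K ∪ (A₁.edges c.start ∪ (B₁.edges (c.start + A₁.size + A₂.size + 1) ∪
    (B₂.edges (c.start + A₁.size + A₂.size + B₁.size + 1 + 1) ∪
      C.edges (c.start + A₁.size + A₂.size + B₁.size + 1 + B₂.size + 1)))))
    c.start (c.start + A₁.size) (c.start + A₁.size + A₂.size + B₁.size + 1 + B₂.size + 1) A₂,
    ⟨by omega, by omega, fun X hX => ?_, fun x h1 h2 => ?_⟩, ?_, ?_, ?_⟩
  · simp only [Finset.mem_union] at hX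
    rcases hX with hX | hX | hX | hX | hX
    · have := hK X hX; omega
    all_goals have := Decomp.edges_bounds hX; omega
  · obtain ⟨X, hX, hXc⟩ := (Decomp.covers_edges (D := A₁) (o := c.start)).2 ⟨h1, h2⟩
    have := Decomp.edges_bounds hX
    exact ⟨X, by simp [hX], by omega, by omega, hXc⟩
  · rw [treeOf, hparse, e1]
    simp only [Config.source, Decomp.edges, Decomp.edges_concat, Decomp.size_concat, Decomp.size,
      add_zero, ← add_assoc]
    ext X
    simp only [Finset.mem_insert, Finset.mem_union, Finset.notMem_empty]
    tauto
  · rw [treeOf, hv, parse_word, e2]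
    simp only [Config.target, Decomp.edges, ht]
    rw [show c.start + A₁.size + A₂.size + 1 + B₁.size + 1 =
      c.start + A₁.size + A₂.size + B₁.size + 1 + 1 by omega]
    ext X
    simp only [Finset.mem_insert, Finset.mem_union]
    tauto
  · have hdrop := leftFlips_of_type_one (w := w) (b := c.pre.length) (A₁ := A₁) (A₂ := A₂)
      (B₁ := B₁) (B₂ := B₂) (v := C.word ++ c.post) (by rw [hw', List.drop_left])
    have p0 : (parse w).pointAt c.pre.length = c.start := by
      have := c.pointAt_fill (Decomp.node (A₁.concat (.node A₂ .nil B₁)) B₂ C) (k := 0) (by omega)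
      rwa [add_zero, Decomp.pointAt_zero, add_zero, ← hparse] at this
    have p1 : (parse w).pointAt (c.pre.length + 1 + 3 * A₁.size) = c.start + A₁.size := by
      have := c.pointAt_fill (Decomp.node (A₁.concat (.node A₂ .nil B₁)) B₂ C)
        (k := 1 + (3 * A₁.size + 0)) (by omega)
      rw [Decomp.pointAt_node_left (by simp only [Decomp.size_concat]; omega),
        Decomp.pointAt_concat, Decomp.pointAt_zero, add_zero, add_zero, ← hparse, ← add_assoc] at this
      exact this
    have p2 : (parse w).pointAt (c.pre.length + 2 + 3 * A₁.size + 3 * A₂.size) =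
        c.start + A₁.size + A₂.size := by
      have := c.pointAt_fill (Decomp.node (A₁.concat (.node A₂ .nil B₁)) B₂ C)
        (k := 1 + (3 * A₁.size + (1 + 3 * A₂.size))) (by omega)
      rw [Decomp.pointAt_node_left (by simp only [Decomp.size_concat, Decomp.size]; omega),
        Decomp.pointAt_concat, Decomp.pointAt_node_left le_rfl, Decomp.pointAt_end, ← hparse,
        ← add_assoc c.start] at this
      rw [← this]; congr 1; omega
    have p3 : (parse w).pointAt
        (c.pre.length + 6 + 3 * A₁.size + 3 * A₂.size + 3 * B₁.size + 3 * B₂.size) =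
        c.start + A₁.size + A₂.size + B₁.size + 1 + B₂.size + 1 := by
      have := c.pointAt_fill (Decomp.node (A₁.concat (.node A₂ .nil B₁)) B₂ C)
        (k := 3 + 3 * (A₁.concat (.node A₂ .nil B₁)).size + 3 * B₂.size + 0)
        (by simp only [Decomp.size_concat, Decomp.size] at *; omega)
      rw [Decomp.pointAt_node_right, Decomp.pointAt_zero, ← hparse] at this
      simp only [Decomp.size_concat, Decomp.size] at this
      rw [show c.pre.length + 6 + 3 * A₁.size + 3 * A₂.size + 3 * B₁.size + 3 * B₂.size =
        c.pre.length + (3 + 3 * (A₁.size + (A₂.size + 0 + B₁.size + 1)) + 3 * B₂.size + 0) by omega,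
        this]
      omega
    rw [p0, p1, p2, p3] at hdrop
    rw [hP, hdrop, Config.flips]

theorem exists_config_of_type_two {w v : List Step} {P Q : List Step} (c : Ctx)
    (A₁ A₂ A₃ B C : Decomp)
    (hw : w = (c.fill (.node A₁ (A₂.concat (.node A₃ .nil B)) C)).word)
    (hI : w = P ++ .up :: .down :: Q) (hF : v = P ++ .down :: .up :: Q)
    (hP : P.length = c.pre.length + 3 + 3 * A₁.size + 3 * A₂.size + 3 * A₃.size) :
    ∃ g : Config, g.Valid ∧ g.source = treeOf w ∧ g.target = treeOf v ∧
      g.flips = leftFlips w (P.length + 1) := by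
  have hw' : w = c.pre ++ (.up :: (A₁.word ++ .up :: (A₂.word ++ .up :: (A₃.word ++
      .up :: .down :: (B.word ++ .down :: (C.word ++ c.post)))))) := by
    rw [hw, Ctx.word_fill]
    simp [Decomp.word, Decomp.word_concat]
  -- After the swap, `A₂` and `A₃` form a segment that joins the first part, and `B` alone remains
  -- as the second part.
  have hv : v = (c.fill (.node (A₁.concat (.node A₂ A₃ .nil)) B C)).word := by
    rw [hF, swap_eq (P' := c.pre ++ .up :: (A₁.word ++ .up :: (A₂.word ++ .up :: A₃.word)))
      (Q' := B.word ++ .down :: (C.word ++ c.post)) ?_ ?_, Ctx.word_fill]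
    · simp [Decomp.word, Decomp.word_concat]
    · rw [← hI, hw']; simp
    · simp [hP, Decomp.length_word]; omega
  have hparse : parse w = c.fill (.node A₁ (A₂.concat (.node A₃ .nil B)) C) := by
    rw [hw, parse_word]
  have hs : (Decomp.node A₁ (A₂.concat (.node A₃ .nil B)) C).size =
      A₁.size + A₂.size + A₃.size + B.size + C.size + 2 := by
    simp only [Decomp.size, Decomp.size_concat]; omega
  have hs' : (Decomp.node (A₁.concat (.node A₂ A₃ .nil)) B C).size =
      A₁.size + A₂.size + A₃.size + B.size + C.size + 2 := by
    simp only [Decomp.size, Decomp.size_concat]; omega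
  obtain ⟨K, hK, hE⟩ := c.exists_edges_fill
    (A₁.size + A₂.size + A₃.size + B.size + C.size + 2) 0 (by omega)
  have e1 := hE _ hs
  have e2 := hE _ hs'
  simp only [zero_add] at hK e1 e2
  have ht : c.start + A₁.size + A₂.size + A₃.size + B.size + 1 + 1 =
    c.start + A₁.size + 1 + A₂.size + A₃.size + 1 + B.size := by omega
  have ht' : c.start + A₁.size + A₂.size + A₃.size + 1 + B.size + 1 =
    c.start + A₁.size + 1 + A₂.size + A₃.size + 1 + B.size := by omega
  refine ⟨.two (K ∪ (A₁.edges c.start ∪ (A₃.edges (c.start + A₁.size + 1 + A₂.size) ∪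
    (B.edges (c.start + A₁.size + 1 + A₂.size + A₃.size + 1) ∪
      C.edges (c.start + A₁.size + 1 + A₂.size + A₃.size + 1 + B.size)))))
    c.start (c.start + A₁.size) (c.start + A₁.size + 1 + A₂.size + A₃.size)
    (c.start + A₁.size + 1 + A₂.size + A₃.size + 1 + B.size) A₂,
    ⟨by omega, by omega, by omega, fun X hX => ?_, fun x h1 h2 h3 h4 => ?_⟩, ?_, ?_, ?_⟩
  · simp only [Finset.mem_union] at hX
    rcases hX with hX | hX | hX | hX | hX
    · have := hK X hX; omega
    all_goals have := Decomp.edges_bounds hX; omega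
  · rcases h4 with h4 | h4
    · obtain ⟨X, hX, hXc⟩ := (Decomp.covers_edges (D := A₁) (o := c.start)).2 ⟨h1, h4⟩
      have := Decomp.edges_bounds hX
      exact ⟨X, by simp [hX], by omega, by omega, hXc⟩
    · rcases lt_or_gt_of_ne h3 with h5 | h5
      · obtain ⟨X, hX, hXc⟩ := (Decomp.covers_edges (D := A₃)).2 ⟨h4, h5⟩
        have := Decomp.edges_bounds hX
        exact ⟨X, by simp [hX], by omega, by omega, hXc⟩
      · obtain ⟨X, hX, hXc⟩ := (Decomp.covers_edges (D := B)).2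
          ⟨show c.start + A₁.size + 1 + A₂.size + A₃.size + 1 ≤ x by omega, h2⟩
        have := Decomp.edges_bounds hX
        exact ⟨X, by simp [hX], by omega, by omega, hXc⟩
  · rw [treeOf, hparse, e1]
    simp only [Config.source, Decomp.edges, Decomp.edges_concat, Decomp.size_concat, Decomp.size,
      add_zero, ← add_assoc, ht]
    ext X
    simp only [Finset.mem_insert, Finset.mem_union, Finset.notMem_empty]
    tauto
  · rw [treeOf, hv, parse_word, e2]
    simp only [Config.target, Decomp.edges, Decomp.edges_concat, Decomp.size_concat, Decomp.size,
      add_zero, ← add_assoc, ht']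
    rw [show c.start + A₁.size + A₂.size + A₃.size + 1 =
      c.start + A₁.size + 1 + A₂.size + A₃.size by omega,
      show c.start + A₁.size + A₂.size + 1 = c.start + A₁.size + 1 + A₂.size by omega]
    ext X
    simp only [Finset.mem_insert, Finset.mem_union, Finset.notMem_empty]
    tauto
  · have hdrop := leftFlips_of_type_two (w := w) (b := c.pre.length) (A₁ := A₁) (A₂ := A₂)
      (A₃ := A₃) (B := B) (v := C.word ++ c.post) (by rw [hw', List.drop_left])
    have p1 : (parse w).pointAt (c.pre.length + 1 + 3 * A₁.size) = c.start + A₁.size := by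
      have := c.pointAt_fill (Decomp.node A₁ (A₂.concat (.node A₃ .nil B)) C)
        (k := 1 + 3 * A₁.size) (by omega)
      rwa [Decomp.pointAt_node_left le_rfl, Decomp.pointAt_end, ← hparse, ← add_assoc] at this
    have p2 : (parse w).pointAt (c.pre.length + 2 + 3 * A₁.size + 3 * A₂.size) =
        c.start + A₁.size + 1 + A₂.size := by
      have := c.pointAt_fill (Decomp.node A₁ (A₂.concat (.node A₃ .nil B)) C)
        (k := 2 + 3 * A₁.size + (3 * A₂.size + 0)) (by omega)
      rw [Decomp.pointAt_node_mid (by simp only [Decomp.size_concat]; omega),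
        Decomp.pointAt_concat, Decomp.pointAt_zero, ← hparse] at this
      rw [show c.pre.length + 2 + 3 * A₁.size + 3 * A₂.size =
        c.pre.length + (2 + 3 * A₁.size + (3 * A₂.size + 0)) by omega, this]
      omega
    have p3 : (parse w).pointAt (c.pre.length + 3 + 3 * A₁.size + 3 * A₂.size + 3 * A₃.size) =
        c.start + A₁.size + 1 + A₂.size + A₃.size := by
      have := c.pointAt_fill (Decomp.node A₁ (A₂.concat (.node A₃ .nil B)) C)
        (k := 2 + 3 * A₁.size + (3 * A₂.size + (1 + 3 * A₃.size))) (by omega)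
      rw [Decomp.pointAt_node_mid (by simp only [Decomp.size_concat, Decomp.size]; omega),
        Decomp.pointAt_concat, Decomp.pointAt_node_left le_rfl, Decomp.pointAt_end,
        ← hparse] at this
      rw [show c.pre.length + 3 + 3 * A₁.size + 3 * A₂.size + 3 * A₃.size =
        c.pre.length + (2 + 3 * A₁.size + (3 * A₂.size + (1 + 3 * A₃.size))) by omega, this]
      omega
    rw [p1, p2, p3] at hdrop
    rw [hP, hdrop, Config.flips]

/-- An adjacent move to the left is described by a configuration. -/
theorem exists_config {n : ℕ} {I F : DyckPath n} {P Q : List Step}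
    (hI : I.steps = P ++ .up :: .down :: Q) (hF : F.steps = P ++ .down :: .up :: Q) :
    ∃ c : Config, c.Valid ∧ c.source = treeOf I.steps ∧ c.target = treeOf F.steps ∧
      c.flips = leftFlips I.steps (P.length + 1) := by
  have hw := (word_parse I).symm
  have hu : (parse I.steps).word[P.length]? = some .up := by
    rw [← hw, hI, List.getElem?_append_right le_rfl]; simp
  have hd : (parse I.steps).word[P.length + 1]? = some .down := by
    rw [← hw, hI, List.getElem?_append_right (by omega)]; simp
  rcases Decomp.peak_cases hu hd with ⟨L, A, R, h, hk⟩ | ⟨c, A₁, A₂, B₁, B₂, C, h, hk⟩ |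
    ⟨c, A₁, A₂, A₃, B, C, h, hk⟩
  -- The up-step of an outermost peak starts at height one, so a down-step in its place would reach
  -- height `-1`.
  · exfalso
    rw [h] at hw
    have hF' : F.steps.drop 0 = L.word ++ .up :: (A.word ++ .down :: .up :: R.word) := by
      rw [List.drop_zero, hF, swap_eq (P' := L.word ++ .up :: A.word) (Q' := R.word) ?_ ?_]
      · simp
      · rw [← hI, hw]; simp [Decomp.word, Decomp.word_concat]
      · simp [Decomp.length_word, hk]; omega
    obtain ⟨-, e1, d1, -⟩ := height_of_drop_word hF'
    obtain ⟨e2, d2, -⟩ := height_of_drop_cons d1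
    obtain ⟨-, e3, d3, -⟩ := height_of_drop_word d2
    obtain ⟨e4, -, l4⟩ := height_of_drop_cons d3
    rw [F.length_eq] at l4
    have := F.height_nonneg (0 + 3 * L.size + 1 + 3 * A.size + 1) l4
    have h0 := height_zero F.steps
    simp only [Step.val] at e2 e4
    omega
  · rw [h] at hw
    exact exists_config_of_type_one c A₁ A₂ B₁ B₂ C hw hI hF hk
  · rw [h] at hw
    exact exists_config_of_type_two c A₁ A₂ A₃ B C hw hI hF hk

/-! ### Directions -/

theorem firstDiff_swap (P Q : List Step) {s t : Step} (h : s ≠ t) :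
    firstDiff (P ++ s :: t :: Q) (P ++ t :: s :: Q) = P.length := by
  induction P with
  | nil => simp [firstDiff, List.findIdx_cons, h]
  | cons a P ih =>
    simpa [firstDiff, List.findIdx_cons] using ih

theorem direction_swap (P Q : List Step) {s t : Step} (h : s ≠ t) :
    direction (P ++ s :: t :: Q) (P ++ t :: s :: Q) = if s = .up then .left else .right := by
  rw [direction, firstDiff_swap P Q h, List.getElem?_append_right le_rfl]
  simp

/-- Choose the first element for moves to the left, the second one for moves to the right. -/
def Direction.pick {α : Type*} : Direction → α → α → α
  | .left, a, _ => a
  | .right, _, b => b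

/-- For a move to the Right, `pick` exchanges the ends of each transition, so that sites always
refer to the path of the reverse move to the Left. -/
theorem exists_config_of_PAM_pos {n : ℕ} {I F : DyckPath n} (hne : I ≠ F) (hp : 0 < PAM I F) :
    ∃ c : Config, c.Valid ∧
      treeOf I.steps = (direction I.steps F.steps).pick c.source c.target ∧
      treeOf F.steps = (direction I.steps F.steps).pick c.target c.source ∧
      ∀ t ∈ canonicalPath I.steps F.steps, ∃ f : Flip,
        Site c ((direction I.steps F.steps).pick t.src t.tgt) f ∧
        (direction I.steps F.steps).pick t.tgt t.src =
          f.apply ((direction I.steps F.steps).pick t.src t.tgt) ∧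
        t.kind = f.kind ∧ t.depth = f.depth := by
  have hmem : F ∈ adjacentMoves I := by
    by_contra hm
    simp [PAM, hne, hm] at hp
  obtain ⟨-, P, Q, s, t, hI, hF⟩ := hmem
  have hst : s ≠ t := by
    rintro rfl
    apply hne
    cases I; cases F
    simp only [DyckPath.mk.injEq]
    exact hI.trans hF.symm
  have hdir := direction_swap P Q hst
  rw [← hI, ← hF] at hdir
  cases s with
  | up =>
    obtain rfl : t = .down := by cases t <;> simp at hst ⊢
    rw [if_pos rfl] at hdir
    obtain ⟨c, hv, h1, h2, h3⟩ := exists_config hI hF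
    refine ⟨c, hv, by rw [hdir, h1]; rfl, by rw [hdir, h2]; rfl, fun t ht => ?_⟩
    rw [canonicalPath, hdir] at ht
    dsimp only at ht
    rw [leftPath, show firstDiff I.steps F.steps = P.length by rw [hI, hF, firstDiff_swap P Q hst],
      ← h1, ← h3] at ht
    rw [hdir]
    exact (Config.source_trace hv).exists_of_mem ht
  | down =>
    obtain rfl : t = .up := by cases t <;> simp at hst ⊢
    rw [if_neg (by simp)] at hdir
    obtain ⟨c, hv, h1, h2, h3⟩ := exists_config hF hI
    refine ⟨c, hv, by rw [hdir, h2]; rfl, by rw [hdir, h1]; rfl, fun t ht => ?_⟩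
    rw [canonicalPath, hdir] at ht
    dsimp only at ht
    rw [leftPath, show firstDiff F.steps I.steps = P.length by
      rw [hI, hF, firstDiff_swap P Q hst.symm], ← h1, ← h3, List.mem_reverse, List.mem_map] at ht
    obtain ⟨t', ht', rfl⟩ := ht
    rw [hdir]
    exact (Config.source_trace hv).exists_of_mem ht'


/-! ### Encodings and the count -/

theorem IsNCST.nonCrossing {n : ℕ} {T : Finset Edge} (h : IsNCST n T) : NonCrossing T := h.2.1

theorem IsNCST.card_eq {n : ℕ} {T : Finset Edge} (h : IsNCST n T) : T.card = n := by
  classical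
  obtain ⟨hb, -, ht⟩ := h
  have hc := ht.card_edgeFinset
  rw [Fintype.card_fin, Nat.add_right_cancel_iff] at hc
  rw [← hc]
  refine Finset.card_bij (fun e he => s(⟨e.1, by have := hb e he; omega⟩,
    ⟨e.2, by have := hb e he; omega⟩)) (fun e he => ?_) (fun e he f hf hef => ?_) (fun s => ?_)
  · rw [SimpleGraph.mem_edgeFinset, SimpleGraph.mem_edgeSet, graphOf, SimpleGraph.fromRel_adj]
    refine ⟨fun h => ?_, .inl he⟩
    have := hb e he
    rw [Fin.mk.injEq] at h
    omega
  · have h1 := hb e he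
    have h2 := hb f hf
    rw [Sym2.eq_iff] at hef
    simp only [Fin.mk.injEq] at hef
    rcases hef with hef | hef
    · exact Prod.ext hef.1 hef.2
    · omega
  · induction s with
    | _ a b =>
      intro hs
      rw [SimpleGraph.mem_edgeFinset, SimpleGraph.mem_edgeSet, graphOf,
        SimpleGraph.fromRel_adj] at hs
      rcases hs.2 with h | h
      · exact ⟨_, h, rfl⟩
      · exact ⟨_, h, Sym2.eq_swap⟩

/-- Equal cardinalities force the added edge to be absent from `Z`. The removed and the added edge
are then the only differences between the two sets. -/
theorem flip_unique {Y Z : Finset Edge} {f f' : Flip} (hf : f.old ∈ Z)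
    (h : Y = f.apply Z) (h' : Y = f'.apply Z) (hne : Y ≠ Z) (hc : Y.card = Z.card) :
    f.old = f'.old ∧ f.new = f'.new := by
  have hon : f.old ≠ f.new := fun he => hne (by rw [h, Flip.apply, ← he, Finset.insert_erase hf])
  have hold : f.old ∉ Y := by
    rw [h, Flip.apply]
    simp [hon]
  have hnew : f.new ∉ Z := fun hm => by
    have : Y = Z.erase f.old := by
      rw [h, Flip.apply, Finset.insert_eq_of_mem (Finset.mem_erase.2 ⟨hon.symm, hm⟩)]
    rw [this] at hc
    exact (Finset.card_erase_lt_of_mem hf).ne hc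
  have h1 : f.old = f'.old := by
    by_contra he
    exact hold (h' ▸ Finset.mem_insert_of_mem (Finset.mem_erase.2 ⟨he, hf⟩))
  refine ⟨h1, ?_⟩
  have h2 : f.new ∈ f'.apply Z := by
    rw [← h', h]
    exact Finset.mem_insert_self _ _
  rcases Finset.mem_insert.1 h2 with h3 | h3
  · exact h3
  · exact absurd (Finset.mem_of_mem_erase h3) hnew

theorem old_eq_new_of_apply_eq {Z : Finset Edge} {f : Flip} (hf : f.old ∈ Z)
    (h : Z = f.apply Z) : f.old = f.new := by
  have : f.old ∈ f.apply Z := h ▸ hf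
  rcases Finset.mem_insert.1 this with h1 | h1
  · exact h1
  · exact absurd rfl (Finset.ne_of_mem_erase h1)

/-- A configuration of type 1 has no `M₄` and one of type 2 has no `M₁`, so only one kind of loop is
possible. -/
theorem Site.kind_unique_of_loop {c : Config} {Z Z' : Finset Edge} {f f' : Flip} (hv : c.Valid)
    (h : Site c Z f) (h' : Site c Z' f') (hf : f.old = f.new) (hf' : f'.old = f'.new) :
    f.kind = f'.kind := by
  have k := h.kind_of_old_eq_new hv hf
  have k' := h'.kind_of_old_eq_new hv hf'
  cases h <;> simp at k <;> cases h' <;> simp at k' <;> rfl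

theorem DyckPath.eq_of_treeOf_eq {n : ℕ} {I J : DyckPath n} (h : treeOf I.steps = treeOf J.steps) :
    I = J := by
  have h1 : I.steps = J.steps := by
    rw [← word_parse I, ← word_parse J, Decomp.edges_injective rfl h]
  cases I; cases J
  simp only [DyckPath.mk.injEq]
  exact h1

/-- `IsMark Z Z' p c f`: on the canonical path of the pair `p`, with the configuration `c`, the
transition `Z → Z'` comes from the flip `f`. -/
structure IsMark {n : ℕ} (Z Z' : NCST n) (p : pairsUsing Z Z') (c : Config) (f : Flip) : Prop where
  valid : c.Valid
  fst_eq : treeOf p.1.1.steps = (direction p.1.1.steps p.1.2.steps).pick c.source c.target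
  snd_eq : treeOf p.1.2.steps = (direction p.1.1.steps p.1.2.steps).pick c.target c.source
  site : Site c ((direction p.1.1.steps p.1.2.steps).pick Z Z').1 f
  apply_eq : ((direction p.1.1.steps p.1.2.steps).pick Z' Z).1 =
    f.apply ((direction p.1.1.steps p.1.2.steps).pick Z Z').1
  occurs : ∃ t ∈ canonicalPath p.1.1.steps p.1.2.steps, t.src = Z.1 ∧ t.tgt = Z'.1 ∧
    t.kind = f.kind ∧ t.depth = f.depth
  unique : ∀ t ∈ canonicalPath p.1.1.steps p.1.2.steps, t.src = Z.1 → t.tgt = Z'.1 →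
    t.kind = f.kind ∧ (t.kind = .S1 ∨ t.kind = .S2 → t.depth = f.depth)

theorem Direction.pick_val {n : ℕ} (d : Direction) (Z Z' : NCST n) :
    d.pick Z.1 Z'.1 = (d.pick Z Z').1 := by
  cases d <;> rfl

theorem exists_isMark {n : ℕ} {Z Z' : NCST n} (p : pairsUsing Z Z') :
    ∃ c f, IsMark Z Z' p c f := by
  obtain ⟨⟨I, F⟩, hne, hpos, t, ht, hs, hg⟩ := p
  obtain ⟨c, hv, h1, h2, h3⟩ := exists_config_of_PAM_pos hne hpos
  obtain ⟨f, hf, ha, hk, hd⟩ := h3 t ht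
  rw [hs, hg, Direction.pick_val] at hf
  rw [hs, hg, Direction.pick_val, Direction.pick_val] at ha
  refine ⟨c, f, hv, h1, h2, hf, ha, ⟨t, ht, hs, hg, hk, hd⟩, fun t' ht' hs' hg' => ?_⟩
  obtain ⟨f', hf', ha', hk', hd'⟩ := h3 t' ht'
  rw [hs', hg', Direction.pick_val] at hf'
  rw [hs', hg', Direction.pick_val, Direction.pick_val] at ha'
  rw [hk', hd']
  -- In a loop the flipped edge is not visible, but the kind is still determined and no depth is
  -- involved. Otherwise the two ends determine the flip.
  by_cases he : ((direction I.steps F.steps).pick Z' Z).1 =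
      ((direction I.steps F.steps).pick Z Z').1
  · have o1 := old_eq_new_of_apply_eq hf.old_mem (he.symm.trans ha)
    have o2 := old_eq_new_of_apply_eq hf'.old_mem (he.symm.trans ha')
    refine ⟨hf'.kind_unique_of_loop hv hf o2 o1, fun hS => ?_⟩
    rcases hf'.kind_of_old_eq_new hv o2 with h | h <;> simp [h] at hS
  · obtain ⟨e1, e2⟩ := flip_unique hf'.old_mem ha' ha he
      (by rw [IsNCST.card_eq (Subtype.prop _), IsNCST.card_eq (Subtype.prop _)])
    exact ⟨hf'.kind_unique hf hv e1, fun hS => hf'.depth_unique hf rfl hv e1 e2 hS⟩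

theorem IsMark.pair_unique {n : ℕ} {Z Z' : NCST n} {p p' : pairsUsing Z Z'} {c c' : Config}
    {f f' : Flip} (h : IsMark Z Z' p c f) (h' : IsMark Z Z' p' c' f')
    (hdir : direction p.1.1.steps p.1.2.steps = direction p'.1.1.steps p'.1.2.steps)
    (hk : f.kind = f'.kind) (hd : f.kind = .S1 ∨ f.kind = .S2 → f.depth = f'.depth)
    (ho : f.old = f'.old) (hn : f.new = f'.new) : p = p' := by
  have hc : c = c' := by
    refine h.site.unique h'.site h.valid h'.valid (by rw [hdir]) (IsNCST.nonCrossing (Subtype.prop _))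
      ?_ ho hn hk hd
    rw [← h.apply_eq]
    exact IsNCST.nonCrossing (Subtype.prop _)
  subst hc
  refine Subtype.ext (Prod.ext ?_ ?_)
  · exact DyckPath.eq_of_treeOf_eq (by rw [h.fst_eq, h'.fst_eq, hdir])
  · exact DyckPath.eq_of_treeOf_eq (by rw [h.snd_eq, h'.snd_eq, hdir])

theorem IsMark.pair_unique_of_ne {n : ℕ} {Z Z' : NCST n} (hne : Z ≠ Z') {p p' : pairsUsing Z Z'}
    {c c' : Config} {f f' : Flip} (h : IsMark Z Z' p c f) (h' : IsMark Z Z' p' c' f')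
    (hdir : direction p.1.1.steps p.1.2.steps = direction p'.1.1.steps p'.1.2.steps)
    (hk : f.kind = f'.kind) (hd : f.kind = .S1 ∨ f.kind = .S2 → f.depth = f'.depth) : p = p' := by
  have ha' := h'.apply_eq
  rw [← hdir] at ha'
  obtain ⟨ho, hn⟩ := flip_unique h.site.old_mem h.apply_eq ha'
    (fun he => hne (by
      cases hD : direction p.1.1.steps p.1.2.steps <;> rw [hD] at he
      · exact (Subtype.ext he).symm
      · exact Subtype.ext he))
    (by rw [IsNCST.card_eq (Subtype.prop _), IsNCST.card_eq (Subtype.prop _)])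
  exact h.pair_unique h' hdir hk hd ho hn

theorem encard_code (n : ℕ) : ENat.card (Code n) ≤ 12 * n := by
  let g : Code n → Fin 2 × Fin 6 × Fin n := fun x =>
    (match x.1 with
      | .left => 0
      | .right => 1,
     match x.2.1 with
      | .M1 => 0
      | .M2 => 1
      | .M3 => 2
      | .M4 => 3
      | .S1 => 4
      | .S2 => 5,
     -- Depths start at one, elements of `Fin n` at zero.
     ⟨x.2.2 - 1, by have := x.2.2.2; omega⟩)
  have hg : Function.Injective g := by
    rintro ⟨d, m, k, hk⟩ ⟨d', m', k', hk'⟩ h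
    simp only [g, Prod.mk.injEq, Fin.mk.injEq] at h
    obtain ⟨h1, h2, h3⟩ := h
    have e1 : d = d' := by cases d <;> cases d' <;> simp at h1 ⊢
    have e2 : m = m' := by cases m <;> cases m' <;> simp at h2 ⊢
    have e3 : k = k' := by omega
    subst e1 e2 e3
    rfl
  refine (ENat.card_le_card_of_injective hg).trans ?_
  rw [ENat.card_eq_coe_fintype_card]
  simp only [Fintype.card_prod, Fintype.card_fin]
  exact_mod_cast (by omega : 2 * (6 * n) ≤ 12 * n)

theorem exists_injective_encoding {n : ℕ} (Z Z' : NCST n) :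
    ∃ φ : pairsUsing Z Z' → Code n, IsEncoding Z Z' φ ∧ Function.Injective φ := by
  choose c f hm using fun p : pairsUsing Z Z' => exists_isMark p
  let ι : {e // e ∈ Z.1} ≃ Fin n := Finset.equivFinOfCardEq Z.2.card_eq
  have loop : ∀ p, Z = Z' → (f p).old ∈ Z.1 ∧ (f p).old = (f p).new := by
    intro p h
    have h1 := (hm p).site.old_mem
    have h2 := (hm p).apply_eq
    subst h
    have h3 : (direction p.1.1.steps p.1.2.steps).pick Z Z = Z := by
      cases direction p.1.1.steps p.1.2.steps <;> rfl
    rw [h3] at h1 h2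
    exact ⟨h1, old_eq_new_of_apply_eq h1 h2⟩
  -- The two demands on `d` never conflict: a loop is never made by a shift flip, so its third entry
  -- is free to number the edge that is removed and put back.
  have key : ∀ p, ∃ d : {d : ℕ // 1 ≤ d ∧ d ≤ n},
      ((f p).kind = .S1 ∨ (f p).kind = .S2 → (d : ℕ) = (f p).depth) ∧
      ∀ h : Z = Z', (d : ℕ) = ι ⟨(f p).old, (loop p h).1⟩ + 1 := by
    intro p
    have hn : 1 ≤ n := by
      have := Finset.card_pos.2 ⟨_, (hm p).site.old_mem⟩
      rw [IsNCST.card_eq (Subtype.prop _)] at this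
      exact this
    by_cases h : Z = Z'
    · refine ⟨⟨ι ⟨(f p).old, (loop p h).1⟩ + 1, by omega, by omega⟩, fun hS => ?_, fun _ => rfl⟩
      rcases (hm p).site.kind_of_old_eq_new (hm p).valid (loop p h).2 with h1 | h1 <;>
        simp [h1] at hS
    · by_cases hS : (f p).kind = .S1 ∨ (f p).kind = .S2
      · have := (hm p).site.depth_bounds hS
        rw [← (hm p).apply_eq, IsNCST.card_eq (Subtype.prop _),
          IsNCST.card_eq (Subtype.prop _)] at this
        exact ⟨⟨(f p).depth, by omega, by omega⟩, fun _ => rfl, fun h' => absurd h' h⟩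
      · exact ⟨⟨1, le_rfl, hn⟩, fun h' => absurd h' hS, fun h' => absurd h' h⟩
  choose d hd hl using key
  refine ⟨fun p => (direction p.1.1.steps p.1.2.steps, (f p).kind, d p), fun p => ⟨rfl, ?_⟩, ?_⟩
  · intro t ht hs hg
    obtain ⟨h1, h2⟩ := (hm p).unique t ht hs hg
    exact ⟨h1.symm, fun hS => by rw [h2 hS]; exact hd p (h1 ▸ hS)⟩
  · intro p p' hpp
    simp only [Prod.mk.injEq] at hpp
    obtain ⟨h1, h2, h3⟩ := hpp
    have hS : (f p).kind = .S1 ∨ (f p).kind = .S2 → (f p).depth = (f p').depth := fun h => by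
      rw [← hd p h, ← hd p' (h2 ▸ h), h3]
    by_cases h : Z = Z'
    · have e1 := hl p h
      rw [h3, hl p' h] at e1
      have e2 : ι ⟨(f p').old, (loop p' h).1⟩ = ι ⟨(f p).old, (loop p h).1⟩ := by
        apply Fin.ext
        omega
      have e3 : (f p').old = (f p).old := congrArg Subtype.val (ι.injective e2)
      exact (hm p).pair_unique (hm p') h1 h2 hS e3.symm
        (by rw [← (loop p h).2, ← (loop p' h).2, e3])
    · exact (hm p).pair_unique_of_ne h (hm p') h1 h2 hS

theorem injective_of_isEncoding {n : ℕ} {Z Z' : NCST n} (hne : Z ≠ Z')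
    {φ : pairsUsing Z Z' → Code n} (hφ : IsEncoding Z Z' φ) : Function.Injective φ := by
  intro p p' hpp
  obtain ⟨c, f, hm⟩ := exists_isMark p
  obtain ⟨c', f', hm'⟩ := exists_isMark p'
  obtain ⟨t, ht, hs, hg, hk, hd⟩ := hm.occurs
  obtain ⟨t', ht', hs', hg', hk', hd'⟩ := hm'.occurs
  obtain ⟨d1, e1⟩ := hφ p
  obtain ⟨d2, e2⟩ := hφ p'
  obtain ⟨k1, s1⟩ := e1 t ht hs hg
  obtain ⟨k2, s2⟩ := e2 t' ht' hs' hg'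
  have hkk : f.kind = f'.kind := by rw [← hk, ← hk', ← k1, ← k2, hpp]
  refine hm.pair_unique_of_ne hne hm' (by rw [← d1, ← d2, hpp]) hkk fun hS => ?_
  rw [← hd, ← hd', ← s1 (hk ▸ hS), ← s2 (by rw [hk', ← hkk]; exact hS), hpp]

end FlipChain

theorem mainTheorem4 (n : ℕ) (Z Z' : FlipChain.NCST n) (hZ : 0 < FlipChain.PFM Z Z') :
    (∃ φ : FlipChain.pairsUsing Z Z' → FlipChain.Code n,
      FlipChain.IsEncoding Z Z' φ ∧ Function.Injective φ) ∧
    (Z ≠ Z' → ∀ φ : FlipChain.pairsUsing Z Z' → FlipChain.Code n,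
      FlipChain.IsEncoding Z Z' φ → Function.Injective φ) ∧
    (FlipChain.pairsUsing Z Z').encard ≤ 12 * n := by
  obtain ⟨φ, hφ, hinj⟩ := FlipChain.exists_injective_encoding Z Z'
  exact ⟨⟨φ, hφ, hinj⟩, fun hne ψ hψ => FlipChain.injective_of_isEncoding hne hψ,
    (ENat.card_le_card_of_injective hinj).trans (FlipChain.encard_code n)⟩
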